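/- **Setting.** Let $T>0$, let $\mu$ be a finite Borel measure on $[0,T]$, and let $X=(X_t)$, $u=(u_t)$, $t\in[0,T]$, be real processes on a probability space $(\Omega,\mathcal F,\mathbb P_u)$ such that $X^u:=X-u$ is a centered Gaussian process with covariance $\gamma(s,t)=\mathbb E_u[X^u_sX^u_t]$, jointly measurable ($\mathbb P_u\otimes\mu$), with $\int_0^T\gamma(t,t)\,\mu(dt)<\infty$. Let $H$ be the Hilbert space generated by vectors $\chi_t$, $t\in[0,T]$, with $\langle\chi_s,\chi_t\rangle_H=\gamma(s,t)$ (realized as the closed linear span of the $X^u_t$ in $L^2(\mathbb P_u)$, with $\chi_t=X^u_t$), let $X^u:H\to L^2(\mathbb P_u)$ be the isometry with $X^u(\chi_t)=X^u_t$, and let $(h_n)_{n\ge1}$ be a sequence with dense linear span in $H$. For $F=f(X^u(h_1),\dots,X^u(h_n))$, $n\ge 1$, $f$ a Schwartz function on $\mathbb R^n$, put $DF=\sum_{i}\partial_if(X^u(h_1),\dots,X^u(h_n))\,h_i$. Let $\mathrm{Dom}(D)\subset L^2(\mathbb P_u)$ be the domain of the closure $D$ of this operator from $L^2(\mathbb P_u)$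 to $L^2(\mathbb P_u;H)$, and $D_tF=\langle\chi_t,DF\rangle_H$. Write $\Delta F=\int_0^TD_tD_tF\,\mu(dt)$. As usual, $D$ is extended to $\mathrm{Dom}_{loc}(D)$: $F\in\mathrm{Dom}_{loc}(D)$ with derivative $DF$ if there are events $A_k$ increasing to an event of probability one and $F_k\in\mathrm{Dom}(D)$ with $F=F_k$ and $DF=DF_k$ a.s. on $A_k$. Put $R(\gamma,\mu,\hat u)=\mathbb E_u\|X-u\|^2_{L^2(\mu)}$. **Theorem.** $R(\gamma,\mu,\hat u)=\int_0^T\gamma(t,t)\,\mu(dt)$, and the following hold. (i) *Unbiased risk estimate.* For every $\xi\in L^2(\Omega\times[0,T],\mathbb P_u\otimes\mu)$ such that $\xi_t\in\mathrm{Dom}(D)$ for all $t\in[0,T]$ and $(D_t\xi_t)_t\in L^1(\Omega\times[0,T],\mathbb P_u\otimes\mu)$, the error $X+\xi-u$ is in $L^2(\mathbb P_u\otimes\mu)$ and $$\mathbb E_u\|X+\xi-u\|^2_{L^2(\mu)}=R(\gamma,\mu,\hat u)+\|\xi\|^2_{L^2(\mathbb P_u\otimes\mu)}+2\,\mathbb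 E_u\Big[\int_0^TD_t\xi_t\,\mu(dt)\Big].$$ (ii) *Stein-type estimator.* Let $F\in\mathrm{Dom}(D)$ be $\mathbb P_u$-a.s. positive with $D_tF\in\mathrm{Dom}(D)$ for all $t\in[0,T]$ and $(D_tD_tF)_t\in L^1(\Omega\times[0,T],\mathbb P_u\otimes\mu)$. Then $\log F\in\mathrm{Dom}_{loc}(D)$ with $D\log F=DF/F$ a.s., uniquely; and $\Delta\sqrt F$ exists, i.e. $\sqrt F$ and all $D_t\sqrt F$ are in $\mathrm{Dom}_{loc}(D)$, with $(D_tD_t\sqrt F)_t$ jointly measurable and a.s. $\mu$-integrable. If moreover $\mathbb E_u[(\Delta F/F)^+]<\infty$ (so that $\mathbb E_u[\Delta F/F]$ is defined), then $D\log F\in L^2(\mathbb P_u\otimes\mu)$, the variables $\Delta F/F$ and $\Delta\sqrt F/\sqrt F$ are $\mathbb P_u$-integrable, and $$\begin{aligned}\mathbb E_u\|X+D\log F-u\|^2_{L^2(\mu)}&=R(\gamma,\mu,\hat u)-\mathbb E_u\|D\log F\|^2_{L^2(\mu)}+2\,\mathbb E_u\Big[\frac{\Delta F}{F}\Big]\\&=R(\gamma,\mu,\hat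 u)+4\,\mathbb E_u\Big[\frac{\Delta\sqrt F}{\sqrt F}\Big].\end{aligned}$$ Consequently, if also $\Delta\sqrt F\le0$ a.s., the risk of $X+D\log F$ is at most $R(\gamma,\mu,\hat u)$, with strict inequality if and only if $\Delta\sqrt F$ is not a.s. zero. This comparison, together with $D\log F\in L^2(\mathbb P_u\otimes\mu)$, also holds without the condition on $\Delta F/F$ if $\sqrt F\in\mathrm{Dom}(D)$, $D_t\sqrt F\in\mathrm{Dom}(D)$ for all $t\in[0,T]$, $(D_tD_t\sqrt F)_t\in L^1(\mathbb P_u\otimes\mu)$ and $\Delta\sqrt F\le0$ a.s. -/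

import Mathlib

open MeasureTheory ProbabilityTheory Filter Topology
open scoped ENNReal SchwartzMap

/-- The Hilbert space `H` of a centered square-integrable process `Y`: the closed linear span of
the variables `Y t` in `L²(P)`. Write `χ_t` for the class of `Y t`; then the `χ_t` are total in `H`
and `⟪χ_s, χ_t⟫ = E[Y_s Y_t]`, so `H` is the completion of the span of the `χ_t` for the scalar
product given by the covariance. The isometry `h ↦ Y(h)`, `Y(χ_t) = Y t`, of `H` into `L²(P)` is
the inclusion. -/
noncomputable abbrev GaussHilbert {Ω ι : Type*} [MeasurableSpace Ω] (P : Measure Ω) (Y : ι → Ω → ℝ) :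
    Submodule ℝ (Lp ℝ 2 P) :=
  (Submodule.span ℝ {g : Lp ℝ 2 P | ∃ t, g =ᵐ[P] Y t}).topologicalClosure

/-- The isometry `h ↦ Y(h)` from `H` to square-integrable random variables. -/
noncomputable def gaussVar {Ω ι : Type*} [MeasurableSpace Ω] {P : Measure Ω} {Y : ι → Ω → ℝ}
    (g : GaussHilbert P Y) : Ω → ℝ :=
  ((g : Lp ℝ 2 P) : Ω → ℝ)

/-- `(Γ g)(t) = ⟪χ_t, g⟫_H = E[Y_t Y(g)]`, for `g ∈ H`. -/
noncomputable def covOp {Ω ι : Type*} [MeasurableSpace Ω] {P : Measure Ω} {Y : ι → Ω → ℝ}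
    (g : GaussHilbert P Y) (t : ι) : ℝ :=
  ∫ ω, Y t ω * gaussVar g ω ∂P

/-- The cylindrical functional `f(Y(h_0), …, Y(h_n))`, `f` a Schwartz function. -/
noncomputable def cylFun {Ω ι : Type*} [MeasurableSpace Ω] {P : Measure Ω} {Y : ι → Ω → ℝ}
    (h : ℕ → GaussHilbert P Y) (n : ℕ) (f : 𝓢(Fin (n + 1) → ℝ, ℝ)) (ω : Ω) : ℝ :=
  f (fun i => gaussVar (h i) ω)

/-- The derivative `∑ i, ∂ᵢf(Y(h_0), …, Y(h_n)) hᵢ` of a cylindrical functional, as an `H`-valued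
random variable. Its value at time `t` is `∑ i, (Γ hᵢ)(t) ∂ᵢf(Y(h_0), …, Y(h_n))`. -/
noncomputable def cylDeriv {Ω ι : Type*} [MeasurableSpace Ω] {P : Measure Ω} {Y : ι → Ω → ℝ}
    (h : ℕ → GaussHilbert P Y) (n : ℕ) (f : 𝓢(Fin (n + 1) → ℝ, ℝ)) (ω : Ω) : GaussHilbert P Y :=
  ∑ i : Fin (n + 1),
    (fderiv ℝ f (fun j => gaussVar (h j) ω) (Pi.single i 1)) • h i

/-- `F ∈ Dom(D)` with `DF = G`: the pair `(F, G)` lies in the closure, in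
`L²(P) × L²(P; H)`, of the graph of the derivative on cylindrical functionals. -/
def HasMalliavinDeriv {Ω ι : Type*} [MeasurableSpace Ω] {P : Measure Ω} {Y : ι → Ω → ℝ}
    (h : ℕ → GaussHilbert P Y) (F : Ω → ℝ) (G : Ω → GaussHilbert P Y) : Prop :=
  MemLp F 2 P ∧ MemLp G 2 P ∧
  ∃ (n : ℕ → ℕ) (f : ∀ k, 𝓢(Fin (n k + 1) → ℝ, ℝ)),
    Tendsto (fun k => eLpNorm (fun ω => cylFun h (n k) (f k) ω - F ω) 2 P) atTop (𝓝 0) ∧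
    Tendsto (fun k => eLpNorm (fun ω => cylDeriv h (n k) (f k) ω - G ω) 2 P) atTop (𝓝 0)

/-- The usual localization: `F ∈ Dom_loc(D)` with `DF = G` if there are events `A k` increasing to
an event of full probability and `F k ∈ Dom(D)` with `F = F k` and `G = D (F k)` a.s. on `A k`. -/
def HasLocalMalliavinDeriv {Ω ι : Type*} [MeasurableSpace Ω] {P : Measure Ω} {Y : ι → Ω → ℝ}
    (h : ℕ → GaussHilbert P Y) (F : Ω → ℝ) (G : Ω → GaussHilbert P Y) : Prop :=
  ∃ (A : ℕ → Set Ω) (Fk : ℕ → Ω → ℝ) (Gk : ℕ → Ω → GaussHilbert P Y),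
    (∀ k, MeasurableSet (A k)) ∧ Monotone A ∧ (∀ᵐ ω ∂P, ∃ k, ω ∈ A k) ∧
    (∀ k, HasMalliavinDeriv h (Fk k) (Gk k)) ∧
    ∀ k, ∀ᵐ ω ∂P, ω ∈ A k → F ω = Fk k ω ∧ G ω = Gk k ω

/-- `D_t F` at `ω`, for a derivative `G = DF` given as an `H`-valued random variable:
`D_t F = ⟪χ_t, DF⟫_H`. -/
noncomputable def derivAt {Ω ι : Type*} [MeasurableSpace Ω] {P : Measure Ω} {Y : ι → Ω → ℝ}
    (G : Ω → GaussHilbert P Y) (t : ι) (ω : Ω) : ℝ :=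
  covOp (G ω) t

/-- The trace `∫ D_t ξ_t μ(dt)` at `ω`, for a family `G t = D ξ_t` of derivatives. For
`ξ_t = D_t F` it is the Laplacian `ΔF = ∫ D_t D_t F μ(dt)`. -/
noncomputable def traceDeriv {Ω ι : Type*} [MeasurableSpace Ω] [MeasurableSpace ι]
    {P : Measure Ω} {Y : ι → Ω → ℝ} (μ : Measure ι) (G : ι → Ω → GaussHilbert P Y) (ω : Ω) : ℝ :=
  ∫ t, derivAt (G t) t ω ∂μ

/-- `F ∈ Dom(D)`, `D_t F ∈ Dom(D)` for all `t`, and `(D_t D_t F)_t ∈ L¹(P ⊗ μ)`, where `G = DF`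
and `G2 t = D (D_t F)`. -/
structure IsTwiceMalliavin {Ω ι : Type*} [MeasurableSpace Ω] [MeasurableSpace ι]
    {P : Measure Ω} {Y : ι → Ω → ℝ} (h : ℕ → GaussHilbert P Y) (μ : Measure ι)
    (F : Ω → ℝ) (G : Ω → GaussHilbert P Y) (G2 : ι → Ω → GaussHilbert P Y) : Prop where
  deriv : HasMalliavinDeriv h F G
  deriv_deriv : ∀ t, HasMalliavinDeriv h (derivAt G t) (G2 t)
  integrable : Integrable (fun p : Ω × ι => derivAt (G2 p.2) p.2 p.1) (P.prod μ)

/-- `L = ΔF` a.s., the derivatives in `ΔF = ∫ D_t D_t F μ(dt)` being understood in the local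
domain of `D`, with `(D_t D_t F)_t` jointly measurable and a.s. `μ`-integrable in `t`. -/
def HasLocalLaplacian {Ω ι : Type*} [MeasurableSpace Ω] [MeasurableSpace ι]
    {P : Measure Ω} {Y : ι → Ω → ℝ} (h : ℕ → GaussHilbert P Y) (μ : Measure ι)
    (F L : Ω → ℝ) : Prop :=
  ∃ (G : Ω → GaussHilbert P Y) (G2 : ι → Ω → GaussHilbert P Y),
    HasLocalMalliavinDeriv h F G ∧
    (∀ t, HasLocalMalliavinDeriv h (derivAt G t) (G2 t)) ∧
    AEStronglyMeasurable (fun p : Ω × ι => derivAt (G2 p.2) p.2 p.1) (P.prod μ) ∧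
    (∀ᵐ ω ∂P, Integrable (fun t => derivAt (G2 t) t ω) μ) ∧
    L =ᵐ[P] traceDeriv μ G2

/-- The quadratic risk `E ‖Z - u‖²_{L²(μ)}` of an estimator `Z` of the drift `u`. -/
noncomputable def quadRisk {Ω ι : Type*} [MeasurableSpace Ω] [MeasurableSpace ι]
    (P : Measure Ω) (μ : Measure ι) (Z u : ι → Ω → ℝ) : ℝ :=
  ∫ ω, ∫ t, (Z t ω - u t ω) ^ 2 ∂μ ∂P

/-!
The process `Y = X - u` is a centred Gaussian process, and everything rests on Gaussian integration
by parts, `E[F Y(g)] = E⟪DF, g⟫` for `F` in `Dom(D)` (`HasMalliavinDeriv.integral_mul_gaussVar`).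
For a cylindrical functional one splits the vectors `h i` into their components along `g` and an
orthogonal part. The orthogonal part is independent of `Y(g)`, since elements of the Gaussian
Hilbert space have the characteristic functions of centred Gaussian variables, so that Stein's
identity in one variable applies (`integral_mul_gaussVar_eq`). With `ξ_t` for `F` and `χ_t` for `g`
it gives `E ∫ Y_t ξ_t μ(dt) = E ∫ D_t ξ_t μ(dt)`, and expanding the square (`quadRisk_add`) gives
the unbiased risk estimate.

The derivative is local: `DF = 0` a.s. on `{F = 0}` (`HasMalliavinDeriv.ae_eq_zero`). To see this,
integrate by parts with functions `arctan (c F) / c`, which tend uniformly to zero while their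
derivatives tend boundedly to the indicator function of `{F = 0}`. Hence derivatives in the local
domain are unique (`HasLocalMalliavinDeriv.ae_eq`). The chain rule, applied to bounded smooth
functions that agree with `log`, `√` and `1 / (2 √)` on large parts of `(0, ∞)`, shows that
`log F`, `√F` and `D_t √F` lie in the local domain, with the expected derivatives.

For the Stein-type estimator put `η_t = D_t F / F`. The central identity is
`E ∫ Y_t η_t μ(dt) = E[ΔF / F] - E ∫ η_t² μ(dt)`, together with the integrability of its terms
(`integral_process_mul_log_deriv`). Replace `1 / x` by a bounded smooth function `a` with
`a(x) ≤ 1 / x` and `a(x)² / 2 ≤ -a'(x) ≤ a(x)²` for `x > 0` (`softInv`). Integration by parts for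
`a(F) D_t F` bounds half of `E ∫ (a(F) D_t F)² dμ` by `E[(ΔF / F)⁺] - E ∫ Y_t a(F) D_t F dμ`, and
the last term is absorbed by means of `|y ξ| ≤ y² + ξ² / 4`. Fatou's lemma yields the
integrability, and dominated convergence the identity. Since
`Δ√F / √F = ΔF / (2 F) - ∫ η_t² μ(dt) / 4`, both expressions of the risk follow. If `√F` is itself
twice differentiable with `Δ√F ≤ 0`, the condition on the positive part is void for `√F`, and the
central identity for `√F`, with `log F = 2 log √F`, gives the comparison directly.
-/

/-! ### Gaussian Hilbert spaces -/

section GaussianSpace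

variable {Ω ι : Type*} [MeasurableSpace Ω] {P : Measure Ω} {Y : ι → Ω → ℝ}

lemma memLp_gaussVar (g : GaussHilbert P Y) : MemLp (gaussVar g) 2 P := Lp.memLp _

lemma gaussHilbert_inner_smul_left (c : ℝ) (g k : GaussHilbert P Y) :
    inner ℝ (c • g) k = c * inner ℝ g k := real_inner_smul_left g k c

lemma gaussHilbert_inner_smul_right (c : ℝ) (g k : GaussHilbert P Y) :
    inner ℝ g (c • k) = c * inner ℝ g k := real_inner_smul_right g k c

lemma gaussVar_add (g k : GaussHilbert P Y) :
    gaussVar (g + k) =ᵐ[P] fun ω => gaussVar g ω + gaussVar k ω :=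
  Lp.coeFn_add (g : Lp ℝ 2 P) k

lemma gaussVar_smul (c : ℝ) (g : GaussHilbert P Y) :
    gaussVar (c • g) =ᵐ[P] fun ω => c * gaussVar g ω :=
  Lp.coeFn_smul c (g : Lp ℝ 2 P)

lemma gaussVar_sum {n : ℕ} (b : Fin n → ℝ) (k : Fin n → GaussHilbert P Y) :
    gaussVar (∑ i, b i • k i) =ᵐ[P] fun ω => ∑ i, b i * gaussVar (k i) ω := by
  induction n with
  | zero =>
    simp only [Finset.univ_eq_empty, Finset.sum_empty]
    exact Lp.coeFn_zero ℝ 2 P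
  | succ n ih =>
    simp only [Fin.sum_univ_succ]
    filter_upwards [gaussVar_add (b 0 • k 0) (∑ i : Fin n, b i.succ • k i.succ),
      gaussVar_smul (b 0) (k 0), ih (fun i => b i.succ) (fun i => k i.succ)] with ω h1 h2 h3
    rw [h1, h2, h3]

lemma inner_eq_integral_gaussVar (g k : GaussHilbert P Y) :
    inner ℝ g k = ∫ ω, gaussVar g ω * gaussVar k ω ∂P := by
  rw [Submodule.coe_inner, L2.inner_def]
  refine integral_congr_ae (ae_of_all _ fun ω => ?_)
  simp [gaussVar, mul_comm]

/-- The characteristic function of an `L²` variable in the linear span of a centred Gaussian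
process. -/
lemma integral_cexp_of_mem_span [IsProbabilityMeasure P] (hgauss : IsGaussianProcess Y P)
    (hmean : ∀ t, ∫ ω, Y t ω ∂P = 0) {v : Lp ℝ 2 P}
    (hv : v ∈ Submodule.span ℝ {g : Lp ℝ 2 P | ∃ t, g =ᵐ[P] Y t}) :
    ∫ ω, Complex.exp (Complex.I * v ω) ∂P = Complex.exp (-((‖v‖ ^ 2 : ℝ) : ℂ) / 2) := by
  obtain ⟨n, c, g, rfl⟩ := Submodule.mem_span_set'.1 hv
  choose t ht using fun i => (g i).2
  set v : Lp ℝ 2 P := ∑ i, c i • (g i : Lp ℝ 2 P) with hvdef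
  have hY2 : ∀ i, MemLp (Y (t i)) 2 P := fun i => (hgauss.hasGaussianLaw_eval (t i)).memLp_two
  have hve : (v : Ω → ℝ) =ᵐ[P] fun ω => ∑ i, c i * Y (t i) ω := by
    have h1 : (v : Ω → ℝ) =ᵐ[P] ∑ i, ((c i • (g i : Lp ℝ 2 P) : Lp ℝ 2 P) : Ω → ℝ) :=
      Lp.coeFn_finsetSum _ _
    have h2 : ∀ᵐ ω ∂P, ∀ i, (c i • (g i : Lp ℝ 2 P) : Lp ℝ 2 P) ω = c i * Y (t i) ω := by
      rw [ae_all_iff]; intro i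
      filter_upwards [Lp.coeFn_smul (c i) (g i : Lp ℝ 2 P), ht i] with ω a b
      rw [a, Pi.smul_apply, b, smul_eq_mul]
    filter_upwards [h1, h2] with ω a b
    rw [a, Finset.sum_apply]
    exact Finset.sum_congr rfl fun i _ => b i
  have hG : HasGaussianLaw (v : Ω → ℝ) P := by
    have := ((hgauss.comp_right t).smul c).hasGaussianLaw_fun_sum (I := Finset.univ)
    refine this.congr ?_
    filter_upwards [hve] with ω a
    rw [a]; simp
  have hm : ∫ ω, v ω ∂P = 0 := by
    rw [integral_congr_ae hve, integral_finsetSum]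
    · simp [integral_const_mul, hmean]
    · exact fun i _ => ((hY2 i).integrable one_le_two).const_mul _
  have hlaw := hG.map_eq_gaussianReal
  have hch := congrArg (fun m => charFun m 1) hlaw
  simp only [charFun_gaussianReal] at hch
  rw [charFun_apply_real, integral_map hG.aemeasurable (by fun_prop)] at hch
  rw [hm, variance_eq_integral hG.aemeasurable, hm] at hch
  have hn : ∫ ω, (v ω - 0) ^ 2 ∂P = ‖v‖ ^ 2 := by
    rw [← real_inner_self_eq_norm_sq, L2.inner_def]
    refine integral_congr_ae (ae_of_all _ fun ω => ?_)
    simp [pow_two]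
  rw [hn, Real.coe_toNNReal _ (by positivity)] at hch
  simp only [Complex.ofReal_one, one_mul, Complex.ofReal_zero, mul_zero, zero_mul, zero_sub,
    one_pow, mul_one] at hch
  simp only [mul_comm Complex.I]
  rw [hch]
  congr 1
  ring

/-- Every element `k` of the Gaussian Hilbert space is a centred Gaussian variable with variance
`‖k‖²`, by passing to the limit in the characteristic functions. -/
lemma integral_cexp_gaussVar [IsProbabilityMeasure P] (hgauss : IsGaussianProcess Y P)
    (hmean : ∀ t, ∫ ω, Y t ω ∂P = 0) (k : GaussHilbert P Y) :
    ∫ ω, Complex.exp (Complex.I * gaussVar k ω) ∂P = Complex.exp (-((‖k‖ ^ 2 : ℝ) : ℂ) / 2) := by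
  obtain ⟨v, hv⟩ := k
  change ∫ ω, Complex.exp (Complex.I * v ω) ∂P = Complex.exp (-((‖v‖ ^ 2 : ℝ) : ℂ) / 2)
  rw [← SetLike.mem_coe, Submodule.topologicalClosure_coe] at hv
  obtain ⟨w, hw, hlim⟩ := mem_closure_iff_seq_limit.1 hv
  obtain ⟨ns, hns, hae⟩ := (tendstoInMeasure_of_tendsto_Lp hlim).exists_seq_tendsto_ae
  have h1 : Tendsto (fun i => ∫ ω, Complex.exp (Complex.I * w (ns i) ω) ∂P) atTop
      (𝓝 (∫ ω, Complex.exp (Complex.I * v ω) ∂P)) := by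
    refine tendsto_integral_of_dominated_convergence (fun _ => 1) (fun i => ?_)
      (integrable_const _) (fun i => ae_of_all _ fun ω => ?_) ?_
    · have := (Lp.aestronglyMeasurable (w (ns i))).aemeasurable
      exact AEMeasurable.aestronglyMeasurable (by fun_prop)
    · rw [mul_comm, Complex.norm_exp_ofReal_mul_I]
    · filter_upwards [hae] with ω hω
      exact ((Complex.continuous_exp.comp
        (continuous_const.mul Complex.continuous_ofReal)).tendsto _).comp hω
  have h2 : Tendsto (fun i => Complex.exp (-((‖w (ns i)‖ ^ 2 : ℝ) : ℂ) / 2)) atTop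
      (𝓝 (Complex.exp (-((‖v‖ ^ 2 : ℝ) : ℂ) / 2))) := by
    have hc : Continuous fun x : Lp ℝ 2 P => Complex.exp (-((‖x‖ ^ 2 : ℝ) : ℂ) / 2) := by fun_prop
    exact (hc.tendsto v).comp (hlim.comp hns.tendsto_atTop)
  refine tendsto_nhds_unique h1 (h2.congr fun i => ?_)
  exact (integral_cexp_of_mem_span hgauss hmean (hw _)).symm

lemma map_gaussVar [IsProbabilityMeasure P] (hgauss : IsGaussianProcess Y P)
    (hmean : ∀ t, ∫ ω, Y t ω ∂P = 0) (k : GaussHilbert P Y) :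
    P.map (gaussVar k) = gaussianReal 0 (‖k‖ ^ 2).toNNReal := by
  have hk := (memLp_gaussVar k).aestronglyMeasurable.aemeasurable
  have := Measure.isProbabilityMeasure_map hk
  refine Measure.ext_of_charFun (funext fun t => ?_)
  rw [charFun_gaussianReal, charFun_apply_real, integral_map hk (by fun_prop)]
  have h1 := integral_cexp_gaussVar hgauss hmean (t • k)
  rw [Real.coe_toNNReal _ (by positivity)]
  calc _ = ∫ ω, Complex.exp (Complex.I * gaussVar (t • k) ω) ∂P := by
        refine integral_congr_ae ?_
        filter_upwards [gaussVar_smul t k] with ω hω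
        rw [hω]; push_cast; ring_nf
    _ = _ := by
        rw [h1, norm_smul, mul_pow, Real.norm_eq_abs, sq_abs]
        congr 1
        push_cast; ring

/-- Orthogonal elements of the Gaussian Hilbert space are independent. -/
lemma indepFun_gaussVar [IsProbabilityMeasure P] (hgauss : IsGaussianProcess Y P)
    (hmean : ∀ t, ∫ ω, Y t ω ∂P = 0) (g : GaussHilbert P Y) {n : ℕ} (k : Fin n → GaussHilbert P Y)
    (hk : ∀ i, inner ℝ g (k i) = 0) :
    IndepFun (gaussVar g) (fun ω i => gaussVar (k i) ω) P := by
  have hg := (memLp_gaussVar g).aestronglyMeasurable.aemeasurable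
  have hkm : AEMeasurable (fun ω i => gaussVar (k i) ω) P :=
    aemeasurable_pi_lambda _ fun i => (memLp_gaussVar (k i)).aestronglyMeasurable.aemeasurable
  have key : ∀ (a : ℝ) (b : Fin n → ℝ),
      ∫ ω, Complex.exp (((a * gaussVar g ω + ∑ i, b i * gaussVar (k i) ω : ℝ) : ℂ) * Complex.I) ∂P
        = Complex.exp (-((‖a • g + ∑ i, b i • k i‖ ^ 2 : ℝ) : ℂ) / 2) := by
    intro a b
    rw [← integral_cexp_gaussVar hgauss hmean]
    refine integral_congr_ae ?_
    filter_upwards [gaussVar_add (a • g) (∑ i, b i • k i), gaussVar_smul a g, gaussVar_sum b k]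
      with ω h1 h2 h3
    rw [h1, h2, h3, mul_comm]
  rw [indepFun_iff_charFunDual_prod hg hkm]
  intro L
  have hL : ∀ (x : ℝ) (y : Fin n → ℝ),
      L (x, y) = L (1, 0) * x + ∑ i, L (0, Pi.single i 1) * y i := by
    intro x y
    have e : (x, y) = x • ((1 : ℝ), (0 : Fin n → ℝ))
        + ∑ i, y i • ((0 : ℝ), (Pi.single i (1 : ℝ) : Fin n → ℝ)) := by
      refine Prod.ext ?_ ?_
      · simp [Prod.fst_sum]
      · simp only [Prod.snd_add, Prod.smul_snd, Prod.snd_sum, smul_zero, zero_add]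
        ext j
        simp [Finset.sum_apply, Pi.single_apply]
    rw [e, map_add, map_smul, map_sum]
    simp only [map_smul, smul_eq_mul, mul_comm]
  set a := L (1, 0)
  set b : Fin n → ℝ := fun i => L (0, Pi.single i 1)
  have e0 := key a b
  have e1 := key a 0
  have e2 := key 0 b
  simp only [charFunDual_apply]
  rw [integral_map (hg.prodMk hkm) (by fun_prop), integral_map hg (by fun_prop),
    integral_map hkm (by fun_prop)]
  simp only [ContinuousLinearMap.comp_apply, ContinuousLinearMap.inl_apply,
    ContinuousLinearMap.inr_apply]
  have horth : inner ℝ (a • g) (∑ i, b i • k i) = 0 := by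
    rw [inner_sum]
    refine Finset.sum_eq_zero fun i _ => ?_
    rw [gaussHilbert_inner_smul_left, gaussHilbert_inner_smul_right, hk]; simp
  have hnorm := norm_add_sq_real (a • g) (∑ i, b i • k i)
  rw [horth] at hnorm
  have hLab : ∀ (x : ℝ) (y : Fin n → ℝ), L (x, y) = a * x + ∑ i, b i * y i := hL
  simp only [hLab]
  have z1 : a • g + ∑ i, (0 : Fin n → ℝ) i • k i = a • g := by
    have : ∑ i, (0 : Fin n → ℝ) i • k i = 0 :=
      Finset.sum_eq_zero fun i _ => zero_smul ℝ (k i)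
    rw [this, add_zero]
  have z2 : (0 : ℝ) • g + ∑ i, b i • k i = ∑ i, b i • k i := by
    rw [show (0 : ℝ) • g = 0 from zero_smul ℝ g, zero_add]
  rw [z1] at e1
  rw [z2] at e2
  simp only [Pi.zero_apply, zero_mul, mul_zero, Finset.sum_const_zero, add_zero, zero_add]
    at e1 e2 ⊢
  rw [e0, e1, e2, ← Complex.exp_add, hnorm]
  congr 1
  push_cast; ring

end GaussianSpace

/-! ### Gaussian integration by parts -/

/-- One-dimensional Gaussian integration by parts (Stein's identity). -/
lemma integral_id_mul_gaussianReal (v : NNReal) {φ φ' : ℝ → ℝ}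
    (hφ : ∀ x, HasDerivAt φ (φ' x) x) (hφ' : Continuous φ') {C : ℝ}
    (hb : ∀ x, |φ x| ≤ C) (hb' : ∀ x, |φ' x| ≤ C) :
    ∫ x, x * φ x ∂(gaussianReal 0 v) = v * ∫ x, φ' x ∂(gaussianReal 0 v) := by
  by_cases hv : v = 0
  · subst hv; simp
  have hv' : (v : ℝ) ≠ 0 := by exact_mod_cast hv
  have hcont : Continuous φ := continuous_iff_continuousAt.2 fun x => (hφ x).continuousAt
  have hpdf : ∀ x, HasDerivAt (gaussianPDFReal 0 v) (-(x / v) * gaussianPDFReal 0 v x) x := by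
    intro x
    have h1 : HasDerivAt (fun y : ℝ => -(y - 0) ^ 2 / (2 * v)) (-(x / v)) x := by
      have := ((((hasDerivAt_id x).sub_const 0).pow 2).neg).div_const (2 * (v : ℝ))
      refine this.congr_deriv ?_
      simp; field_simp
    have := (h1.exp).const_mul ((√(2 * Real.pi * v))⁻¹)
    refine this.congr_deriv ?_
    simp only [gaussianPDFReal]; ring
  have hint : ∀ f : ℝ → ℝ, Integrable f (gaussianReal 0 v) →
      Integrable (fun x => gaussianPDFReal 0 v x * f x) := by
    intro f hf
    rw [gaussianReal_of_var_ne_zero _ hv, integrable_withDensity_iff_integrable_smul'] at hf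
    · refine hf.congr (ae_of_all _ fun x => ?_)
      simp [gaussianPDF, ENNReal.toReal_ofReal (gaussianPDFReal_nonneg 0 v x)]
    · exact measurable_gaussianPDF 0 v
    · exact ae_of_all _ fun x => by simp [gaussianPDF]
  have hid : Integrable (fun x : ℝ => x) (gaussianReal 0 v) :=
    (memLp_id_gaussianReal (μ := 0) (v := v) 1).integrable (by simp)
  have i1 : Integrable (fun x => x * φ x) (gaussianReal 0 v) :=
    hid.mul_bdd (c := C) hcont.aestronglyMeasurable (ae_of_all _ fun x => by simpa using hb x)
  have i2 : Integrable φ (gaussianReal 0 v) :=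
    Integrable.of_bound hcont.aestronglyMeasurable C (ae_of_all _ fun x => by simpa using hb x)
  have i3 : Integrable φ' (gaussianReal 0 v) :=
    Integrable.of_bound hφ'.aestronglyMeasurable C (ae_of_all _ fun x => by simpa using hb' x)
  rw [integral_gaussianReal_eq_integral_smul hv, integral_gaussianReal_eq_integral_smul hv]
  have h := integral_mul_deriv_eq_deriv_mul_of_integrable (u := φ) (v := gaussianPDFReal 0 v)
    (fun x _ => hφ x) (fun x _ => hpdf x)
    (by refine ((hint _ i1).const_mul (-(1 / (v : ℝ)))).congr (ae_of_all _ fun x => ?_)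
        simp only [Pi.mul_apply]; ring)
    (by refine (hint _ i3).congr (ae_of_all _ fun x => ?_)
        simp only [Pi.mul_apply]; ring)
    (by refine (hint _ i2).congr (ae_of_all _ fun x => ?_)
        simp only [Pi.mul_apply]; ring)
  have e1 : ∫ x, φ x * (-(x / v) * gaussianPDFReal 0 v x)
      = -(1 / (v : ℝ)) * ∫ x, gaussianPDFReal 0 v x • (x * φ x) := by
    rw [← integral_const_mul]
    congr 1; ext x; simp only [smul_eq_mul]; ring
  have e2 : ∫ x, φ' x * gaussianPDFReal 0 v x = ∫ x, gaussianPDFReal 0 v x • φ' x := by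
    congr 1; ext x; simp only [smul_eq_mul]; ring
  rw [e1, e2] at h
  field_simp at h
  linarith

section GaussianSpace

variable {Ω ι : Type*} [MeasurableSpace Ω] {P : Measure Ω} {Y : ι → Ω → ℝ}

lemma aemeasurable_gaussVar_pi {n : ℕ} (k : Fin n → GaussHilbert P Y) :
    AEMeasurable (fun ω i => gaussVar (k i) ω) P :=
  aemeasurable_pi_lambda _ fun i => (memLp_gaussVar (k i)).aestronglyMeasurable.aemeasurable

lemma fderiv_apply_eq_sum {n : ℕ} (L : (Fin n → ℝ) →L[ℝ] ℝ) (c : Fin n → ℝ) :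
    L c = ∑ i, c i * L (Pi.single i 1) := by
  conv_lhs => rw [← Finset.univ_sum_single c]
  rw [map_sum]
  refine Finset.sum_congr rfl fun i _ => ?_
  have : (Pi.single i (c i) : Fin n → ℝ) = c i • Pi.single i (1 : ℝ) := by
    rw [← Pi.single_smul, smul_eq_mul, mul_one]
  rw [this, map_smul, smul_eq_mul]

/-- Gaussian integration by parts for a bounded `C¹` function of finitely many elements of the
Gaussian Hilbert space. Splitting `h i` into its component along `g` and an orthogonal, hence
independent, part reduces it to the one-dimensional identity. -/
lemma integral_mul_gaussVar_eq [IsProbabilityMeasure P] (hgauss : IsGaussianProcess Y P)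
    (hmean : ∀ t, ∫ ω, Y t ω ∂P = 0) (g : GaussHilbert P Y) {n : ℕ} (h : Fin n → GaussHilbert P Y)
    {f : (Fin n → ℝ) → ℝ} (hf : ContDiff ℝ 1 f) {C C' : ℝ} (hb : ∀ x, |f x| ≤ C)
    (hb' : ∀ x, ‖fderiv ℝ f x‖ ≤ C') :
    ∫ ω, f (fun i => gaussVar (h i) ω) * gaussVar g ω ∂P
      = ∫ ω, fderiv ℝ f (fun i => gaussVar (h i) ω) (fun i => inner ℝ (h i) g) ∂P := by
  have hfd : ∀ x, HasFDerivAt f (fderiv ℝ f x) x := fun x =>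
    (hf.differentiable one_ne_zero).differentiableAt.hasFDerivAt
  have hfc : Continuous (fderiv ℝ f) := hf.continuous_fderiv one_ne_zero
  by_cases hg : g = 0
  · subst hg
    have h0 : gaussVar (0 : GaussHilbert P Y) =ᵐ[P] 0 := Lp.coeFn_zero ℝ 2 P
    rw [integral_eq_zero_of_ae]
    · symm
      refine integral_eq_zero_of_ae (ae_of_all _ fun ω => ?_)
      have : (fun i => inner ℝ (h i) (0 : GaussHilbert P Y)) = (0 : Fin n → ℝ) := by ext i; simp
      simp only [this, map_zero, Pi.zero_apply]
    · filter_upwards [h0] with ω hω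
      simp [hω]
  have hgn : ‖g‖ ^ 2 ≠ 0 := by simpa using hg
  set c : Fin n → ℝ := fun i => inner ℝ (h i) g / ‖g‖ ^ 2 with hc
  set k : Fin n → GaussHilbert P Y := fun i => h i - c i • g with hkdef
  have horth : ∀ i, inner ℝ g (k i) = 0 := by
    intro i
    simp only [hkdef, inner_sub_right]
    rw [gaussHilbert_inner_smul_right, real_inner_self_eq_norm_sq, real_inner_comm]
    simp only [hc]
    field_simp; ring
  have hind := indepFun_gaussVar hgauss hmean g k horth
  have hgm := (memLp_gaussVar g).aestronglyMeasurable.aemeasurable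
  have hkm := aemeasurable_gaussVar_pi k
  have hdec : ∀ᵐ ω ∂P, (fun i => gaussVar (h i) ω)
      = gaussVar g ω • c + fun i => gaussVar (k i) ω := by
    have : ∀ᵐ ω ∂P, ∀ i, gaussVar (h i) ω = gaussVar (k i) ω + c i * gaussVar g ω := by
      rw [ae_all_iff]; intro i
      have e : h i = k i + c i • g := by simp [hkdef]
      filter_upwards [gaussVar_add (k i) (c i • g), gaussVar_smul (c i) g] with ω h1 h2
      rw [← h2, ← h1, ← e]
    filter_upwards [this] with ω hω
    ext i
    simp [hω i]; ring
  have hprod := (indepFun_iff_map_prod_eq_prod_map_map hgm hkm).1 hind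
  set m := P.map (gaussVar g)
  set κ := P.map (fun ω i => gaussVar (k i) ω)
  have : IsProbabilityMeasure m := Measure.isProbabilityMeasure_map hgm
  have : IsProbabilityMeasure κ := Measure.isProbabilityMeasure_map hkm
  have hfcont : Continuous f := hf.continuous
  have hvec : (fun i => inner ℝ (h i) g) = (‖g‖ ^ 2) • c := by
    ext i; simp only [hc, Pi.smul_apply, smul_eq_mul]; field_simp
  have hm_id : Integrable (fun x : ℝ => x) m :=
    (integrable_map_measure (by fun_prop) hgm).2 ((memLp_gaussVar g).integrable one_le_two)
  have hC : 0 ≤ C := (abs_nonneg _).trans (hb 0)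
  have hcurve : ∀ (y : Fin n → ℝ) (x : ℝ),
      HasDerivAt (fun x : ℝ => f (x • c + y)) (fderiv ℝ f (x • c + y) c) x := by
    intro y x
    have h1 : HasDerivAt (fun x : ℝ => x • c + y) c x := by
      simpa using ((hasDerivAt_id x).smul_const c).add_const y
    exact (hfd (x • c + y)).comp_hasDerivAt x h1
  have hbc : ∀ z, |fderiv ℝ f z c| ≤ C' * ‖c‖ := fun z =>
    ((fderiv ℝ f z).le_opNorm c).trans (by gcongr; exact hb' z)
  have hcm : Continuous fun p : ℝ × (Fin n → ℝ) => f (p.1 • c + p.2) := by fun_prop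
  have hcm' : Continuous fun p : ℝ × (Fin n → ℝ) => fderiv ℝ f (p.1 • c + p.2) c :=
    (hfc.comp (by fun_prop)).clm_apply continuous_const
  have i1 : Integrable (fun p : ℝ × (Fin n → ℝ) => f (p.1 • c + p.2) * p.1) (m.prod κ) :=
    (hm_id.comp_fst κ).bdd_mul (c := C) hcm.aestronglyMeasurable
      (ae_of_all _ fun p => by simpa using hb _)
  have i2 : Integrable (fun p : ℝ × (Fin n → ℝ) => fderiv ℝ f (p.1 • c + p.2) c) (m.prod κ) :=
    Integrable.of_bound hcm'.aestronglyMeasurable (C' * ‖c‖)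
      (ae_of_all _ fun p => by simpa using hbc _)
  have hfub : ∀ u : ℝ × (Fin n → ℝ) → ℝ, Integrable u (m.prod κ) →
      ∫ ω, u (gaussVar g ω, fun i => gaussVar (k i) ω) ∂P = ∫ y, ∫ x, u (x, y) ∂m ∂κ := by
    intro u hu
    rw [← integral_prod_symm _ hu, ← hprod, integral_map (hgm.prodMk hkm)]
    rw [hprod]; exact hu.aestronglyMeasurable
  calc ∫ ω, f (fun i => gaussVar (h i) ω) * gaussVar g ω ∂P
      = ∫ ω, (fun p : ℝ × (Fin n → ℝ) => f (p.1 • c + p.2) * p.1)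
          (gaussVar g ω, fun i => gaussVar (k i) ω) ∂P := by
        refine integral_congr_ae ?_
        filter_upwards [hdec] with ω hω
        rw [hω]
    _ = ∫ y, ∫ x, x * f (x • c + y) ∂m ∂κ := by
        rw [hfub _ i1]
        simp only [mul_comm]
    _ = ∫ y, ∫ x, ‖g‖ ^ 2 * fderiv ℝ f (x • c + y) c ∂m ∂κ := by
        refine integral_congr_ae (ae_of_all _ fun y => ?_)
        have hm : m = gaussianReal 0 (‖g‖ ^ 2).toNNReal := map_gaussVar hgauss hmean g
        simp only [hm]
        rw [integral_id_mul_gaussianReal _ (hcurve y) ((hfc.comp (by fun_prop)).clm_apply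
          continuous_const) (C := max C (C' * ‖c‖)) (fun x => (hb _).trans (le_max_left _ _))
          (fun x => (hbc _).trans (le_max_right _ _)), integral_const_mul,
          Real.coe_toNNReal _ (by positivity)]
    _ = ∫ ω, (fun p : ℝ × (Fin n → ℝ) => ‖g‖ ^ 2 * fderiv ℝ f (p.1 • c + p.2) c)
          (gaussVar g ω, fun i => gaussVar (k i) ω) ∂P := by
        rw [hfub _ (i2.const_mul _)]
    _ = _ := by
        refine integral_congr_ae ?_
        filter_upwards [hdec] with ω hω
        rw [hω, hvec, map_smul, smul_eq_mul]

end GaussianSpace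

/-! ### Convergence in `L²` -/

section L2Convergence

variable {Ω E : Type*} [MeasurableSpace Ω] {P : Measure Ω} [NormedAddCommGroup E]

lemma tendsto_eLpNorm_two_of_dominated {u : ℕ → Ω → E} {v : Ω → E} {g : Ω → ℝ}
    (hu : ∀ k, AEStronglyMeasurable (u k) P) (hv : AEStronglyMeasurable v P) (hg : MemLp g 2 P)
    (hb : ∀ k, ∀ᵐ ω ∂P, ‖u k ω - v ω‖ ≤ g ω)
    (hlim : ∀ᵐ ω ∂P, Tendsto (fun k => u k ω) atTop (𝓝 (v ω))) :
    Tendsto (fun k => eLpNorm (fun ω => u k ω - v ω) 2 P) atTop (𝓝 0) := by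
  have h2 : (2 : ℝ≥0∞) ≠ 0 := two_ne_zero
  simp only [eLpNorm_eq_lintegral_rpow_enorm_toReal h2 ENNReal.ofNat_ne_top]
  have key : Tendsto (fun k => ∫⁻ ω, ‖u k ω - v ω‖ₑ ^ (2 : ℝ≥0∞).toReal ∂P) atTop (𝓝 0) := by
    have := tendsto_lintegral_of_dominated_convergence' (μ := P)
      (F := fun k ω => ‖u k ω - v ω‖ₑ ^ (2 : ℝ≥0∞).toReal) (f := fun _ => 0)
      (fun ω => ‖g ω‖ₑ ^ (2 : ℝ≥0∞).toReal) (fun k => ((hu k).sub hv).enorm.pow_const _)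
      (fun k => ?_) ?_ ?_
    · simpa using this
    · filter_upwards [hb k] with ω hω
      gcongr
      exact enorm_le_iff_norm_le.2 (hω.trans (Real.le_norm_self _))
    · exact (lintegral_rpow_enorm_lt_top_of_eLpNorm_lt_top h2 ENNReal.ofNat_ne_top hg.2).ne
    · filter_upwards [hlim] with ω hω
      have h3 : Tendsto (fun k => ‖u k ω - v ω‖ₑ) atTop (𝓝 0) := by
        simpa using (hω.sub_const (v ω)).enorm
      simpa [Function.comp_def] using
        ((ENNReal.continuous_rpow_const (y := (2 : ℝ≥0∞).toReal)).tendsto 0).comp h3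
  simpa [Function.comp_def] using
    ((ENNReal.continuous_rpow_const (y := 1 / (2 : ℝ≥0∞).toReal)).tendsto 0).comp key

lemma exists_subseq_tendsto_ae_of_eLpNorm_two {u : ℕ → Ω → E} {v : Ω → E}
    (hu : ∀ k, AEStronglyMeasurable (u k) P) (hv : AEStronglyMeasurable v P)
    (h : Tendsto (fun k => eLpNorm (fun ω => u k ω - v ω) 2 P) atTop (𝓝 0)) :
    ∃ ns : ℕ → ℕ, StrictMono ns ∧ ∀ᵐ ω ∂P, Tendsto (fun k => u (ns k) ω) atTop (𝓝 (v ω)) :=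
  (tendstoInMeasure_of_tendsto_eLpNorm two_ne_zero hu hv h).exists_seq_tendsto_ae

lemma tendsto_eLpNorm_two_of_le_add {E' E'' : Type*} [NormedAddCommGroup E']
    [NormedAddCommGroup E''] {u : ℕ → Ω → E} {v : ℕ → Ω → E'} {w : ℕ → Ω → E''} {C : ℝ}
    (hv : ∀ k, AEStronglyMeasurable (v k) P) (hw : ∀ k, AEStronglyMeasurable (w k) P)
    (hle : ∀ k, ∀ᵐ ω ∂P, ‖u k ω‖ ≤ C * (‖v k ω‖ + ‖w k ω‖))
    (hv0 : Tendsto (fun k => eLpNorm (v k) 2 P) atTop (𝓝 0))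
    (hw0 : Tendsto (fun k => eLpNorm (w k) 2 P) atTop (𝓝 0)) :
    Tendsto (fun k => eLpNorm (u k) 2 P) atTop (𝓝 0) := by
  have h1 : Tendsto (fun k => ENNReal.ofReal C * (eLpNorm (v k) 2 P + eLpNorm (w k) 2 P)) atTop
      (𝓝 0) := by
    simpa using ENNReal.Tendsto.const_mul (hv0.add hw0) (Or.inr ENNReal.ofReal_ne_top)
  refine tendsto_of_tendsto_of_tendsto_of_le_of_le tendsto_const_nhds h1 (fun _ => zero_le)
    fun k => ?_
  have h2 : eLpNorm (u k) 2 P ≤ ENNReal.ofReal C *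
      eLpNorm (fun ω => ‖v k ω‖ + ‖w k ω‖) 2 P := by
    refine eLpNorm_le_mul_eLpNorm_of_ae_le_mul ?_ 2
    filter_upwards [hle k] with ω hω
    rwa [Real.norm_of_nonneg (add_nonneg (norm_nonneg _) (norm_nonneg _))]
  refine h2.trans ?_
  gcongr
  have h3 := eLpNorm_add_le (hv k).norm (hw k).norm (p := 2) one_le_two
  simpa only [Pi.add_def, eLpNorm_norm] using h3

lemma tendsto_integral_inner_of_eLpNorm_two {E : Type*} [NormedAddCommGroup E]
    [InnerProductSpace ℝ E] {u : ℕ → Ω → E} {v w : Ω → E} (hu : ∀ k, MemLp (u k) 2 P)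
    (hv : MemLp v 2 P) (hw : MemLp w 2 P)
    (h : Tendsto (fun k => eLpNorm (fun ω => u k ω - v ω) 2 P) atTop (𝓝 0)) :
    Tendsto (fun k => ∫ ω, inner ℝ (u k ω) (w ω) ∂P) atTop (𝓝 (∫ ω, inner ℝ (v ω) (w ω) ∂P)) := by
  have h1 : Tendsto (fun k => (hu k).toLp (u k)) atTop (𝓝 (hv.toLp v)) := by
    rw [Lp.tendsto_Lp_iff_tendsto_eLpNorm'']
    exact h
  have h2 : ∀ (a : Ω → E) (ha : MemLp a 2 P),
      inner ℝ (ha.toLp a) (hw.toLp w) = ∫ ω, inner ℝ (a ω) (w ω) ∂P := by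
    intro a ha
    rw [L2.inner_def]
    refine integral_congr_ae ?_
    filter_upwards [ha.coeFn_toLp, hw.coeFn_toLp] with ω e1 e2
    rw [e1, e2]
  simp only [← h2 _ hv, ← h2 _ (hu _)]
  exact h1.inner tendsto_const_nhds

lemma tendsto_integral_mul_of_eLpNorm_two {u : ℕ → Ω → ℝ} {v w : Ω → ℝ}
    (hu : ∀ k, MemLp (u k) 2 P) (hv : MemLp v 2 P) (hw : MemLp w 2 P)
    (h : Tendsto (fun k => eLpNorm (fun ω => u k ω - v ω) 2 P) atTop (𝓝 0)) :
    Tendsto (fun k => ∫ ω, u k ω * w ω ∂P) atTop (𝓝 (∫ ω, v ω * w ω ∂P)) := by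
  simpa [mul_comm] using tendsto_integral_inner_of_eLpNorm_two hu hv hw h

end L2Convergence

/-! ### Smooth cylindrical functionals -/

/-- The vector `∑ i, ℓ(eᵢ) hᵢ` attached to a linear form `ℓ` on `ℝⁿ`, as a continuous linear
function of `ℓ`. Applied to `ℓ = fderiv ℝ f x` it gives the derivative of a cylindrical
functional. -/
noncomputable def coordGrad {E : Type*} [NormedAddCommGroup E] [NormedSpace ℝ E] {n : ℕ}
    (h : Fin n → E) : ((Fin n → ℝ) →L[ℝ] ℝ) →L[ℝ] E :=
  ∑ i, (ContinuousLinearMap.apply ℝ ℝ (Pi.single i 1 : Fin n → ℝ)).smulRight (h i)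

lemma coordGrad_apply {E : Type*} [NormedAddCommGroup E] [NormedSpace ℝ E] {n : ℕ}
    (h : Fin n → E) (ℓ : (Fin n → ℝ) →L[ℝ] ℝ) :
    coordGrad h ℓ = ∑ i, ℓ (Pi.single i 1) • h i := by
  simp [coordGrad]

lemma inner_coordGrad {E : Type*} [NormedAddCommGroup E] [InnerProductSpace ℝ E] {n : ℕ}
    (h : Fin n → E) (ℓ : (Fin n → ℝ) →L[ℝ] ℝ) (g : E) :
    inner ℝ (coordGrad h ℓ) g = ℓ (fun i => inner ℝ (h i) g) := by
  rw [coordGrad_apply, fderiv_apply_eq_sum, sum_inner]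
  refine Finset.sum_congr rfl fun i _ => ?_
  rw [real_inner_smul_left, mul_comm]

/-- The projection of `ℝᴺ` onto its first `n` coordinates. -/
noncomputable def firstCoords {n N : ℕ} (hn : n ≤ N) : (Fin N → ℝ) →L[ℝ] (Fin n → ℝ) :=
  ContinuousLinearMap.pi fun i => ContinuousLinearMap.proj (Fin.castLE hn i)

lemma firstCoords_apply {n N : ℕ} (hn : n ≤ N) (x : Fin N → ℝ) (i : Fin n) :
    firstCoords hn x i = x (Fin.castLE hn i) := rfl

lemma coordGrad_comp_firstCoords {E : Type*} [NormedAddCommGroup E] [NormedSpace ℝ E] (h : ℕ → E)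
    {n N : ℕ} (hn : n ≤ N) (ℓ : (Fin n → ℝ) →L[ℝ] ℝ) :
    coordGrad (fun i : Fin N => h i) (ℓ.comp (firstCoords hn))
      = coordGrad (fun i : Fin n => h i) ℓ := by
  simp only [coordGrad_apply, ContinuousLinearMap.comp_apply]
  have h1 : ∀ i : Fin N, ℓ (firstCoords hn (Pi.single i 1))
      = ∑ j : Fin n, if Fin.castLE hn j = i then ℓ (Pi.single j 1) else 0 := by
    intro i
    rw [fderiv_apply_eq_sum]
    refine Finset.sum_congr rfl fun j _ => ?_
    rw [firstCoords_apply, Pi.single_apply]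
    split_ifs <;> simp
  simp only [h1, Finset.sum_smul, ite_smul, zero_smul]
  rw [Finset.sum_comm]
  refine Finset.sum_congr rfl fun j _ => ?_
  rw [Finset.sum_ite_eq]
  simp

section Cylinder

variable {Ω ι : Type*} [MeasurableSpace Ω] {P : Measure Ω} {Y : ι → Ω → ℝ}

/-- `F = f(Y(h_0), …, Y(h_{n-1}))` for a bounded smooth `f` with bounded gradient, and `G` is the
derivative of this representation. Unlike cylindrical functionals of Schwartz functions these are
stable under composition with smooth functions, and two of them can be written with the same
number of variables. -/
def IsSmoothCyl (h : ℕ → GaussHilbert P Y) (n : ℕ) (F : Ω → ℝ) (G : Ω → GaussHilbert P Y) : Prop :=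
  ∃ f : (Fin n → ℝ) → ℝ, ContDiff ℝ (⊤ : ℕ∞) f ∧ (∃ C, ∀ x, |f x| ≤ C) ∧
    (∃ C, ∀ x, ‖fderiv ℝ f x‖ ≤ C) ∧
    (∀ ω, F ω = f (fun i => gaussVar (h i) ω)) ∧
    (∀ ω, G ω = coordGrad (fun i : Fin n => h i) (fderiv ℝ f (fun i => gaussVar (h i) ω)))

variable {h : ℕ → GaussHilbert P Y}

lemma cylDeriv_eq_coordGrad (n : ℕ) (f : 𝓢(Fin (n + 1) → ℝ, ℝ)) (ω : Ω) :
    cylDeriv h n f ω = coordGrad (fun i : Fin (n + 1) => h i)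
      (fderiv ℝ f (fun i => gaussVar (h i) ω)) := by
  rw [coordGrad_apply]; rfl

lemma schwartz_bounded {n : ℕ} {V : Type*} [NormedAddCommGroup V] [NormedSpace ℝ V]
    (f : 𝓢(Fin n → ℝ, V)) : ∃ C, ∀ x, ‖f x‖ ≤ C := by
  obtain ⟨C, hC⟩ := f.decay 0 0
  exact ⟨C, fun x => by simpa using hC.2 x⟩

lemma isSmoothCyl_cylFun (n : ℕ) (f : 𝓢(Fin (n + 1) → ℝ, ℝ)) :
    IsSmoothCyl h (n + 1) (cylFun h n f) (cylDeriv h n f) := by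
  refine ⟨f, f.smooth _, schwartz_bounded f, ?_, fun _ => rfl, cylDeriv_eq_coordGrad n f⟩
  exact schwartz_bounded (SchwartzMap.fderivCLM ℝ _ _ f)

lemma IsSmoothCyl.mono {n N : ℕ} (hn : n ≤ N) {F : Ω → ℝ} {G : Ω → GaussHilbert P Y}
    (H : IsSmoothCyl h n F G) : IsSmoothCyl h N F G := by
  obtain ⟨f, hf, ⟨C, hC⟩, ⟨C', hC'⟩, hF, hG⟩ := H
  have hd : ∀ x, fderiv ℝ (fun x => f (firstCoords hn x)) x
      = (fderiv ℝ f (firstCoords hn x)).comp (firstCoords hn) := fun x =>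
    (((hf.differentiable (by simp)).differentiableAt.hasFDerivAt).comp x
      (firstCoords hn).hasFDerivAt).fderiv
  refine ⟨fun x => f (firstCoords hn x), hf.comp (firstCoords hn).contDiff, ⟨C, fun x => hC _⟩,
    ⟨C' * ‖(firstCoords hn : (Fin N → ℝ) →L[ℝ] (Fin n → ℝ))‖, fun x => ?_⟩, fun ω => hF ω,
    fun ω => ?_⟩
  · rw [hd]
    refine (ContinuousLinearMap.opNorm_comp_le _ _).trans ?_
    gcongr
    exact hC' _
  · rw [hd, coordGrad_comp_firstCoords, hG]
    rfl

lemma isSmoothCyl_const (c : ℝ) : IsSmoothCyl h 1 (fun _ => c) (fun _ => 0) :=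
  ⟨fun _ => c, contDiff_const, ⟨|c|, fun _ => le_rfl⟩, ⟨0, fun x => by simp⟩, fun _ => rfl,
    fun ω => by simp⟩

/-- A smooth function of two smooth cylindrical functionals is again one. -/
lemma IsSmoothCyl.comp₂ {n : ℕ} {F F' : Ω → ℝ} {G G' : Ω → GaussHilbert P Y}
    (H : IsSmoothCyl h n F G) (H' : IsSmoothCyl h n F' G') {Φ : ℝ × ℝ → ℝ}
    (hΦ : ContDiff ℝ (⊤ : ℕ∞) Φ) :
    IsSmoothCyl h n (fun ω => Φ (F ω, F' ω))
      (fun ω => fderiv ℝ Φ (F ω, F' ω) (1, 0) • G ω + fderiv ℝ Φ (F ω, F' ω) (0, 1) • G' ω) := by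
  obtain ⟨f, hf, ⟨C, hC⟩, ⟨D, hD⟩, hF, hG⟩ := H
  obtain ⟨f', hf', ⟨C', hC'⟩, ⟨D', hD'⟩, hF', hG'⟩ := H'
  have hdf : ∀ x, HasFDerivAt (fun x => (f x, f' x))
      ((fderiv ℝ f x).prod (fderiv ℝ f' x)) x := fun x =>
    ((hf.differentiable (by simp)).differentiableAt.hasFDerivAt).prodMk
      ((hf'.differentiable (by simp)).differentiableAt.hasFDerivAt)
  have hd : ∀ x, fderiv ℝ (fun x => Φ (f x, f' x)) x
      = fderiv ℝ Φ (f x, f' x) (1, 0) • fderiv ℝ f x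
        + fderiv ℝ Φ (f x, f' x) (0, 1) • fderiv ℝ f' x := by
    intro x
    have hx : HasFDerivAt (fun x => Φ (f x, f' x)) _ x :=
      (hΦ.differentiable (by simp)).differentiableAt.hasFDerivAt.comp x (hdf x)
    rw [hx.fderiv]
    ext v
    have e : ((fderiv ℝ f x) v, (fderiv ℝ f' x) v)
        = (fderiv ℝ f x) v • ((1 : ℝ), (0 : ℝ)) + (fderiv ℝ f' x) v • ((0 : ℝ), (1 : ℝ)) := by
      simp
    simp only [ContinuousLinearMap.comp_apply, ContinuousLinearMap.prod_apply, e, map_add,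
      map_smul, add_apply, smul_apply, smul_eq_mul]
    ring
  -- the values of `(f, f')` stay in a compact square
  have hK : IsCompact (Set.Icc (-C) C ×ˢ Set.Icc (-C') C') := isCompact_Icc.prod isCompact_Icc
  have hmem : ∀ x, (f x, f' x) ∈ Set.Icc (-C) C ×ˢ Set.Icc (-C') C' := fun x =>
    ⟨abs_le.1 (hC x), abs_le.1 (hC' x)⟩
  obtain ⟨B, hB⟩ := hK.exists_bound_of_continuousOn hΦ.continuous.continuousOn
  obtain ⟨B', hB'⟩ := hK.exists_bound_of_continuousOn
    (hΦ.continuous_fderiv (by simp)).continuousOn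
  refine ⟨fun x => Φ (f x, f' x), hΦ.comp (hf.prodMk hf'), ⟨B, fun x => hB _ (hmem x)⟩,
    ⟨B' * ‖((1 : ℝ), (0 : ℝ))‖ * D + B' * ‖((0 : ℝ), (1 : ℝ))‖ * D', fun x => ?_⟩,
    fun ω => by simp only [hF, hF'], fun ω => ?_⟩
  · rw [hd]
    have b := hB' _ (hmem x)
    refine (norm_add_le _ _).trans (add_le_add ?_ ?_)
    · rw [norm_smul]
      have := ContinuousLinearMap.le_of_opNorm_le _ b (1, 0)
      gcongr
      · exact (norm_nonneg _).trans this
      · exact hD x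
    · rw [norm_smul]
      have := ContinuousLinearMap.le_of_opNorm_le _ b (0, 1)
      gcongr
      · exact (norm_nonneg _).trans this
      · exact hD' x
  · rw [hd, map_add, map_smul, map_smul, ← hG, ← hG', ← hF, ← hF']

lemma aestronglyMeasurable_gaussVar_pi {n : ℕ} (k : Fin n → GaussHilbert P Y) :
    AEStronglyMeasurable (fun ω i => gaussVar (k i) ω) P :=
  (aemeasurable_gaussVar_pi k).aestronglyMeasurable

lemma IsSmoothCyl.memLp [IsFiniteMeasure P] {n : ℕ} {F : Ω → ℝ} {G : Ω → GaussHilbert P Y}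
    (H : IsSmoothCyl h n F G) : MemLp F 2 P ∧ MemLp G 2 P := by
  obtain ⟨f, hf, ⟨C, hC⟩, ⟨D, hD⟩, hF, hG⟩ := H
  obtain rfl := funext hF
  obtain rfl := funext hG
  have hZ := aestronglyMeasurable_gaussVar_pi (P := P) (fun i : Fin n => h i)
  constructor
  · exact MemLp.of_bound (hf.continuous.comp_aestronglyMeasurable hZ) C
      (ae_of_all _ fun ω => hC _)
  · refine MemLp.of_bound (((coordGrad _).continuous.comp
      (hf.continuous_fderiv (by simp))).comp_aestronglyMeasurable hZ)
      (‖coordGrad fun i : Fin n => h i‖ * D) (ae_of_all _ fun ω => ?_)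
    exact (ContinuousLinearMap.le_opNorm _ _).trans (by gcongr; exact hD _)

/-- Integration by parts for smooth cylindrical functionals. -/
lemma IsSmoothCyl.integral_mul_gaussVar [IsProbabilityMeasure P] (hgauss : IsGaussianProcess Y P)
    (hmean : ∀ t, ∫ ω, Y t ω ∂P = 0) {n : ℕ} {F : Ω → ℝ} {G : Ω → GaussHilbert P Y}
    (H : IsSmoothCyl h n F G) (g : GaussHilbert P Y) :
    ∫ ω, F ω * gaussVar g ω ∂P = ∫ ω, inner ℝ (G ω) g ∂P := by
  obtain ⟨f, hf, ⟨C, hC⟩, ⟨D, hD⟩, hF, hG⟩ := H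
  simp only [hF, hG]
  rw [integral_mul_gaussVar_eq hgauss hmean g (fun i : Fin n => h i) (hf.of_le (by simp)) hC hD]
  congr 1; ext ω
  exact (inner_coordGrad _ _ _).symm

/-- A smooth cylindrical functional lies in the domain of `D`: multiplying by cutoff functions
makes it the limit of cylindrical functionals of compactly supported smooth functions. -/
lemma IsSmoothCyl.hasMalliavinDeriv [IsFiniteMeasure P] {n : ℕ} {F : Ω → ℝ}
    {G : Ω → GaussHilbert P Y} (H : IsSmoothCyl h n F G) : HasMalliavinDeriv h F G := by
  replace H := H.mono n.le_succ
  refine ⟨H.memLp.1, H.memLp.2, fun _ => n, ?_⟩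
  obtain ⟨f, hf, ⟨C, hC⟩, ⟨D, hD⟩, hF, hG⟩ := H
  let χ : ContDiffBump (0 : Fin (n + 1) → ℝ) := ⟨1, 2, one_pos, one_lt_two⟩
  let c : ℕ → ℝ := fun k => ((k : ℝ) + 1)⁻¹
  have hc0 : ∀ k, 0 < c k := fun k => by positivity
  have hc1 : ∀ k, c k ≤ 1 := fun k => inv_le_one_of_one_le₀ (by simp)
  have hχ : ContDiff ℝ (⊤ : ℕ∞) χ := χ.contDiff
  have hχc : HasCompactSupport χ := χ.hasCompactSupport
  obtain ⟨B, hB⟩ := (hχc.fderiv ℝ).exists_bound_of_continuous (hχ.continuous_fderiv (by simp))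
  have hB0 : 0 ≤ B := (norm_nonneg _).trans (hB 0)
  have hC0 : 0 ≤ C := (abs_nonneg _).trans (hC 0)
  let φ : ℕ → (Fin (n + 1) → ℝ) → ℝ := fun k x => χ (c k • x) * f x
  have hφs : ∀ k, ContDiff ℝ (⊤ : ℕ∞) (φ k) := fun k =>
    (hχ.comp (contDiff_const_smul _)).mul hf
  have hφc : ∀ k, HasCompactSupport (φ k) := fun k =>
    (hχc.comp_smul (hc0 k).ne').mul_right
  have hdχ : ∀ k x, HasFDerivAt (fun x => χ (c k • x)) (c k • fderiv ℝ χ (c k • x)) x := by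
    intro k x
    have h1 : HasFDerivAt (fun x : Fin (n + 1) → ℝ => c k • x)
        (c k • ContinuousLinearMap.id ℝ _) x := (hasFDerivAt_id x).const_smul (c k)
    have h2 := ((hχ.differentiable (by simp)).differentiableAt (x := c k • x)).hasFDerivAt.comp x h1
    refine h2.congr_fderiv ?_
    ext v
    simp
  have hdφ : ∀ k x, ‖fderiv ℝ (φ k) x‖ ≤ D + C * B := by
    intro k x
    have hx : HasFDerivAt (φ k) _ x :=
      (hdχ k x).mul ((hf.differentiable (by simp)).differentiableAt.hasFDerivAt)
    rw [hx.fderiv]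
    refine (norm_add_le _ _).trans (add_le_add ?_ ?_)
    · rw [norm_smul, Real.norm_eq_abs, abs_of_nonneg χ.nonneg]
      exact (mul_le_of_le_one_left (norm_nonneg _) χ.le_one).trans (hD x)
    · rw [norm_smul, norm_smul, Real.norm_eq_abs, Real.norm_eq_abs, abs_of_pos (hc0 k)]
      refine mul_le_mul (hC x) ?_ (by positivity) hC0
      exact (mul_le_of_le_one_left (norm_nonneg _) (hc1 k)).trans (hB _)
  have hev : ∀ x, ∀ᶠ k in atTop, φ k =ᶠ[𝓝 x] f := by
    intro x
    obtain ⟨K, hK⟩ := exists_nat_gt ‖x‖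
    filter_upwards [eventually_ge_atTop K] with k hk
    have hx : x ∈ Metric.ball (0 : Fin (n + 1) → ℝ) (k + 1) := by
      simp only [Metric.mem_ball, dist_zero_right]
      have : (K : ℝ) ≤ k := by exact_mod_cast hk
      linarith
    filter_upwards [Metric.isOpen_ball.mem_nhds hx] with y hy
    have : χ (c k • y) = 1 := by
      refine χ.one_of_mem_closedBall ?_
      simp only [Metric.mem_ball, dist_zero_right] at hy
      simp only [Metric.mem_closedBall, dist_zero_right, norm_smul, Real.norm_eq_abs,
        abs_of_pos (hc0 k), χ, c]
      rw [inv_mul_le_iff₀ (by positivity)]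
      linarith
    simp only [φ, this, one_mul]
  have hφb : ∀ k x, |φ k x| ≤ C := by
    intro k x
    rw [abs_mul, abs_of_nonneg χ.nonneg]
    exact (mul_le_of_le_one_left (abs_nonneg _) χ.le_one).trans (hC x)
  have hZ := aestronglyMeasurable_gaussVar_pi (P := P) (fun i : Fin (n + 1) => h i)
  set A := coordGrad fun i : Fin (n + 1) => h i
  have hA : ∀ f' : (Fin (n + 1) → ℝ) → ℝ, ContDiff ℝ (⊤ : ℕ∞) f' →
      AEStronglyMeasurable (fun ω => A (fderiv ℝ f' (fun i => gaussVar (h i) ω))) P := fun f' hf' =>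
    (A.continuous.comp (hf'.continuous_fderiv (by simp))).comp_aestronglyMeasurable hZ
  refine ⟨fun k => (hφc k).toSchwartzMap (hφs k), ?_, ?_⟩
  · refine tendsto_eLpNorm_two_of_dominated (g := fun _ => C + C) (fun k => ?_) ?_
      (memLp_const _) (fun k => ae_of_all _ fun ω => ?_) (ae_of_all _ fun ω => ?_)
    · exact (hφs k).continuous.comp_aestronglyMeasurable hZ
    · simp only [funext hF]
      exact hf.continuous.comp_aestronglyMeasurable hZ
    · rw [hF]
      exact (norm_sub_le _ _).trans (add_le_add (hφb k _) (hC _))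
    · rw [hF]
      refine tendsto_const_nhds.congr' ?_
      filter_upwards [hev fun i => gaussVar (h i) ω] with k hk
      exact hk.eq_of_nhds.symm
  · simp only [cylDeriv_eq_coordGrad, hG]
    refine tendsto_eLpNorm_two_of_dominated (g := fun _ => ‖A‖ * (D + C * B) + ‖A‖ * D)
      (fun k => hA _ (hφs k)) (hA _ hf)
      (memLp_const _) (fun k => ae_of_all _ fun ω => ?_) (ae_of_all _ fun ω => ?_)
    · refine (norm_sub_le _ _).trans (add_le_add ?_ ?_)
      · exact (A.le_opNorm _).trans (by gcongr; exact hdφ k _)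
      · exact (A.le_opNorm _).trans (by gcongr; exact hD _)
    · refine tendsto_const_nhds.congr' ?_
      filter_upwards [hev fun i => gaussVar (h i) ω] with k hk
      exact congrArg A hk.fderiv_eq.symm

end Cylinder

/-! ### Closedness, chain rule and integration by parts on the domain of `D` -/

section ChainRule

variable {Ω ι : Type*} [MeasurableSpace Ω] {P : Measure Ω} {Y : ι → Ω → ℝ}
variable {h : ℕ → GaussHilbert P Y}

/-- The derivative is closed: a limit in `L²` of functionals of `Dom(D)` whose derivatives converge
is in `Dom(D)`. -/
lemma HasMalliavinDeriv.of_tendsto [IsFiniteMeasure P] {F : Ω → ℝ} {G : Ω → GaussHilbert P Y}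
    {Fk : ℕ → Ω → ℝ} {Gk : ℕ → Ω → GaussHilbert P Y} (hF : MemLp F 2 P) (hG : MemLp G 2 P)
    (hk : ∀ k, HasMalliavinDeriv h (Fk k) (Gk k))
    (hFk : Tendsto (fun k => eLpNorm (fun ω => Fk k ω - F ω) 2 P) atTop (𝓝 0))
    (hGk : Tendsto (fun k => eLpNorm (fun ω => Gk k ω - G ω) 2 P) atTop (𝓝 0)) :
    HasMalliavinDeriv h F G := by
  have key : ∀ k : ℕ, ∃ (n : ℕ) (f : 𝓢(Fin (n + 1) → ℝ, ℝ)),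
      eLpNorm (fun ω => cylFun h n f ω - Fk k ω) 2 P < ENNReal.ofReal (1 / ((k : ℝ) + 1)) ∧
      eLpNorm (fun ω => cylDeriv h n f ω - Gk k ω) 2 P < ENNReal.ofReal (1 / ((k : ℝ) + 1)) := by
    intro k
    obtain ⟨-, -, n, f, h1, h2⟩ := hk k
    have hpos : 0 < ENNReal.ofReal (1 / ((k : ℝ) + 1)) := ENNReal.ofReal_pos.2 (by positivity)
    obtain ⟨j, hj1, hj2⟩ := ((h1.eventually_lt_const hpos).and (h2.eventually_lt_const hpos)).exists
    exact ⟨n j, f j, hj1, hj2⟩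
  choose n f h1 h2 using key
  have h0 : Tendsto (fun k : ℕ => ENNReal.ofReal (1 / ((k : ℝ) + 1))) atTop (𝓝 0) := by
    simpa [Function.comp_def] using
      (ENNReal.continuous_ofReal.tendsto 0).comp tendsto_one_div_add_atTop_nhds_zero_nat
  have hm := fun k => (isSmoothCyl_cylFun (h := h) (n k) (f k)).memLp
  refine ⟨hF, hG, n, f, ?_, ?_⟩
  · refine tendsto_eLpNorm_two_of_le_add (C := 1)
      (v := fun k ω => cylFun h (n k) (f k) ω - Fk k ω) (w := fun k ω => Fk k ω - F ω)
      (fun k => ((hm k).1.sub (hk k).1).1) (fun k => ((hk k).1.sub hF).1)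
      (fun k => ae_of_all _ fun ω => ?_)
      (tendsto_of_tendsto_of_tendsto_of_le_of_le tendsto_const_nhds h0 (fun _ => zero_le)
        fun k => (h1 k).le) hFk
    rw [one_mul]
    exact norm_sub_le_norm_sub_add_norm_sub _ _ _
  · refine tendsto_eLpNorm_two_of_le_add (C := 1)
      (v := fun k ω => cylDeriv h (n k) (f k) ω - Gk k ω) (w := fun k ω => Gk k ω - G ω)
      (fun k => ((hm k).2.sub (hk k).2.1).1) (fun k => ((hk k).2.1.sub hG).1)
      (fun k => ae_of_all _ fun ω => ?_)
      (tendsto_of_tendsto_of_tendsto_of_le_of_le tendsto_const_nhds h0 (fun _ => zero_le)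
        fun k => (h2 k).le) hGk
    rw [one_mul]
    exact norm_sub_le_norm_sub_add_norm_sub _ _ _

lemma norm_smul_add_smul_sub_le {E : Type*} [NormedAddCommGroup E] [NormedSpace ℝ E] {C : ℝ}
    {a b : ℝ} (ha : |a| ≤ C) (hb : |b| ≤ C) (a' b' : ℝ) (x y x' y' : E) :
    ‖(a • x + b • y) - (a' • x' + b' • y')‖
      ≤ max C 1 * (‖‖x - x'‖ + ‖y - y'‖‖ + ‖(a - a') • x' + (b - b') • y'‖) := by
  have e : (a • x + b • y) - (a' • x' + b' • y')
      = (a • (x - x') + b • (y - y')) + ((a - a') • x' + (b - b') • y') := by module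
  have h1 : ‖a • (x - x') + b • (y - y')‖ ≤ max C 1 * (‖x - x'‖ + ‖y - y'‖) := by
    refine (norm_add_le _ _).trans ?_
    rw [norm_smul, norm_smul, mul_add]
    have := le_max_left C 1
    gcongr
    · exact ha.trans this
    · exact hb.trans this
  have h2 : ‖(a - a') • x' + (b - b') • y'‖ ≤ max C 1 * ‖(a - a') • x' + (b - b') • y'‖ :=
    le_mul_of_one_le_left (norm_nonneg _) (le_max_right _ _)
  rw [e, Real.norm_of_nonneg (add_nonneg (norm_nonneg _) (norm_nonneg _)), mul_add]
  exact (norm_add_le _ _).trans (add_le_add h1 h2)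

lemma memLp_two_smul_of_bounded {E : Type*} [NormedAddCommGroup E] [NormedSpace ℝ E] {a : Ω → ℝ}
    {C : ℝ} (ha : AEStronglyMeasurable a P) (haC : ∀ ω, |a ω| ≤ C) {x : Ω → E}
    (hx : MemLp x 2 P) : MemLp (fun ω => a ω • x ω) 2 P := by
  refine hx.of_le_mul (c := C) (ha.smul hx.1) (ae_of_all _ fun ω => ?_)
  rw [norm_smul]
  gcongr
  exact haC _

/-- `a_k x_k + b_k y_k → a x + b y` in `L²` when `x_k → x`, `y_k → y` in `L²` and the uniformly
bounded scalars `a_k`, `b_k` converge almost surely. -/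
lemma tendsto_eLpNorm_two_smul_add_smul {E : Type*} [NormedAddCommGroup E] [NormedSpace ℝ E]
    {a b : ℕ → Ω → ℝ} {a' b' : Ω → ℝ} {C : ℝ} {x y : ℕ → Ω → E} {x' y' : Ω → E}
    (ha : ∀ k, AEStronglyMeasurable (a k) P) (hb : ∀ k, AEStronglyMeasurable (b k) P)
    (ha' : AEStronglyMeasurable a' P) (hb' : AEStronglyMeasurable b' P)
    (haC : ∀ k ω, |a k ω| ≤ C) (hbC : ∀ k ω, |b k ω| ≤ C) (haC' : ∀ ω, |a' ω| ≤ C)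
    (hbC' : ∀ ω, |b' ω| ≤ C)
    (hlima : ∀ᵐ ω ∂P, Tendsto (fun k => a k ω) atTop (𝓝 (a' ω)))
    (hlimb : ∀ᵐ ω ∂P, Tendsto (fun k => b k ω) atTop (𝓝 (b' ω)))
    (hx : ∀ k, MemLp (x k) 2 P) (hy : ∀ k, MemLp (y k) 2 P) (hx' : MemLp x' 2 P)
    (hy' : MemLp y' 2 P) (hxx : Tendsto (fun k => eLpNorm (fun ω => x k ω - x' ω) 2 P) atTop (𝓝 0))
    (hyy : Tendsto (fun k => eLpNorm (fun ω => y k ω - y' ω) 2 P) atTop (𝓝 0)) :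
    Tendsto (fun k => eLpNorm (fun ω => (a k ω • x k ω + b k ω • y k ω)
      - (a' ω • x' ω + b' ω • y' ω)) 2 P) atTop (𝓝 0) := by
  have hmeas : ∀ k, AEStronglyMeasurable (fun ω => (a k ω - a' ω) • x' ω + (b k ω - b' ω) • y' ω) P :=
    fun k => (((ha k).sub ha').smul hx'.1).add (((hb k).sub hb').smul hy'.1)
  refine tendsto_eLpNorm_two_of_le_add (C := max C 1)
    (v := fun k ω => ‖x k ω - x' ω‖ + ‖y k ω - y' ω‖)
    (w := fun k ω => (a k ω - a' ω) • x' ω + (b k ω - b' ω) • y' ω)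
    (fun k => ((hx k).sub hx').1.norm.add ((hy k).sub hy').1.norm) hmeas
    (fun k => ae_of_all _ fun ω =>
      norm_smul_add_smul_sub_le (haC k ω) (hbC k ω) _ _ _ _ _ _) ?_ ?_
  · refine tendsto_eLpNorm_two_of_le_add (C := 1) (fun k => ((hx k).sub hx').1)
      (fun k => ((hy k).sub hy').1) (fun k => ae_of_all _ fun ω => ?_) hxx hyy
    rw [one_mul, Real.norm_of_nonneg (add_nonneg (norm_nonneg _) (norm_nonneg _))]
    rfl
  · have hdom : MemLp (fun ω => (C + C) * ‖x' ω‖ + (C + C) * ‖y' ω‖) 2 P :=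
      (hx'.norm.const_mul _).add (hy'.norm.const_mul _)
    have := tendsto_eLpNorm_two_of_dominated (v := fun _ => (0 : E)) hmeas
      aestronglyMeasurable_const hdom (fun k => ae_of_all _ fun ω => ?_) ?_
    · simpa using this
    · rw [sub_zero]
      refine (norm_add_le _ _).trans ?_
      rw [norm_smul, norm_smul]
      gcongr
      · exact (norm_sub_le _ _).trans (add_le_add (haC _ _) (haC' _))
      · exact (norm_sub_le _ _).trans (add_le_add (hbC _ _) (hbC' _))
    · filter_upwards [hlima, hlimb] with ω h1 h2
      simpa using ((h1.sub_const (a' ω)).smul_const (x' ω)).add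
        ((h2.sub_const (b' ω)).smul_const (y' ω))

/-- Chain rule for a smooth function with bounded gradient of two functionals of `Dom(D)`. -/
lemma HasMalliavinDeriv.comp₂ [IsFiniteMeasure P] {F F' : Ω → ℝ} {G G' : Ω → GaussHilbert P Y}
    (H : HasMalliavinDeriv h F G) (H' : HasMalliavinDeriv h F' G') {Φ : ℝ × ℝ → ℝ}
    (hΦ : ContDiff ℝ (⊤ : ℕ∞) Φ) {C : ℝ} (hC : ∀ p, ‖fderiv ℝ Φ p‖ ≤ C) :
    HasMalliavinDeriv h (fun ω => Φ (F ω, F' ω))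
      (fun ω => fderiv ℝ Φ (F ω, F' ω) (1, 0) • G ω + fderiv ℝ Φ (F ω, F' ω) (0, 1) • G' ω) := by
  obtain ⟨hF, hG, n, f, hFf, hGf⟩ := H
  obtain ⟨hF', hG', n', f', hFf', hGf'⟩ := H'
  have hm := fun k => (isSmoothCyl_cylFun (h := h) (n k) (f k)).memLp
  have hm' := fun k => (isSmoothCyl_cylFun (h := h) (n' k) (f' k)).memLp
  -- extract a common subsequence along which both approximations converge almost surely
  obtain ⟨r, hr, hrae⟩ := exists_subseq_tendsto_ae_of_eLpNorm_two (fun k => (hm k).1.1) hF.1 hFf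
  obtain ⟨s, hs, hsae⟩ := exists_subseq_tendsto_ae_of_eLpNorm_two (fun k => (hm' (r k)).1.1) hF'.1
    (hFf'.comp hr.tendsto_atTop)
  set q : ℕ → ℕ := fun k => r (s k) with hq
  have hqt : Tendsto q atTop atTop := hr.tendsto_atTop.comp hs.tendsto_atTop
  set A := fun k ω => cylFun h (n (q k)) (f (q k)) ω
  set A' := fun k ω => cylFun h (n' (q k)) (f' (q k)) ω
  set B := fun k ω => cylDeriv h (n (q k)) (f (q k)) ω
  set B' := fun k ω => cylDeriv h (n' (q k)) (f' (q k)) ω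
  have hA : Tendsto (fun k => eLpNorm (fun ω => A k ω - F ω) 2 P) atTop (𝓝 0) := hFf.comp hqt
  have hA' : Tendsto (fun k => eLpNorm (fun ω => A' k ω - F' ω) 2 P) atTop (𝓝 0) := hFf'.comp hqt
  have hB : Tendsto (fun k => eLpNorm (fun ω => B k ω - G ω) 2 P) atTop (𝓝 0) := hGf.comp hqt
  have hB' : Tendsto (fun k => eLpNorm (fun ω => B' k ω - G' ω) 2 P) atTop (𝓝 0) := hGf'.comp hqt
  have hae : ∀ᵐ ω ∂P, Tendsto (fun k => (A k ω, A' k ω)) atTop (𝓝 (F ω, F' ω)) := by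
    filter_upwards [hrae, hsae] with ω h1 h2
    exact (h1.comp hs.tendsto_atTop).prodMk_nhds h2
  have hcd : Continuous (fderiv ℝ Φ) := hΦ.continuous_fderiv (by simp)
  have hcd1 : Continuous fun p => fderiv ℝ Φ p (1, 0) := hcd.clm_apply continuous_const
  have hcd2 : Continuous fun p => fderiv ℝ Φ p (0, 1) := hcd.clm_apply continuous_const
  have hb1 : ∀ p, |fderiv ℝ Φ p (1, 0)| ≤ C := fun p => by
    simpa [Prod.norm_def] using ContinuousLinearMap.le_of_opNorm_le _ (hC p) (1, 0)
  have hb2 : ∀ p, |fderiv ℝ Φ p (0, 1)| ≤ C := fun p => by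
    simpa [Prod.norm_def] using ContinuousLinearMap.le_of_opNorm_le _ (hC p) (0, 1)
  have hC0 : 0 ≤ C := (norm_nonneg _).trans (hC 0)
  have hlip : ∀ p p', |Φ p - Φ p'| ≤ C * (‖p.1 - p'.1‖ + ‖p.2 - p'.2‖) := by
    intro p p'
    refine (Convex.norm_image_sub_le_of_norm_fderiv_le (𝕜 := ℝ) (f := Φ) (s := Set.univ)
      (fun x _ => (hΦ.differentiable (by simp)).differentiableAt) (fun x _ => hC x) convex_univ
      (Set.mem_univ p') (Set.mem_univ p)).trans ?_
    gcongr
    rw [Prod.norm_def]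
    exact max_le_add_of_nonneg (norm_nonneg _) (norm_nonneg _)
  have hpair : AEStronglyMeasurable (fun ω => (F ω, F' ω)) P := hF.1.prodMk hF'.1
  have hΦF : MemLp (fun ω => Φ (F ω, F' ω)) 2 P := by
    have h0 : MemLp (fun ω => C * (‖F ω‖ + ‖F' ω‖)) 2 P :=
      MemLp.const_mul (f := fun ω => ‖F ω‖ + ‖F' ω‖) (hF.norm.add hF'.norm) C
    have h1 : MemLp (fun ω => |Φ 0| + C * (‖F ω‖ + ‖F' ω‖)) 2 P :=
      (memLp_const (|Φ 0|)).add h0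
    refine h1.mono (hΦ.continuous.comp_aestronglyMeasurable hpair) (ae_of_all _ fun ω => ?_)
    have h2 := hlip (F ω, F' ω) 0
    simp only [Prod.fst_zero, Prod.snd_zero, sub_zero] at h2
    have h3 := abs_sub_abs_le_abs_sub (Φ (F ω, F' ω)) (Φ 0)
    rw [Real.norm_eq_abs, Real.norm_eq_abs]
    refine le_trans ?_ (le_abs_self _)
    linarith
  refine HasMalliavinDeriv.of_tendsto (Fk := fun k ω => Φ (A k ω, A' k ω))
    (Gk := fun k ω => fderiv ℝ Φ (A k ω, A' k ω) (1, 0) • B k ω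
      + fderiv ℝ Φ (A k ω, A' k ω) (0, 1) • B' k ω) hΦF
    ((memLp_two_smul_of_bounded (hcd1.comp_aestronglyMeasurable hpair) (fun ω => hb1 _) hG).add
      (memLp_two_smul_of_bounded (hcd2.comp_aestronglyMeasurable hpair) (fun ω => hb2 _) hG'))
    (fun k => ?_) ?_ ?_
  · exact (((isSmoothCyl_cylFun (h := h) (n (q k)) (f (q k))).mono (le_max_left _ _)).comp₂
      ((isSmoothCyl_cylFun (h := h) (n' (q k)) (f' (q k))).mono (le_max_right _ _))
      hΦ).hasMalliavinDeriv
  · exact tendsto_eLpNorm_two_of_le_add (C := C) (v := fun k ω => A k ω - F ω)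
      (w := fun k ω => A' k ω - F' ω) (fun k => ((hm _).1.sub hF).1)
      (fun k => ((hm' _).1.sub hF').1) (fun k => ae_of_all _ fun ω => hlip _ _) hA hA'
  · have hpk : ∀ k, AEStronglyMeasurable (fun ω => (A k ω, A' k ω)) P := fun k =>
      (hm _).1.1.prodMk (hm' _).1.1
    refine tendsto_eLpNorm_two_smul_add_smul
      (a := fun k ω => fderiv ℝ Φ (A k ω, A' k ω) (1, 0))
      (b := fun k ω => fderiv ℝ Φ (A k ω, A' k ω) (0, 1))
      (fun k => hcd1.comp_aestronglyMeasurable (hpk k))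
      (fun k => hcd2.comp_aestronglyMeasurable (hpk k)) (hcd1.comp_aestronglyMeasurable hpair)
      (hcd2.comp_aestronglyMeasurable hpair) (fun k ω => hb1 _) (fun k ω => hb2 _)
      (fun ω => hb1 _) (fun ω => hb2 _) ?_ ?_ (fun k => (hm _).2) (fun k => (hm' _).2) hG hG' hB hB'
    · filter_upwards [hae] with ω hω
      exact (hcd1.tendsto _).comp hω
    · filter_upwards [hae] with ω hω
      exact (hcd2.tendsto _).comp hω

lemma HasMalliavinDeriv.sub [IsFiniteMeasure P] {F F' : Ω → ℝ} {G G' : Ω → GaussHilbert P Y}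
    (H : HasMalliavinDeriv h F G) (H' : HasMalliavinDeriv h F' G') :
    HasMalliavinDeriv h (fun ω => F ω - F' ω) (fun ω => G ω - G' ω) := by
  set L : ℝ × ℝ →L[ℝ] ℝ := ContinuousLinearMap.fst ℝ ℝ ℝ - ContinuousLinearMap.snd ℝ ℝ ℝ
  have key := H.comp₂ H' (Φ := L) L.contDiff (C := ‖L‖) (fun p => by rw [L.fderiv])
  have e : (fun ω => fderiv ℝ L (F ω, F' ω) (1, 0) • G ω + fderiv ℝ L (F ω, F' ω) (0, 1) • G' ω)
      = fun ω => G ω - G' ω := by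
    ext1 ω
    rw [L.fderiv]
    have h1 : L (1, 0) = 1 := by simp [L]
    have h2 : L (0, 1) = -1 := by simp [L]
    rw [h1, h2]
    have e1 : (1 : ℝ) • G ω = G ω := one_smul ℝ _
    have e2 : (-1 : ℝ) • G' ω = -G' ω := neg_one_smul ℝ _
    rw [e1, e2, sub_eq_add_neg]
  rw [e] at key
  exact key

/-- Chain and product rule for bounded smooth functions with bounded derivatives. -/
lemma HasMalliavinDeriv.mul_comp [IsFiniteMeasure P] {F F' : Ω → ℝ} {G G' : Ω → GaussHilbert P Y}
    (H : HasMalliavinDeriv h F G) (H' : HasMalliavinDeriv h F' G') {a b : ℝ → ℝ}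
    (ha : ContDiff ℝ (⊤ : ℕ∞) a) (hb : ContDiff ℝ (⊤ : ℕ∞) b) {C : ℝ} (hac : ∀ x, |a x| ≤ C)
    (hac' : ∀ x, |deriv a x| ≤ C) (hbc : ∀ x, |b x| ≤ C) (hbc' : ∀ x, |deriv b x| ≤ C) :
    HasMalliavinDeriv h (fun ω => a (F ω) * b (F' ω))
      (fun ω => (deriv a (F ω) * b (F' ω)) • G ω + (a (F ω) * deriv b (F' ω)) • G' ω) := by
  have hC0 : 0 ≤ C := (abs_nonneg _).trans (hac 0)
  have hd : ∀ p : ℝ × ℝ, HasFDerivAt (fun p : ℝ × ℝ => a p.1 * b p.2)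
      ((deriv a p.1 * b p.2) • ContinuousLinearMap.fst ℝ ℝ ℝ
        + (a p.1 * deriv b p.2) • ContinuousLinearMap.snd ℝ ℝ ℝ) p := by
    intro p
    have h1 : HasFDerivAt (fun p : ℝ × ℝ => a p.1) _ p :=
      ((ha.differentiable (by simp)).differentiableAt.hasDerivAt).comp_hasFDerivAt p
        (hasFDerivAt_fst (𝕜 := ℝ) (p := p))
    have h2 : HasFDerivAt (fun p : ℝ × ℝ => b p.2) _ p :=
      ((hb.differentiable (by simp)).differentiableAt.hasDerivAt).comp_hasFDerivAt p
        (hasFDerivAt_snd (𝕜 := ℝ) (p := p))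
    refine (h1.mul h2).congr_fderiv ?_
    rw [smul_smul, smul_smul, add_comm, mul_comm (b p.2)]
  have key := H.comp₂ H' (Φ := fun p : ℝ × ℝ => a p.1 * b p.2)
    ((ha.comp contDiff_fst).mul (hb.comp contDiff_snd)) (C := C * C + C * C) (fun p => by
      rw [(hd p).fderiv]
      refine (norm_add_le _ _).trans (add_le_add ?_ ?_)
      · rw [norm_smul, norm_mul]
        refine (mul_le_of_le_one_right (by positivity) (ContinuousLinearMap.norm_fst_le ..)).trans ?_
        gcongr
        exacts [hac' _, hbc _]
      · rw [norm_smul, norm_mul]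
        refine (mul_le_of_le_one_right (by positivity) (ContinuousLinearMap.norm_snd_le ..)).trans ?_
        gcongr
        exacts [hac _, hbc' _])
  simp only [fun p => (hd p).fderiv] at key
  simpa using key

lemma HasMalliavinDeriv.integral_mul_gaussVar [IsProbabilityMeasure P]
    (hgauss : IsGaussianProcess Y P) (hmean : ∀ t, ∫ ω, Y t ω ∂P = 0) {F : Ω → ℝ}
    {G : Ω → GaussHilbert P Y} (H : HasMalliavinDeriv h F G) (g : GaussHilbert P Y) :
    ∫ ω, F ω * gaussVar g ω ∂P = ∫ ω, inner ℝ (G ω) g ∂P := by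
  obtain ⟨hF, hG, n, f, h1, h2⟩ := H
  have hm := fun k => (isSmoothCyl_cylFun (h := h) (n k) (f k)).memLp
  have t1 := tendsto_integral_mul_of_eLpNorm_two (fun k => (hm k).1) hF (memLp_gaussVar g) h1
  have t2 := tendsto_integral_inner_of_eLpNorm_two (fun k => (hm k).2) hG
    (memLp_const g : MemLp (fun _ => g) 2 P) h2
  refine tendsto_nhds_unique t1 (t2.congr fun k => ?_)
  exact ((isSmoothCyl_cylFun (h := h) (n k) (f k)).integral_mul_gaussVar hgauss hmean g).symm

end ChainRule

/-! ### The local property of the derivative -/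

section LocalProperty

lemma eq_zero_of_inner_total_eq_zero {E : Type*} [NormedAddCommGroup E] [InnerProductSpace ℝ E]
    {h : ℕ → E} (htotal : (Submodule.span ℝ (Set.range h)).topologicalClosure = ⊤) {w : E}
    (hw : ∀ i, inner ℝ w (h i) = 0) : w = 0 := by
  have hd := Submodule.dense_iff_topologicalClosure_eq_top.2 htotal
  refine hd.eq_zero_of_inner_left ℝ fun v hv => ?_
  induction hv using Submodule.span_induction with
  | mem x hx => obtain ⟨i, rfl⟩ := hx; exact hw i
  | zero => simp
  | add x y _ _ hx hy => rw [inner_add_right, hx, hy, add_zero]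
  | smul a x _ hx => rw [real_inner_smul_right, hx, mul_zero]

lemma abs_arctan_le_two (x : ℝ) : |Real.arctan x| ≤ 2 := by
  have h1 := Real.arctan_lt_pi_div_two x
  have h2 := Real.neg_pi_div_two_lt_arctan x
  have h3 := Real.pi_le_four
  rw [abs_le]; constructor <;> linarith

lemma abs_deriv_arctan_le_one (x : ℝ) : |deriv Real.arctan x| ≤ 1 := by
  rw [Real.deriv_arctan]
  simp only
  rw [abs_of_nonneg (by positivity), div_le_one (by positivity)]
  nlinarith [sq_nonneg x]

lemma mul_arctan_nonneg (x : ℝ) : 0 ≤ x * Real.arctan x := by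
  rcases le_total 0 x with h | h
  · exact mul_nonneg h (Real.arctan_nonneg.2 h)
  · exact mul_nonneg_of_nonpos_of_nonpos h (by
      simpa using Real.arctan_strictMono.monotone h)

/-- `arctan (c x) / c`, with `c = m + 1`: a bounded function, uniformly small in `m`, whose
derivative tends to the indicator function of `{0}`. -/
noncomputable def arctanSpike (m : ℕ) (x : ℝ) : ℝ := ((m : ℝ) + 1)⁻¹ * Real.arctan ((m + 1) * x)

lemma hasDerivAt_arctanSpike (m : ℕ) (x : ℝ) :
    HasDerivAt (arctanSpike m) (1 / (1 + ((m + 1) * x) ^ 2)) x := by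
  have h1 : HasDerivAt (fun x : ℝ => ((m : ℝ) + 1) * x) ((m : ℝ) + 1) x := by
    simpa using (hasDerivAt_id x).const_mul ((m : ℝ) + 1)
  refine (h1.arctan.const_mul (((m : ℝ) + 1)⁻¹)).congr_deriv ?_
  field_simp

lemma contDiff_arctanSpike (m : ℕ) : ContDiff ℝ (⊤ : ℕ∞) (arctanSpike m) :=
  contDiff_const.mul (Real.contDiff_arctan.comp (contDiff_const.mul contDiff_id))

lemma abs_arctanSpike_le (m : ℕ) (x : ℝ) : |arctanSpike m x| ≤ 2 * (1 / ((m : ℝ) + 1)) := by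
  have h := abs_arctan_le_two ((m + 1) * x)
  have h0 : 0 < ((m : ℝ) + 1)⁻¹ := by positivity
  rw [arctanSpike, abs_mul, abs_of_pos h0, one_div, mul_comm]
  gcongr

lemma abs_arctanSpike_le_two (m : ℕ) (x : ℝ) : |arctanSpike m x| ≤ 2 :=
  (abs_arctanSpike_le m x).trans (by
    have : 1 / ((m : ℝ) + 1) ≤ 1 := by rw [div_le_one (by positivity)]; simp
    linarith)

lemma abs_deriv_arctanSpike_le (m : ℕ) (x : ℝ) : |deriv (arctanSpike m) x| ≤ 1 := by
  rw [(hasDerivAt_arctanSpike m x).deriv, abs_of_nonneg (by positivity),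
    div_le_one (by positivity)]
  nlinarith [sq_nonneg (((m : ℝ) + 1) * x)]

lemma tendsto_arctanSpike (x : ℝ) : Tendsto (fun m => arctanSpike m x) atTop (𝓝 0) := by
  refine squeeze_zero_norm (fun m => abs_arctanSpike_le m x) ?_
  simpa using (tendsto_one_div_add_atTop_nhds_zero_nat (𝕜 := ℝ)).const_mul 2

lemma tendsto_deriv_arctanSpike (x : ℝ) :
    Tendsto (fun m => deriv (arctanSpike m) x) atTop (𝓝 (if x = 0 then 1 else 0)) := by
  simp only [fun m => (hasDerivAt_arctanSpike m x).deriv]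
  split_ifs with hx
  · subst hx; simp
  · have h1 : Tendsto (fun m : ℕ => 1 + (((m : ℝ) + 1) * x) ^ 2) atTop atTop := by
      refine tendsto_atTop_add_const_left _ _ ?_
      simp only [mul_pow]
      refine Tendsto.atTop_mul_const (by positivity) ?_
      exact (tendsto_pow_atTop two_ne_zero).comp
        (tendsto_atTop_add_const_right _ _ tendsto_natCast_atTop_atTop)
    exact h1.inv_tendsto_atTop.congr fun m => by simp

variable {Ω ι : Type*} [MeasurableSpace Ω] {P : Measure Ω} {Y : ι → Ω → ℝ}
variable {h : ℕ → GaussHilbert P Y}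

lemma memLp_inner_const [IsFiniteMeasure P] {G : Ω → GaussHilbert P Y} (hG : MemLp G 2 P)
    (g : GaussHilbert P Y) : MemLp (fun ω => inner ℝ (G ω) g) 2 P :=
  hG.inner_const g

/-- The integral of `⟪DF, g⟫ arctan R` over `{F = 0}` vanishes, for all `F`, `R` in `Dom(D)`:
integrate by parts the product of `arctan R` with small functions of `F` whose derivatives tend to
the indicator function of `{F = 0}`. -/
lemma HasMalliavinDeriv.integral_zero_set [IsProbabilityMeasure P]
    (hgauss : IsGaussianProcess Y P) (hmean : ∀ t, ∫ ω, Y t ω ∂P = 0) {F R : Ω → ℝ}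
    {G V : Ω → GaussHilbert P Y} (H : HasMalliavinDeriv h F G) (HR : HasMalliavinDeriv h R V)
    (g : GaussHilbert P Y) :
    ∫ ω, (if F ω = 0 then (1 : ℝ) else 0) * (Real.arctan (R ω) * inner ℝ (G ω) g) ∂P = 0 := by
  have hFm := H.1.1
  have hRm := HR.1.1
  have hat : AEStronglyMeasurable (fun ω => Real.arctan (R ω)) P :=
    Real.continuous_arctan.comp_aestronglyMeasurable hRm
  have hcd : Continuous (deriv Real.arctan) :=
    (Real.contDiff_arctan (n := 1)).continuous_deriv le_rfl
  have iG : Integrable (fun ω => Real.arctan (R ω) * inner ℝ (G ω) g) P :=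
    ((memLp_inner_const H.2.1 g).integrable one_le_two).bdd_mul (c := 2) hat
      (ae_of_all _ fun ω => abs_arctan_le_two _)
  have iY : Integrable (fun ω => Real.arctan (R ω) * gaussVar g ω) P :=
    ((memLp_gaussVar g).integrable one_le_two).bdd_mul (c := 2) hat
      (ae_of_all _ fun ω => abs_arctan_le_two _)
  have iV : Integrable (fun ω => deriv Real.arctan (R ω) * inner ℝ (V ω) g) P :=
    ((memLp_inner_const HR.2.1 g).integrable one_le_two).bdd_mul (c := 1)
      (hcd.comp_aestronglyMeasurable hRm) (ae_of_all _ fun ω => abs_deriv_arctan_le_one _)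
  have iu := iY.sub iV
  have hsm : ∀ m, AEStronglyMeasurable (fun ω => arctanSpike m (F ω)) P := fun m =>
    (contDiff_arctanSpike m).continuous.comp_aestronglyMeasurable hFm
  have hsm' : ∀ m, AEStronglyMeasurable (fun ω => deriv (arctanSpike m) (F ω)) P := fun m =>
    ((contDiff_arctanSpike m).continuous_deriv (by simp)).comp_aestronglyMeasurable hFm
  have key : ∀ m, ∫ ω, arctanSpike m (F ω) * (Real.arctan (R ω) * gaussVar g ω
        - deriv Real.arctan (R ω) * inner ℝ (V ω) g) ∂P
      = ∫ ω, deriv (arctanSpike m) (F ω) * (Real.arctan (R ω) * inner ℝ (G ω) g) ∂P := by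
    intro m
    have hm := (H.mul_comp HR (contDiff_arctanSpike m) Real.contDiff_arctan (C := 2)
      (abs_arctanSpike_le_two m) (fun x => (abs_deriv_arctanSpike_le m x).trans one_le_two)
      abs_arctan_le_two (fun x => (abs_deriv_arctan_le_one x).trans
        one_le_two)).integral_mul_gaussVar hgauss hmean g
    have e : ∀ ω, inner ℝ ((deriv (arctanSpike m) (F ω) * Real.arctan (R ω)) • G ω
        + (arctanSpike m (F ω) * deriv Real.arctan (R ω)) • V ω) g
        = deriv (arctanSpike m) (F ω) * (Real.arctan (R ω) * inner ℝ (G ω) g)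
          + arctanSpike m (F ω) * (deriv Real.arctan (R ω) * inner ℝ (V ω) g) := by
      intro ω
      rw [inner_add_left, gaussHilbert_inner_smul_left, gaussHilbert_inner_smul_left]
      ring
    simp only [e] at hm
    rw [integral_add (iG.bdd_mul (c := 1) (hsm' m)
        (ae_of_all _ fun ω => abs_deriv_arctanSpike_le m _))
      (iV.bdd_mul (c := 2) (hsm m) (ae_of_all _ fun ω => abs_arctanSpike_le_two m _))] at hm
    have e2 : ∫ ω, arctanSpike m (F ω) * (Real.arctan (R ω) * gaussVar g ω
        - deriv Real.arctan (R ω) * inner ℝ (V ω) g) ∂P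
        = ∫ ω, arctanSpike m (F ω) * Real.arctan (R ω) * gaussVar g ω ∂P
          - ∫ ω, arctanSpike m (F ω) * (deriv Real.arctan (R ω) * inner ℝ (V ω) g) ∂P := by
      rw [← integral_sub]
      · congr 1; ext ω; ring
      · simpa only [mul_assoc] using iY.bdd_mul (c := 2) (hsm m)
          (ae_of_all _ fun ω => abs_arctanSpike_le_two m _)
      · exact iV.bdd_mul (c := 2) (hsm m) (ae_of_all _ fun ω => abs_arctanSpike_le_two m _)
    rw [e2, hm]; ring
  have t1 : Tendsto (fun m => ∫ ω, arctanSpike m (F ω) * (Real.arctan (R ω) * gaussVar g ω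
        - deriv Real.arctan (R ω) * inner ℝ (V ω) g) ∂P) atTop (𝓝 (∫ ω, 0 ∂P)) := by
    refine tendsto_integral_of_dominated_convergence _
      (fun m => (hsm m).mul iu.1) (iu.norm.const_mul 2) (fun m => ae_of_all _ fun ω => ?_)
      (ae_of_all _ fun ω => ?_)
    · rw [norm_mul]
      exact mul_le_mul_of_nonneg_right (abs_arctanSpike_le_two m _) (norm_nonneg _)
    · simpa using (tendsto_arctanSpike (F ω)).mul_const (Real.arctan (R ω) * gaussVar g ω
        - deriv Real.arctan (R ω) * inner ℝ (V ω) g)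
  have t2 : Tendsto (fun m => ∫ ω, deriv (arctanSpike m) (F ω)
        * (Real.arctan (R ω) * inner ℝ (G ω) g) ∂P) atTop
      (𝓝 (∫ ω, (if F ω = 0 then (1 : ℝ) else 0)
        * (Real.arctan (R ω) * inner ℝ (G ω) g) ∂P)) := by
    refine tendsto_integral_of_dominated_convergence _
      (fun m => (hsm' m).mul iG.1) iG.norm (fun m => ae_of_all _ fun ω => ?_)
      (ae_of_all _ fun ω => ?_)
    · rw [norm_mul]
      exact mul_le_of_le_one_left (norm_nonneg _) (abs_deriv_arctanSpike_le m _)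
    · exact (tendsto_deriv_arctanSpike (F ω)).mul_const _
  simp only [key, integral_zero] at t1
  exact tendsto_nhds_unique t2 t1

open LineDeriv in
/-- The scalar product of the derivative of a cylindrical functional with a fixed vector is again a
cylindrical functional. -/
lemma hasMalliavinDeriv_inner_cylDeriv [IsFiniteMeasure P] (n : ℕ)
    (f : 𝓢(Fin (n + 1) → ℝ, ℝ)) (g : GaussHilbert P Y) :
    ∃ V, HasMalliavinDeriv h (fun ω => inner ℝ (cylDeriv h n f ω) g) V := by
  set c : Fin (n + 1) → ℝ := fun i => inner ℝ (h i) g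
  refine ⟨cylDeriv h n (∂_{c} f), ?_⟩
  have e : (fun ω => inner ℝ (cylDeriv h n f ω) g) = cylFun h n (∂_{c} f) := by
    ext ω
    rw [cylDeriv_eq_coordGrad]
    exact inner_coordGrad _ _ _
  rw [e]
  exact (isSmoothCyl_cylFun n _).hasMalliavinDeriv

/-- Local property: the derivative vanishes a.s. where the functional vanishes. In particular the
derivative of a functional is unique, so `D` is closable. -/
lemma HasMalliavinDeriv.ae_eq_zero [IsProbabilityMeasure P]
    (hgauss : IsGaussianProcess Y P) (hmean : ∀ t, ∫ ω, Y t ω ∂P = 0)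
    (htotal : (Submodule.span ℝ (Set.range h)).topologicalClosure = ⊤) {F : Ω → ℝ}
    {G : Ω → GaussHilbert P Y} (H : HasMalliavinDeriv h F G) :
    ∀ᵐ ω ∂P, F ω = 0 → G ω = 0 := by
  have key : ∀ i, ∀ᵐ ω ∂P, F ω = 0 → inner ℝ (G ω) (h i) = 0 := by
    intro i
    obtain ⟨hF, hG, n, f, -, h2⟩ := id H
    have hm := fun k => (isSmoothCyl_cylFun (h := h) (n k) (f k)).memLp
    obtain ⟨r, hr, hrae⟩ := exists_subseq_tendsto_ae_of_eLpNorm_two (fun k => (hm k).2.1) hG.1 h2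
    have hW := memLp_inner_const hG (h i)
    have hind : AEStronglyMeasurable (fun ω => if F ω = 0 then (1 : ℝ) else 0) P :=
      aestronglyMeasurable_of_tendsto_ae atTop (fun m =>
        ((contDiff_arctanSpike m).continuous_deriv (by simp)).comp_aestronglyMeasurable hF.1)
        (ae_of_all _ fun ω => tendsto_deriv_arctanSpike (F ω))
    have hind1 : ∀ ω, |(if F ω = 0 then (1 : ℝ) else 0)| ≤ 1 := fun ω => by split_ifs <;> simp
    -- `⟪DF, h i⟫` need not lie in `Dom(D)`, but it is a limit of variables that do
    have hlim : Tendsto (fun k => ∫ ω, (if F ω = 0 then (1 : ℝ) else 0)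
        * (Real.arctan (inner ℝ (cylDeriv h (n (r k)) (f (r k)) ω) (h i))
          * inner ℝ (G ω) (h i)) ∂P) atTop
        (𝓝 (∫ ω, (if F ω = 0 then (1 : ℝ) else 0)
        * (Real.arctan (inner ℝ (G ω) (h i)) * inner ℝ (G ω) (h i)) ∂P)) := by
      refine tendsto_integral_of_dominated_convergence
        (fun ω => 2 * ‖inner ℝ (G ω) (h i)‖) (fun k => ?_)
        ((hW.integrable one_le_two).norm.const_mul 2) (fun k => ae_of_all _ fun ω => ?_) ?_
      · exact hind.mul ((Real.continuous_arctan.comp_aestronglyMeasurable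
          (memLp_inner_const (hm _).2 (h i)).1).mul hW.1)
      · rw [norm_mul, norm_mul]
        refine (mul_le_of_le_one_left (by positivity) (hind1 ω)).trans ?_
        gcongr
        exact abs_arctan_le_two _
      · filter_upwards [hrae] with ω hω
        exact (((Real.continuous_arctan.tendsto _).comp
          (hω.inner tendsto_const_nhds)).mul_const _).const_mul _
    have hzero : ∫ ω, (if F ω = 0 then (1 : ℝ) else 0)
        * (Real.arctan (inner ℝ (G ω) (h i)) * inner ℝ (G ω) (h i)) ∂P = 0 := by
      refine tendsto_nhds_unique hlim (tendsto_const_nhds.congr fun k => ?_)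
      obtain ⟨V, hV⟩ := hasMalliavinDeriv_inner_cylDeriv (h := h) (n (r k)) (f (r k)) (h i)
      exact (H.integral_zero_set hgauss hmean hV (h i)).symm
    rw [integral_eq_zero_iff_of_nonneg (fun ω => ?_)] at hzero
    · filter_upwards [hzero] with ω hω hFω
      simp only [hFω, if_true, one_mul, Pi.zero_apply, mul_eq_zero] at hω
      rcases hω with h1 | h1
      · simpa using h1
      · exact h1
    · exact ((hW.integrable one_le_two).bdd_mul (c := 2)
        (Real.continuous_arctan.comp_aestronglyMeasurable hW.1)
        (ae_of_all _ fun ω => abs_arctan_le_two _)).bdd_mul (c := 1) hind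
        (ae_of_all _ hind1)
    · have := mul_arctan_nonneg (inner ℝ (G ω) (h i))
      simp only [Pi.zero_apply]
      rw [mul_comm (Real.arctan _)]
      split_ifs
      · rw [one_mul]; exact this
      · rw [zero_mul]
  filter_upwards [ae_all_iff.2 key] with ω hω hF
  exact eq_zero_of_inner_total_eq_zero htotal fun i => hω i hF

/-- The local derivative is unique. -/
lemma HasLocalMalliavinDeriv.ae_eq [IsProbabilityMeasure P]
    (hgauss : IsGaussianProcess Y P) (hmean : ∀ t, ∫ ω, Y t ω ∂P = 0)
    (htotal : (Submodule.span ℝ (Set.range h)).topologicalClosure = ⊤) {F F' : Ω → ℝ}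
    {G G' : Ω → GaussHilbert P Y} (H : HasLocalMalliavinDeriv h F G)
    (H' : HasLocalMalliavinDeriv h F' G') (hFF : F =ᵐ[P] F') : G =ᵐ[P] G' := by
  obtain ⟨A, Fk, Gk, -, -, hA, hk, hloc⟩ := H
  obtain ⟨A', Fk', Gk', -, -, hA', hk', hloc'⟩ := H'
  have key : ∀ᵐ ω ∂P, ∀ k j, Fk k ω - Fk' j ω = 0 → Gk k ω - Gk' j ω = 0 := by
    rw [ae_all_iff]; intro k
    rw [ae_all_iff]; intro j
    exact ((hk k).sub (hk' j)).ae_eq_zero hgauss hmean htotal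
  filter_upwards [hA, hA', ae_all_iff.2 hloc, ae_all_iff.2 hloc', key, hFF]
    with ω ⟨k, hωk⟩ ⟨j, hωj⟩ h1 h2 h3 h4
  obtain ⟨a, b⟩ := h1 k hωk
  obtain ⟨a', b'⟩ := h2 j hωj
  rw [b, b']
  exact sub_eq_zero.1 (h3 k j (by rw [← a, ← a', h4, sub_self]))

end LocalProperty

/-! ### The local chain rule -/

section LocalChainRule

/-- A function smooth on an open set `U` agrees on a ball with a bounded smooth function with
bounded derivative on the line, if a larger closed ball lies in `U`. -/
lemma exists_smooth_bounded_eqOn_ball {g : ℝ → ℝ} {U : Set ℝ} (hU : IsOpen U)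
    (hg : ContDiffOn ℝ (⊤ : ℕ∞) g U) {c r R : ℝ} (hr : 0 < r) (hrR : r < R)
    (hR : Metric.closedBall c R ⊆ U) :
    ∃ (a : ℝ → ℝ) (C : ℝ), ContDiff ℝ (⊤ : ℕ∞) a ∧ (∀ x, |a x| ≤ C) ∧ (∀ x, |deriv a x| ≤ C) ∧
      Set.EqOn a g (Metric.ball c r) := by
  let χ : ContDiffBump c := ⟨r, R, hr, hrR⟩
  have hs : ContDiff ℝ (⊤ : ℕ∞) (fun x => χ x * g x) := by
    rw [contDiff_iff_contDiffAt]
    intro x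
    by_cases hx : x ∈ U
    · exact χ.contDiff.contDiffAt.mul (hg.contDiffAt (hU.mem_nhds hx))
    · have h1 : x ∉ tsupport χ := fun h => hx (hR (by rwa [χ.tsupport_eq] at h))
      have h2 := notMem_tsupport_iff_eventuallyEq.1 h1
      refine contDiffAt_const (c := (0 : ℝ)) |>.congr_of_eventuallyEq ?_
      filter_upwards [h2] with y hy
      rw [hy]; simp
  have hc : HasCompactSupport (fun x => χ x * g x) := χ.hasCompactSupport.mul_right
  obtain ⟨C, hC⟩ := hc.exists_bound_of_continuous hs.continuous
  obtain ⟨C', hC'⟩ := hc.deriv.exists_bound_of_continuous (hs.continuous_deriv (by simp))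
  refine ⟨_, max C C', hs, fun x => (hC x).trans (le_max_left _ _),
    fun x => (hC' x).trans (le_max_right _ _), fun x hx => ?_⟩
  have : χ x = 1 := χ.one_of_mem_closedBall (Metric.ball_subset_closedBall hx)
  simp only [this, one_mul]

lemma exists_smooth_bounded_eqOn_pos {g : ℝ → ℝ} (hg : ContDiffOn ℝ (⊤ : ℕ∞) g (Set.Ioi 0))
    (k : ℕ) :
    ∃ (a : ℝ → ℝ) (C : ℝ), ContDiff ℝ (⊤ : ℕ∞) a ∧ (∀ x, |a x| ≤ C) ∧ (∀ x, |deriv a x| ≤ C) ∧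
      Set.EqOn a g (Set.Ioo (1 / ((k : ℝ) + 2)) (k + 2)) := by
  have hk : (2 : ℝ) ≤ (k : ℝ) + 2 := by have : (0 : ℝ) ≤ k := k.cast_nonneg; linarith
  set s : ℝ := (k : ℝ) + 2
  have hs0 : 0 < 1 / s := by positivity
  have hs1 : 1 / s < s := by
    rw [div_lt_iff₀ (by linarith)]; nlinarith
  obtain ⟨a, C, h1, h2, h3, h4⟩ := exists_smooth_bounded_eqOn_ball isOpen_Ioi hg
    (c := (s + 1 / s) / 2) (r := (s - 1 / s) / 2) (R := s / 2) (by linarith) (by linarith)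
    (fun x hx => by
      rw [Real.closedBall_eq_Icc] at hx
      have := hx.1
      simp only [Set.mem_Ioi]; linarith)
  refine ⟨a, C, h1, h2, h3, ?_⟩
  rw [Real.ball_eq_Ioo] at h4
  convert h4 using 2 <;> ring

lemma exists_smooth_bounded_eqOn_id (k : ℕ) :
    ∃ (a : ℝ → ℝ) (C : ℝ), ContDiff ℝ (⊤ : ℕ∞) a ∧ (∀ x, |a x| ≤ C) ∧ (∀ x, |deriv a x| ≤ C) ∧
      Set.EqOn a id (Set.Ioo (-((k : ℝ) + 2)) (k + 2)) := by
  have hk : (0 : ℝ) ≤ k := k.cast_nonneg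
  obtain ⟨a, C, h1, h2, h3, h4⟩ := exists_smooth_bounded_eqOn_ball (g := id) isOpen_univ
    contDiff_id.contDiffOn (c := 0) (r := (k : ℝ) + 2) (R := k + 3) (by linarith) (by linarith)
    (Set.subset_univ _)
  refine ⟨a, C, h1, h2, h3, ?_⟩
  rw [Real.ball_eq_Ioo] at h4
  simpa using h4

variable {Ω ι : Type*} [MeasurableSpace Ω] {P : Measure Ω} {Y : ι → Ω → ℝ}
variable {h : ℕ → GaussHilbert P Y}

/-- Local chain and product rule for `g(F) R`, where `F > 0` and `g` is smooth on `(0, ∞)`: on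
`{1/(k+2) < F < k+2, |R| < k+2}` the function `g` and the identity may be replaced by bounded smooth
functions. -/
lemma HasMalliavinDeriv.hasLocal_mul_comp [IsFiniteMeasure P] {F R : Ω → ℝ}
    {G V : Ω → GaussHilbert P Y} (HF : HasMalliavinDeriv h F G) (HR : HasMalliavinDeriv h R V)
    (hpos : ∀ᵐ ω ∂P, 0 < F ω) {g g' : ℝ → ℝ} (hg : ContDiffOn ℝ (⊤ : ℕ∞) g (Set.Ioi 0))
    (hg' : ∀ x, 0 < x → HasDerivAt g (g' x) x) :
    HasLocalMalliavinDeriv h (fun ω => g (F ω) * R ω)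
      (fun ω => (g' (F ω) * R ω) • G ω + g (F ω) • V ω) := by
  choose a C ha1 ha2 ha3 ha4 using exists_smooth_bounded_eqOn_pos hg
  choose b D hb1 hb2 hb3 hb4 using exists_smooth_bounded_eqOn_id
  have hF := HF.1.1
  have hR := HR.1.1
  refine ⟨fun k => {ω | hF.mk F ω ∈ Set.Ioo (1 / ((k : ℝ) + 2)) (k + 2)} ∩
      {ω | hR.mk R ω ∈ Set.Ioo (-((k : ℝ) + 2)) (k + 2)},
    fun k ω => a k (F ω) * b k (R ω),
    fun k ω => (deriv (a k) (F ω) * b k (R ω)) • G ω + (a k (F ω) * deriv (b k) (R ω)) • V ω,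
    fun k => ?_, fun i j hij ω hω => ?_, ?_, fun k => ?_, fun k => ?_⟩
  · exact (hF.stronglyMeasurable_mk.measurable measurableSet_Ioo).inter
      (hR.stronglyMeasurable_mk.measurable measurableSet_Ioo)
  · have hij' : (i : ℝ) ≤ j := by exact_mod_cast hij
    obtain ⟨⟨h1, h2⟩, h3, h4⟩ := hω
    refine ⟨⟨lt_of_le_of_lt ?_ h1, by linarith⟩, by linarith, by linarith⟩
    gcongr
  · filter_upwards [hpos, hF.ae_eq_mk] with ω h1 h2
    obtain ⟨k, hk⟩ := exists_nat_gt (max (max (1 / F ω) (F ω)) |hR.mk R ω|)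
    simp only [max_lt_iff] at hk
    obtain ⟨⟨k1, k2⟩, k3⟩ := hk
    have k4 := abs_lt.1 k3
    refine ⟨k, ⟨?_, ?_⟩, by linarith, by linarith⟩
    · rw [← h2, one_div_lt (by positivity) h1]; linarith
    · rw [← h2]; linarith
  · refine HF.mul_comp HR (ha1 k) (hb1 k) (C := max (C k) (D k))
      (fun x => (ha2 k x).trans (le_max_left _ _)) (fun x => (ha3 k x).trans (le_max_left _ _))
      (fun x => (hb2 k x).trans (le_max_right _ _)) (fun x => (hb3 k x).trans (le_max_right _ _))
  · filter_upwards [hF.ae_eq_mk, hR.ae_eq_mk, hpos] with ω h1 h2 h3 hω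
    obtain ⟨hω1, hω2⟩ := hω
    simp only [Set.mem_ofPred_eq, ← h1, ← h2] at hω1 hω2
    have e1 : a k (F ω) = g (F ω) := ha4 k hω1
    have e2 : b k (R ω) = R ω := hb4 k hω2
    have e3 : deriv (a k) (F ω) = g' (F ω) := by
      rw [← (hg' _ h3).deriv]
      exact ((ha4 k).eventuallyEq_of_mem (isOpen_Ioo.mem_nhds hω1)).deriv_eq
    have e4 : deriv (b k) (R ω) = 1 := by
      rw [((hb4 k).eventuallyEq_of_mem (isOpen_Ioo.mem_nhds hω2)).deriv_eq]
      exact deriv_id _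
    simp only [e1, e2, e3, e4, mul_one, and_self]

lemma HasMalliavinDeriv.hasLocal_comp [IsFiniteMeasure P] {F : Ω → ℝ}
    {G : Ω → GaussHilbert P Y} (HF : HasMalliavinDeriv h F G)
    (hpos : ∀ᵐ ω ∂P, 0 < F ω) {g g' : ℝ → ℝ} (hg : ContDiffOn ℝ (⊤ : ℕ∞) g (Set.Ioi 0))
    (hg' : ∀ x, 0 < x → HasDerivAt g (g' x) x) :
    HasLocalMalliavinDeriv h (fun ω => g (F ω)) (fun ω => g' (F ω) • G ω) := by
  have := HF.hasLocal_mul_comp (isSmoothCyl_const (h := h) 1).hasMalliavinDeriv hpos hg hg'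
  have e : (fun ω => (g' (F ω) * 1) • G ω + g (F ω) • (0 : GaussHilbert P Y))
      = fun ω => g' (F ω) • G ω := by
    ext1 ω
    rw [mul_one, show g (F ω) • (0 : GaussHilbert P Y) = 0 from smul_zero _, add_zero]
  rw [e] at this
  simpa only [mul_one] using this

lemma HasMalliavinDeriv.hasLocal_log [IsFiniteMeasure P] {F : Ω → ℝ}
    {G : Ω → GaussHilbert P Y} (HF : HasMalliavinDeriv h F G) (hpos : ∀ᵐ ω ∂P, 0 < F ω) :
    HasLocalMalliavinDeriv h (fun ω => Real.log (F ω)) (fun ω => (F ω)⁻¹ • G ω) :=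
  HF.hasLocal_comp hpos (g' := fun x => x⁻¹)
    (Real.contDiffOn_log.mono fun _ hx => (Set.mem_Ioi.1 hx).ne')
    fun _ hx => Real.hasDerivAt_log hx.ne'

lemma contDiffOn_sqrt_pos : ContDiffOn ℝ (⊤ : ℕ∞) (fun x : ℝ => √x) (Set.Ioi 0) :=
  fun _ hx => (Real.contDiffAt_sqrt (Set.mem_Ioi.1 hx).ne').contDiffWithinAt

lemma HasMalliavinDeriv.hasLocal_sqrt [IsFiniteMeasure P] {F : Ω → ℝ}
    {G : Ω → GaussHilbert P Y} (HF : HasMalliavinDeriv h F G) (hpos : ∀ᵐ ω ∂P, 0 < F ω) :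
    HasLocalMalliavinDeriv h (fun ω => √(F ω)) (fun ω => (1 / (2 * √(F ω))) • G ω) :=
  HF.hasLocal_comp hpos (g := fun x => √x) (g' := fun x => 1 / (2 * √x)) contDiffOn_sqrt_pos
    fun _ hx => Real.hasDerivAt_sqrt hx.ne'

/-- The product rule behind `D_t D_t √F = D_t (D_t F / (2 √F))`. -/
lemma HasMalliavinDeriv.hasLocal_div_sqrt [IsFiniteMeasure P] {F R : Ω → ℝ}
    {G V : Ω → GaussHilbert P Y} (HF : HasMalliavinDeriv h F G) (HR : HasMalliavinDeriv h R V)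
    (hpos : ∀ᵐ ω ∂P, 0 < F ω) :
    HasLocalMalliavinDeriv h (fun ω => 1 / (2 * √(F ω)) * R ω)
      (fun ω => (-(1 / (4 * (F ω * √(F ω)))) * R ω) • G ω + (1 / (2 * √(F ω))) • V ω) := by
  refine HF.hasLocal_mul_comp HR hpos (g := fun x => 1 / (2 * √x))
    (g' := fun x => -(1 / (4 * (x * √x)))) ?_ fun x hx => ?_
  · refine contDiffOn_const.div (contDiffOn_const.mul contDiffOn_sqrt_pos) fun x hx => ?_
    have := Real.sqrt_pos.2 (Set.mem_Ioi.1 hx)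
    positivity
  · have hs := Real.sqrt_pos.2 hx
    have h1 := ((Real.hasDerivAt_sqrt hx.ne').const_mul 2).inv (by positivity)
    simp only [one_div]
    refine h1.congr_deriv ?_
    have h2 : √x ^ 2 = x := Real.sq_sqrt hx.le
    rw [mul_pow, h2]
    field_simp
    norm_num

end LocalChainRule

/-! ### Evaluation of derivatives at the points of the parameter set -/

section Evaluation

variable {Ω ι : Type*} [MeasurableSpace Ω] {P : Measure Ω} {Y : ι → Ω → ℝ}

/-- The vectors `χ_t`, i.e. the variables `Y t` as elements of the Gaussian Hilbert space. -/
lemma exists_gaussVar_eq (hgauss : IsGaussianProcess Y P) :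
    ∃ χ : ι → GaussHilbert P Y, ∀ t, gaussVar (χ t) =ᵐ[P] Y t := by
  have hm : ∀ t, MemLp (Y t) 2 P := fun t => (hgauss.hasGaussianLaw_eval t).memLp_two
  exact ⟨fun t => ⟨(hm t).toLp (Y t), Submodule.le_topologicalClosure _
    (Submodule.subset_span ⟨t, (hm t).coeFn_toLp⟩)⟩, fun t => (hm t).coeFn_toLp⟩

variable {χ : ι → GaussHilbert P Y}

lemma covOp_eq_inner (hχ : ∀ t, gaussVar (χ t) =ᵐ[P] Y t) (g : GaussHilbert P Y) (t : ι) :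
    covOp g t = inner ℝ g (χ t) := by
  rw [inner_eq_integral_gaussVar]
  refine integral_congr_ae ?_
  filter_upwards [hχ t] with ω hω
  rw [hω, mul_comm]

lemma derivAt_eq_inner (hχ : ∀ t, gaussVar (χ t) =ᵐ[P] Y t) (G : Ω → GaussHilbert P Y) (t : ι)
    (ω : Ω) : derivAt G t ω = inner ℝ (G ω) (χ t) := covOp_eq_inner hχ (G ω) t

lemma norm_sq_eq_of_cov (hχ : ∀ t, gaussVar (χ t) =ᵐ[P] Y t) {γ : ι → ι → ℝ}
    (hcov : ∀ s t, ∫ ω, Y s ω * Y t ω ∂P = γ s t) (t : ι) : ‖χ t‖ ^ 2 = γ t t := by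
  rw [← real_inner_self_eq_norm_sq, inner_eq_integral_gaussVar, ← hcov]
  refine integral_congr_ae ?_
  filter_upwards [hχ t] with ω' hω'
  rw [hω']

variable [MeasurableSpace ι] {μ : Measure ι}

lemma aestronglyMeasurable_inner_const [SFinite P] [SFinite μ] (hχ : ∀ t, gaussVar (χ t) =ᵐ[P] Y t)
    (hmeas : AEStronglyMeasurable (fun p : Ω × ι => Y p.2 p.1) (P.prod μ))
    (g : GaussHilbert P Y) : AEStronglyMeasurable (fun t => inner ℝ g (χ t)) μ := by
  have h1 : AEStronglyMeasurable (fun p : ι × Ω => Y p.1 p.2 * gaussVar g p.2) (μ.prod P) :=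
    hmeas.prod_swap.mul ((memLp_gaussVar g).1.comp_snd)
  exact h1.integral_prod_right'.congr (ae_of_all _ fun t => covOp_eq_inner hχ g t)

/-- `(ω, t) ↦ ⟪χ_t, G ω⟫` is jointly measurable, by approximation of `G` by simple functions. -/
lemma aestronglyMeasurable_inner_prod [SFinite P] [SFinite μ]
    (hχ : ∀ t, gaussVar (χ t) =ᵐ[P] Y t)
    (hmeas : AEStronglyMeasurable (fun p : Ω × ι => Y p.2 p.1) (P.prod μ))
    {G : Ω → GaussHilbert P Y} (hG : AEStronglyMeasurable G P) :
    AEStronglyMeasurable (fun p : Ω × ι => inner ℝ (G p.1) (χ p.2)) (P.prod μ) := by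
  have hs : ∀ s : SimpleFunc Ω (GaussHilbert P Y),
      AEStronglyMeasurable (fun p : Ω × ι => inner ℝ (s p.1) (χ p.2)) (P.prod μ) := by
    intro s
    induction s using SimpleFunc.induction with
    | @const c A hA =>
      have h1 : AEStronglyMeasurable (fun p : Ω × ι => inner ℝ c (χ p.2)) (P.prod μ) :=
        (aestronglyMeasurable_inner_const hχ hmeas c).comp_snd
      refine (h1.indicator (measurable_fst hA)).congr (ae_of_all _ fun p => ?_)
      by_cases hp : p.1 ∈ A
      · simp [hp]
      · simp [hp]
    | @add f g _ hf hg =>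
      refine (hf.add hg).congr (ae_of_all _ fun p => ?_)
      simp [inner_add_left]
  have hmk := hG.stronglyMeasurable_mk
  have h1 : AEStronglyMeasurable (fun p : Ω × ι => inner ℝ (hG.mk G p.1) (χ p.2)) (P.prod μ) :=
    aestronglyMeasurable_of_tendsto_ae atTop (fun n => hs (hmk.approx n))
      (ae_of_all _ fun p => (hmk.tendsto_approx p.1).inner tendsto_const_nhds)
  refine h1.congr ?_
  filter_upwards [Measure.quasiMeasurePreserving_fst.ae hG.ae_eq_mk] with p hp
  rw [hp]

end Evaluation

/-! ### Integration by parts for products with unbounded factors -/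

section Truncation

/-- The truncation `(m + 1) arctan (x / (m + 1))` of the identity. -/
noncomputable def arctanTrunc (m : ℕ) (x : ℝ) : ℝ :=
  ((m : ℝ) + 1) * Real.arctan (((m : ℝ) + 1)⁻¹ * x)

lemma hasDerivAt_arctanTrunc (m : ℕ) (x : ℝ) :
    HasDerivAt (arctanTrunc m) (1 / (1 + (((m : ℝ) + 1)⁻¹ * x) ^ 2)) x := by
  have h1 : HasDerivAt (fun x : ℝ => ((m : ℝ) + 1)⁻¹ * x) (((m : ℝ) + 1)⁻¹) x := by
    simpa using (hasDerivAt_id x).const_mul (((m : ℝ) + 1)⁻¹)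
  refine (h1.arctan.const_mul ((m : ℝ) + 1)).congr_deriv ?_
  have : (m : ℝ) + 1 ≠ 0 := by positivity
  rw [mul_left_comm, mul_inv_cancel₀ this, mul_one]

lemma contDiff_arctanTrunc (m : ℕ) : ContDiff ℝ (⊤ : ℕ∞) (arctanTrunc m) :=
  contDiff_const.mul (Real.contDiff_arctan.comp (contDiff_const.mul contDiff_id))

lemma abs_arctanTrunc_le (m : ℕ) (x : ℝ) : |arctanTrunc m x| ≤ 2 * ((m : ℝ) + 1) := by
  have h0 : 0 < (m : ℝ) + 1 := by positivity
  rw [arctanTrunc, abs_mul, abs_of_pos h0, mul_comm]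
  gcongr
  exact abs_arctan_le_two _

lemma abs_deriv_arctanTrunc_le (m : ℕ) (x : ℝ) : |deriv (arctanTrunc m) x| ≤ 1 := by
  rw [(hasDerivAt_arctanTrunc m x).deriv, abs_of_nonneg (by positivity),
    div_le_one (by positivity)]
  nlinarith [sq_nonneg (((m : ℝ) + 1)⁻¹ * x)]

lemma abs_arctanTrunc_le_abs (m : ℕ) (x : ℝ) : |arctanTrunc m x| ≤ |x| := by
  have := Convex.norm_image_sub_le_of_norm_deriv_le (𝕜 := ℝ) (f := arctanTrunc m) (s := Set.univ)
    (C := 1) (x := 0) (y := x) (fun x _ => (hasDerivAt_arctanTrunc m x).differentiableAt)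
    (fun x _ => abs_deriv_arctanTrunc_le m x) convex_univ (Set.mem_univ _) (Set.mem_univ _)
  simpa [arctanTrunc] using this

lemma tendsto_arctanTrunc (x : ℝ) : Tendsto (fun m => arctanTrunc m x) atTop (𝓝 x) := by
  have h1 : HasDerivAt (fun s : ℝ => Real.arctan (s * x)) x 0 := by
    have h2 : HasDerivAt (fun s : ℝ => s * x) x 0 := by
      simpa using (hasDerivAt_id (0 : ℝ)).mul_const x
    simpa using h2.arctan
  rw [hasDerivAt_iff_tendsto_slope_zero] at h1
  have h3 : Tendsto (fun m : ℕ => ((m : ℝ) + 1)⁻¹) atTop (𝓝[≠] 0) := by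
    refine tendsto_nhdsWithin_iff.2 ⟨?_, Eventually.of_forall fun m => ?_⟩
    · simpa using tendsto_one_div_add_atTop_nhds_zero_nat (𝕜 := ℝ)
    · have : (m : ℝ) + 1 ≠ 0 := by positivity
      simpa using this
  refine (h1.comp h3).congr fun m => ?_
  simp [arctanTrunc]

lemma tendsto_deriv_arctanTrunc (x : ℝ) :
    Tendsto (fun m => deriv (arctanTrunc m) x) atTop (𝓝 1) := by
  simp only [fun m => (hasDerivAt_arctanTrunc m x).deriv]
  have h0 : Tendsto (fun m : ℕ => ((m : ℝ) + 1)⁻¹) atTop (𝓝 0) := by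
    simpa using tendsto_one_div_add_atTop_nhds_zero_nat (𝕜 := ℝ)
  have h1 : Tendsto (fun m : ℕ => 1 / (1 + (((m : ℝ) + 1)⁻¹ * x) ^ 2)) atTop
      (𝓝 (1 / (1 + (0 * x) ^ 2))) :=
    tendsto_const_nhds.div (tendsto_const_nhds.add ((h0.mul_const x).pow 2)) (by simp)
  simpa using h1

variable {Ω ι : Type*} [MeasurableSpace Ω] {P : Measure Ω} {Y : ι → Ω → ℝ}
variable {h : ℕ → GaussHilbert P Y}

/-- Integration by parts for `a(F) R` with `R` in `Dom(D)` unbounded; the derivative of `a(F) R`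
is only integrable, so that `a(F) R` need not lie in `Dom(D)`. -/
lemma HasMalliavinDeriv.integral_comp_mul_gaussVar [IsProbabilityMeasure P]
    (hgauss : IsGaussianProcess Y P) (hmean : ∀ t, ∫ ω, Y t ω ∂P = 0) {F R : Ω → ℝ}
    {G V : Ω → GaussHilbert P Y} (H : HasMalliavinDeriv h F G) (HR : HasMalliavinDeriv h R V)
    {a : ℝ → ℝ} (ha : ContDiff ℝ (⊤ : ℕ∞) a) {C : ℝ} (haC : ∀ x, |a x| ≤ C)
    (haC' : ∀ x, |deriv a x| ≤ C) (g : GaussHilbert P Y) :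
    ∫ ω, a (F ω) * R ω * gaussVar g ω ∂P
      = ∫ ω, (a (F ω) * inner ℝ (V ω) g + deriv a (F ω) * (R ω * inner ℝ (G ω) g)) ∂P := by
  have hFm := H.1.1
  have hRm := HR.1.1
  have hC0 : 0 ≤ C := (abs_nonneg _).trans (haC 0)
  have ham : AEStronglyMeasurable (fun ω => a (F ω)) P :=
    ha.continuous.comp_aestronglyMeasurable hFm
  have ham' : AEStronglyMeasurable (fun ω => deriv a (F ω)) P :=
    (ha.continuous_deriv (by simp)).comp_aestronglyMeasurable hFm
  have hbm : ∀ m, AEStronglyMeasurable (fun ω => arctanTrunc m (R ω)) P := fun m =>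
    (contDiff_arctanTrunc m).continuous.comp_aestronglyMeasurable hRm
  have hbm' : ∀ m, AEStronglyMeasurable (fun ω => deriv (arctanTrunc m) (R ω)) P := fun m =>
    ((contDiff_arctanTrunc m).continuous_deriv (by simp)).comp_aestronglyMeasurable hRm
  have hV := memLp_inner_const HR.2.1 g
  have hG := memLp_inner_const H.2.1 g
  have iV := hV.integrable one_le_two
  have iRG : Integrable (fun ω => R ω * inner ℝ (G ω) g) P := HR.1.integrable_mul hG
  have iRY : Integrable (fun ω => R ω * gaussVar g ω) P := HR.1.integrable_mul (memLp_gaussVar g)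
  have key : ∀ m, ∫ ω, a (F ω) * arctanTrunc m (R ω) * gaussVar g ω ∂P
      = ∫ ω, (a (F ω) * (deriv (arctanTrunc m) (R ω) * inner ℝ (V ω) g)
        + deriv a (F ω) * (arctanTrunc m (R ω) * inner ℝ (G ω) g)) ∂P := by
    intro m
    have hm : (1 : ℝ) ≤ 2 * ((m : ℝ) + 1) := by
      have : (0 : ℝ) ≤ m := m.cast_nonneg
      linarith
    have h1 := (H.mul_comp HR ha (contDiff_arctanTrunc m) (C := max C (2 * ((m : ℝ) + 1)))
      (fun x => (haC x).trans (le_max_left _ _)) (fun x => (haC' x).trans (le_max_left _ _))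
      (fun x => (abs_arctanTrunc_le m x).trans (le_max_right _ _))
      (fun x => (abs_deriv_arctanTrunc_le m x).trans
        (hm.trans (le_max_right _ _)))).integral_mul_gaussVar hgauss hmean g
    rw [h1]
    congr 1; ext ω
    rw [inner_add_left, gaussHilbert_inner_smul_left, gaussHilbert_inner_smul_left]
    ring
  have t1 : Tendsto (fun m => ∫ ω, a (F ω) * arctanTrunc m (R ω) * gaussVar g ω ∂P) atTop
      (𝓝 (∫ ω, a (F ω) * R ω * gaussVar g ω ∂P)) := by
    refine tendsto_integral_of_dominated_convergence (fun ω => C * ‖R ω * gaussVar g ω‖)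
      (fun m => (ham.mul (hbm m)).mul (memLp_gaussVar g).1) (iRY.norm.const_mul C)
      (fun m => ae_of_all _ fun ω => ?_) (ae_of_all _ fun ω => ?_)
    · rw [norm_mul, norm_mul, norm_mul, mul_assoc]
      gcongr
      · exact haC _
      · exact abs_arctanTrunc_le_abs m _
    · exact ((tendsto_arctanTrunc (R ω)).const_mul _).mul_const _
  have t2 : Tendsto (fun m => ∫ ω, (a (F ω) * (deriv (arctanTrunc m) (R ω) * inner ℝ (V ω) g)
        + deriv a (F ω) * (arctanTrunc m (R ω) * inner ℝ (G ω) g)) ∂P) atTop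
      (𝓝 (∫ ω, (a (F ω) * (1 * inner ℝ (V ω) g)
        + deriv a (F ω) * (R ω * inner ℝ (G ω) g)) ∂P)) := by
    refine tendsto_integral_of_dominated_convergence
      (fun ω => C * ‖inner ℝ (V ω) g‖ + C * ‖R ω * inner ℝ (G ω) g‖)
      (fun m => (ham.mul ((hbm' m).mul hV.1)).add (ham'.mul ((hbm m).mul hG.1)))
      ((iV.norm.const_mul C).add (iRG.norm.const_mul C))
      (fun m => ae_of_all _ fun ω => ?_) (ae_of_all _ fun ω => ?_)
    · refine (norm_add_le _ _).trans (add_le_add ?_ ?_)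
      · rw [norm_mul, norm_mul]
        gcongr
        · exact haC _
        · exact mul_le_of_le_one_left (norm_nonneg _) (abs_deriv_arctanTrunc_le m _)
      · rw [norm_mul, norm_mul, norm_mul]
        gcongr
        · exact haC' _
        · exact abs_arctanTrunc_le_abs m _
    · exact (((tendsto_deriv_arctanTrunc (R ω)).mul_const _).const_mul _).add
        (((tendsto_arctanTrunc (R ω)).mul_const _).const_mul _)
  simp only [key, one_mul] at t1 t2
  exact tendsto_nhds_unique t1 t2

end Truncation

/-! ### A smooth bounded approximation of the inverse function -/

section SoftInverse

/-- The derivative of `x ↦ (x + √(x² + δ²)) / 2`. It takes its values in `(0, 1)`, and in `(1/2, 1)`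
for `x > 0`. -/
noncomputable def softSlope (δ x : ℝ) : ℝ := (1 + x / √(x ^ 2 + δ ^ 2)) / 2

/-- A bounded smooth function on `ℝ` close to `1 / x` for `x > 0` and small `δ > 0`. With
`s(x) = (x + √(x² + δ²)) / 2`, which is positive and at least `x`, it is `1 / (s(x) + δ)`. -/
noncomputable def softInv (δ x : ℝ) : ℝ := ((x + √(x ^ 2 + δ ^ 2)) / 2 + δ)⁻¹

lemma abs_lt_sqrt_sq_add {δ : ℝ} (hδ : 0 < δ) (x : ℝ) : |x| < √(x ^ 2 + δ ^ 2) := by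
  rw [← Real.sqrt_sq_eq_abs]
  exact Real.sqrt_lt_sqrt (sq_nonneg _) (by nlinarith)

lemma softInv_denom_ge {δ : ℝ} (hδ : 0 < δ) (x : ℝ) :
    δ < (x + √(x ^ 2 + δ ^ 2)) / 2 + δ := by
  have h1 := abs_lt_sqrt_sq_add hδ x
  have h2 := neg_abs_le x
  linarith

lemma softInv_pos {δ : ℝ} (hδ : 0 < δ) (x : ℝ) : 0 < softInv δ x :=
  inv_pos.2 (hδ.trans (softInv_denom_ge hδ x))

lemma softInv_le {δ : ℝ} (hδ : 0 < δ) (x : ℝ) : softInv δ x ≤ δ⁻¹ :=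
  inv_anti₀ hδ (softInv_denom_ge hδ x).le

lemma softInv_le_inv {δ : ℝ} (hδ : 0 < δ) {x : ℝ} (hx : 0 < x) : softInv δ x ≤ x⁻¹ := by
  refine inv_anti₀ hx ?_
  have h1 := abs_lt_sqrt_sq_add hδ x
  rw [abs_of_pos hx] at h1
  linarith

lemma contDiff_softInv {δ : ℝ} (hδ : 0 < δ) : ContDiff ℝ (⊤ : ℕ∞) (softInv δ) := by
  have h1 : ContDiff ℝ (⊤ : ℕ∞) fun x : ℝ => √(x ^ 2 + δ ^ 2) :=
    ((contDiff_id.pow 2).add contDiff_const).sqrt fun x => by positivity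
  exact (((contDiff_id.add h1).div_const 2).add contDiff_const).inv fun x =>
    (hδ.trans (softInv_denom_ge hδ x)).ne'

lemma hasDerivAt_softInv {δ : ℝ} (hδ : 0 < δ) (x : ℝ) :
    HasDerivAt (softInv δ) (-(softSlope δ x * softInv δ x ^ 2)) x := by
  have h0 : HasDerivAt (fun x : ℝ => x ^ 2 + δ ^ 2) (2 * x) x := by
    simpa using (hasDerivAt_pow 2 x).add_const (δ ^ 2)
  have h1 := h0.sqrt (by positivity)
  have h2 := ((((hasDerivAt_id x).add h1).div_const 2).add_const δ).inv
    (hδ.trans (softInv_denom_ge hδ x)).ne'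
  refine h2.congr_deriv ?_
  have h3 : ((id : ℝ → ℝ) + fun x : ℝ => √(x ^ 2 + δ ^ 2)) x = x + √(x ^ 2 + δ ^ 2) := rfl
  rw [h3, softSlope, softInv, inv_pow, neg_div, ← div_eq_mul_inv,
    mul_div_mul_left _ _ (two_ne_zero' ℝ)]

lemma softSlope_mem {δ : ℝ} (hδ : 0 < δ) (x : ℝ) : 0 ≤ softSlope δ x ∧ softSlope δ x ≤ 1 := by
  have h1 := abs_lt_sqrt_sq_add hδ x
  have h0 : 0 < √(x ^ 2 + δ ^ 2) := (abs_nonneg x).trans_lt h1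
  have h2 : |x / √(x ^ 2 + δ ^ 2)| ≤ 1 := by
    rw [abs_div, abs_of_pos h0, div_le_one h0]
    exact h1.le
  obtain ⟨h3, h4⟩ := abs_le.1 h2
  unfold softSlope
  constructor <;> linarith

lemma half_le_softSlope {x : ℝ} (hx : 0 < x) (δ : ℝ) : 1 / 2 ≤ softSlope δ x := by
  have : 0 ≤ x / √(x ^ 2 + δ ^ 2) := by positivity
  unfold softSlope
  linarith

lemma abs_deriv_softInv_le {δ : ℝ} (hδ : 0 < δ) (x : ℝ) :
    |deriv (softInv δ) x| ≤ (δ⁻¹) ^ 2 := by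
  obtain ⟨h1, h2⟩ := softSlope_mem hδ x
  have h3 := softInv_pos hδ x
  rw [(hasDerivAt_softInv hδ x).deriv, abs_neg, abs_of_nonneg (by positivity)]
  calc softSlope δ x * softInv δ x ^ 2 ≤ 1 * softInv δ x ^ 2 := by gcongr
    _ ≤ (δ⁻¹) ^ 2 := by rw [one_mul]; gcongr; exact softInv_le hδ x

lemma tendsto_sqrt_sq_add {x : ℝ} (hx : 0 < x) :
    Tendsto (fun δ : ℝ => √(x ^ 2 + δ ^ 2)) (𝓝 0) (𝓝 x) := by
  have h : Continuous fun δ : ℝ => √(x ^ 2 + δ ^ 2) := by fun_prop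
  simpa [Real.sqrt_sq hx.le] using h.tendsto 0

lemma tendsto_softInv {x : ℝ} (hx : 0 < x) :
    Tendsto (fun δ => softInv δ x) (𝓝 0) (𝓝 x⁻¹) := by
  have h1 := (((tendsto_sqrt_sq_add hx).const_add x).div_const 2).add tendsto_id
  have h2 : (x + x) / 2 + 0 = x := by ring
  rw [h2] at h1
  exact h1.inv₀ hx.ne'

lemma tendsto_softSlope {x : ℝ} (hx : 0 < x) :
    Tendsto (fun δ => softSlope δ x) (𝓝 0) (𝓝 1) := by
  have h1 := ((tendsto_const_nhds (x := x)).div (tendsto_sqrt_sq_add hx) hx.ne').const_add 1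
    |>.div_const 2
  rw [div_self hx.ne', show ((1 : ℝ) + 1) / 2 = 1 by norm_num] at h1
  exact h1

end SoftInverse

/-! ### A consequence of Fatou's lemma -/

lemma integrable_of_tendsto_of_integral_le {α : Type*} [MeasurableSpace α] {m : Measure α}
    {f : ℕ → α → ℝ} {g : α → ℝ} {K : ℝ} (hf : ∀ n, Integrable (f n) m)
    (hf0 : ∀ n, 0 ≤ᵐ[m] f n) (hK : ∀ n, ∫ x, f n x ∂m ≤ K)
    (hlim : ∀ᵐ x ∂m, Tendsto (fun n => f n x) atTop (𝓝 (g x))) : Integrable g m := by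
  have hg := aestronglyMeasurable_of_tendsto_ae atTop (fun n => (hf n).1) hlim
  refine ⟨hg, ?_⟩
  have h1 : ∀ᵐ x ∂m, ‖g x‖ₑ = liminf (fun n => ‖f n x‖ₑ) atTop := by
    filter_upwards [hlim] with x hx
    exact hx.enorm.liminf_eq.symm
  rw [HasFiniteIntegral, lintegral_congr_ae h1]
  refine (lintegral_liminf_le' fun n => (hf n).1.enorm).trans_lt ?_
  have h2 : ∀ n, ∫⁻ x, ‖f n x‖ₑ ∂m ≤ ENNReal.ofReal K := by
    intro n
    rw [← ofReal_integral_norm_eq_lintegral_enorm (hf n)]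
    refine ENNReal.ofReal_le_ofReal ((le_of_eq ?_).trans (hK n))
    refine integral_congr_ae ?_
    filter_upwards [hf0 n] with x hx
    exact Real.norm_of_nonneg hx
  exact (liminf_le_of_le (by isBoundedDefault) fun b hb => by
    obtain ⟨n, hn⟩ := hb.exists
    exact hn.trans (h2 n)).trans_lt ENNReal.ofReal_lt_top

/-! ### Integrability of the logarithmic derivative -/

section LogDerivative

variable {Ω ι : Type*} [MeasurableSpace Ω] {P : Measure Ω}
  {Y : ι → Ω → ℝ} {h : ℕ → GaussHilbert P Y} {χ : ι → GaussHilbert P Y}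

lemma derivAt_smul (hχ : ∀ t, gaussVar (χ t) =ᵐ[P] Y t) (c : Ω → ℝ) (G : Ω → GaussHilbert P Y)
    (t : ι) (ω : Ω) : derivAt (fun ω => c ω • G ω) t ω = c ω * derivAt G t ω := by
  rw [derivAt_eq_inner hχ, derivAt_eq_inner hχ, gaussHilbert_inner_smul_left]

lemma derivAt_smul_add_smul (hχ : ∀ t, gaussVar (χ t) =ᵐ[P] Y t) (c d : Ω → ℝ)
    (G V : Ω → GaussHilbert P Y) (t : ι) (ω : Ω) :
    derivAt (fun ω => c ω • G ω + d ω • V ω) t ω = c ω * derivAt G t ω + d ω * derivAt V t ω := by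
  rw [derivAt_eq_inner hχ, derivAt_eq_inner hχ, derivAt_eq_inner hχ, inner_add_left,
    gaussHilbert_inner_smul_left, gaussHilbert_inner_smul_left]

lemma derivAt_sq_le (hχ : ∀ t, gaussVar (χ t) =ᵐ[P] Y t) (G : Ω → GaussHilbert P Y) (t : ι)
    (ω : Ω) : derivAt G t ω ^ 2 ≤ ‖G ω‖ ^ 2 * ‖χ t‖ ^ 2 := by
  rw [derivAt_eq_inner hχ, ← mul_pow, ← sq_abs]
  gcongr
  exact abs_real_inner_le_norm _ _

variable [MeasurableSpace ι] {μ : Measure ι}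

lemma aestronglyMeasurable_derivAt [SFinite P] [SFinite μ] (hχ : ∀ t, gaussVar (χ t) =ᵐ[P] Y t)
    (hmeas : AEStronglyMeasurable (fun p : Ω × ι => Y p.2 p.1) (P.prod μ))
    {G : Ω → GaussHilbert P Y} (hG : AEStronglyMeasurable G P) :
    AEStronglyMeasurable (fun p : Ω × ι => derivAt G p.2 p.1) (P.prod μ) := by
  simp only [derivAt_eq_inner hχ]
  exact aestronglyMeasurable_inner_prod hχ hmeas hG

lemma memLp_derivAt [IsProbabilityMeasure P] [IsFiniteMeasure μ]
    (hχ : ∀ t, gaussVar (χ t) =ᵐ[P] Y t)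
    (hmeas : AEStronglyMeasurable (fun p : Ω × ι => Y p.2 p.1) (P.prod μ))
    (hint : Integrable (fun t => ‖χ t‖ ^ 2) μ) {G : Ω → GaussHilbert P Y} (hG : MemLp G 2 P) :
    MemLp (fun p : Ω × ι => derivAt G p.2 p.1) 2 (P.prod μ) := by
  have hm := aestronglyMeasurable_derivAt hχ hmeas hG.1
  rw [memLp_two_iff_integrable_sq hm]
  have h1 : Integrable (fun ω => ‖G ω‖ ^ 2) P := (memLp_two_iff_integrable_sq_norm hG.1).1 hG
  refine (h1.mul_prod hint).mono' (hm.pow 2) (ae_of_all _ fun p => ?_)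
  rw [Real.norm_of_nonneg (sq_nonneg _)]
  exact derivAt_sq_le hχ G p.2 p.1

lemma integrable_derivAt_sq [SFinite P] [SFinite μ]
    (hχ : ∀ t, gaussVar (χ t) =ᵐ[P] Y t)
    (hmeas : AEStronglyMeasurable (fun p : Ω × ι => Y p.2 p.1) (P.prod μ))
    (hint : Integrable (fun t => ‖χ t‖ ^ 2) μ) (G : Ω → GaussHilbert P Y) (ω : Ω) :
    Integrable (fun t => derivAt G t ω ^ 2) μ := by
  refine (hint.const_mul (‖G ω‖ ^ 2)).mono' ?_ (ae_of_all _ fun t => ?_)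
  · simp only [derivAt_eq_inner hχ]
    exact (aestronglyMeasurable_inner_const hχ hmeas (G ω)).pow 2
  · rw [Real.norm_of_nonneg (sq_nonneg _)]
    exact derivAt_sq_le hχ G t ω

lemma memLp_process [IsProbabilityMeasure P] [IsFiniteMeasure μ]
    (hχ : ∀ t, gaussVar (χ t) =ᵐ[P] Y t)
    (hmeas : AEStronglyMeasurable (fun p : Ω × ι => Y p.2 p.1) (P.prod μ))
    (hint : Integrable (fun t => ‖χ t‖ ^ 2) μ) :
    MemLp (fun p : Ω × ι => Y p.2 p.1) 2 (P.prod μ) ∧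
      ∫ p : Ω × ι, Y p.2 p.1 ^ 2 ∂(P.prod μ) = ∫ t, ‖χ t‖ ^ 2 ∂μ := by
  have hYt : ∀ t, MemLp (Y t) 2 P := fun t => (memLp_congr_ae (hχ t)).1 (memLp_gaussVar (χ t))
  have hnorm : ∀ t, ∫ ω, Y t ω ^ 2 ∂P = ‖χ t‖ ^ 2 := by
    intro t
    rw [← real_inner_self_eq_norm_sq, inner_eq_integral_gaussVar]
    refine integral_congr_ae ?_
    filter_upwards [hχ t] with ω hω
    rw [hω, sq]
  have hsq : Integrable (fun p : Ω × ι => Y p.2 p.1 ^ 2) (P.prod μ) := by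
    have hm2 : AEStronglyMeasurable (fun p : Ω × ι => Y p.2 p.1 ^ 2) (P.prod μ) := hmeas.pow 2
    rw [integrable_prod_iff' hm2]
    refine ⟨ae_of_all _ fun t => (hYt t).integrable_sq, hint.congr (ae_of_all _ fun t => ?_)⟩
    simp only [norm_pow, Real.norm_eq_abs, sq_abs, hnorm]
  refine ⟨(memLp_two_iff_integrable_sq hmeas).2 hsq, ?_⟩
  rw [integral_prod_symm _ hsq]
  simp only [hnorm]

/-- Integration by parts for `a(F) D_t F`, integrated over `t`. -/
lemma integral_process_mul_comp_mul_derivAt [IsProbabilityMeasure P] [IsFiniteMeasure μ]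
    (hgauss : IsGaussianProcess Y P) (hmean : ∀ t, ∫ ω, Y t ω ∂P = 0)
    (hχ : ∀ t, gaussVar (χ t) =ᵐ[P] Y t)
    (hmeas : AEStronglyMeasurable (fun p : Ω × ι => Y p.2 p.1) (P.prod μ))
    (hint : Integrable (fun t => ‖χ t‖ ^ 2) μ) {F : Ω → ℝ} {G : Ω → GaussHilbert P Y}
    {G2 : ι → Ω → GaussHilbert P Y} (H : IsTwiceMalliavin h μ F G G2)
    {a : ℝ → ℝ} (ha : ContDiff ℝ (⊤ : ℕ∞) a) {C : ℝ} (haC : ∀ x, |a x| ≤ C)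
    (haC' : ∀ x, |deriv a x| ≤ C) :
    ∫ p : Ω × ι, Y p.2 p.1 * (a (F p.1) * derivAt G p.2 p.1) ∂(P.prod μ)
      = ∫ ω, a (F ω) * traceDeriv μ G2 ω ∂P
        + ∫ p : Ω × ι, deriv a (F p.1) * derivAt G p.2 p.1 ^ 2 ∂(P.prod μ) := by
  have hd := memLp_derivAt hχ hmeas hint H.deriv.2.1
  have hY := (memLp_process hχ hmeas hint).1
  have ham : AEStronglyMeasurable (fun p : Ω × ι => a (F p.1)) (P.prod μ) :=
    (ha.continuous.comp_aestronglyMeasurable H.deriv.1.1).comp_fst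
  have ham' : AEStronglyMeasurable (fun p : Ω × ι => deriv a (F p.1)) (P.prod μ) :=
    ((ha.continuous_deriv (by simp)).comp_aestronglyMeasurable H.deriv.1.1).comp_fst
  have i1 : Integrable (fun p : Ω × ι => a (F p.1) * (Y p.2 p.1 * derivAt G p.2 p.1))
      (P.prod μ) :=
    (hY.integrable_mul hd).bdd_mul (c := C) ham (ae_of_all _ fun p => haC _)
  have i2 : Integrable (fun p : Ω × ι => a (F p.1) * derivAt (G2 p.2) p.2 p.1) (P.prod μ) :=
    H.integrable.bdd_mul (c := C) ham (ae_of_all _ fun p => haC _)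
  have i3 : Integrable (fun p : Ω × ι => deriv a (F p.1) * derivAt G p.2 p.1 ^ 2) (P.prod μ) :=
    hd.integrable_sq.bdd_mul (c := C) ham' (ae_of_all _ fun p => haC' _)
  have key : ∀ t, ∫ ω, a (F ω) * (Y t ω * derivAt G t ω) ∂P
      = ∫ ω, (a (F ω) * derivAt (G2 t) t ω + deriv a (F ω) * derivAt G t ω ^ 2) ∂P := by
    intro t
    have h1 := H.deriv.integral_comp_mul_gaussVar hgauss hmean (H.deriv_deriv t) ha haC haC' (χ t)
    calc _ = ∫ ω, a (F ω) * derivAt G t ω * gaussVar (χ t) ω ∂P := by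
          refine integral_congr_ae ?_
          filter_upwards [hχ t] with ω hω
          rw [hω]; ring
      _ = _ := by
          rw [h1]
          congr 1; ext ω
          rw [derivAt_eq_inner hχ, derivAt_eq_inner hχ, sq]
  calc _ = ∫ p : Ω × ι, a (F p.1) * (Y p.2 p.1 * derivAt G p.2 p.1) ∂(P.prod μ) := by
        congr 1; ext p; ring
    _ = ∫ p : Ω × ι, (a (F p.1) * derivAt (G2 p.2) p.2 p.1
          + deriv a (F p.1) * derivAt G p.2 p.1 ^ 2) ∂(P.prod μ) := by
        have i23 : Integrable (fun p : Ω × ι => a (F p.1) * derivAt (G2 p.2) p.2 p.1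
          + deriv a (F p.1) * derivAt G p.2 p.1 ^ 2) (P.prod μ) := i2.add i3
        rw [integral_prod_symm _ i1, integral_prod_symm _ i23]
        simp only [key]
    _ = _ := by
        rw [integral_add i2 i3, integral_prod _ i2]
        simp only [integral_const_mul]
        rfl

/-- The heart of the Stein-type estimate. If `(ΔF/F)⁺` is integrable, then `D log F = DF/F` is
square-integrable, `ΔF/F` is integrable, and integration by parts holds for `DF/F`. The function
`1/x` is approximated by the bounded functions `softInv`, for which `-a' ≥ a² / 2` gives an a priori
bound on the norm of `a(F) DF`. -/
lemma integral_process_mul_log_deriv [IsProbabilityMeasure P] [IsFiniteMeasure μ]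
    (hgauss : IsGaussianProcess Y P) (hmean : ∀ t, ∫ ω, Y t ω ∂P = 0)
    (hχ : ∀ t, gaussVar (χ t) =ᵐ[P] Y t)
    (hmeas : AEStronglyMeasurable (fun p : Ω × ι => Y p.2 p.1) (P.prod μ))
    (hint : Integrable (fun t => ‖χ t‖ ^ 2) μ) {F : Ω → ℝ} {G : Ω → GaussHilbert P Y}
    {G2 : ι → Ω → GaussHilbert P Y} (H : IsTwiceMalliavin h μ F G G2)
    (hpos : ∀ᵐ ω ∂P, 0 < F ω)
    (hplus : Integrable (fun ω => max (traceDeriv μ G2 ω / F ω) 0) P) :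
    MemLp (fun p : Ω × ι => (F p.1)⁻¹ * derivAt G p.2 p.1) 2 (P.prod μ) ∧
    Integrable (fun ω => traceDeriv μ G2 ω / F ω) P ∧
    ∫ p : Ω × ι, Y p.2 p.1 * ((F p.1)⁻¹ * derivAt G p.2 p.1) ∂(P.prod μ)
      = ∫ ω, traceDeriv μ G2 ω / F ω ∂P
        - ∫ p : Ω × ι, ((F p.1)⁻¹ * derivAt G p.2 p.1) ^ 2 ∂(P.prod μ) := by
  set Δ : Ω → ℝ := traceDeriv μ G2 with hΔ
  set d : Ω × ι → ℝ := fun p => derivAt G p.2 p.1 with hddef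
  set y : Ω × ι → ℝ := fun p => Y p.2 p.1 with hydef
  have hd : MemLp d 2 (P.prod μ) := memLp_derivAt hχ hmeas hint H.deriv.2.1
  have hy : MemLp y 2 (P.prod μ) := (memLp_process hχ hmeas hint).1
  have hFm := H.deriv.1.1
  have hΔi : Integrable Δ P := H.integrable.integral_prod_left
  set δ : ℕ → ℝ := fun n => 1 / ((n : ℝ) + 1) with hδdef
  have hδ : ∀ n, 0 < δ n := fun n => by positivity
  have hδ0 : Tendsto δ atTop (𝓝 0) := tendsto_one_div_add_atTop_nhds_zero_nat
  have hpos' : ∀ᵐ p ∂(P.prod μ), 0 < F p.1 := Measure.quasiMeasurePreserving_fst.ae hpos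
  have hac : ∀ n x, |softInv (δ n) x| ≤ (δ n)⁻¹ := fun n x => by
    rw [abs_of_pos (softInv_pos (hδ n) x)]; exact softInv_le (hδ n) x
  have ham : ∀ n, AEStronglyMeasurable (fun ω => softInv (δ n) (F ω)) P := fun n =>
    (contDiff_softInv (hδ n)).continuous.comp_aestronglyMeasurable hFm
  have hamp : ∀ n, AEStronglyMeasurable (fun p : Ω × ι => softInv (δ n) (F p.1)) (P.prod μ) :=
    fun n => (ham n).comp_fst
  -- the approximations of `D log F`
  set ξ : ℕ → Ω × ι → ℝ := fun n p => softInv (δ n) (F p.1) * d p with hξdef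
  have hξ : ∀ n, MemLp (ξ n) 2 (P.prod μ) := fun n =>
    memLp_two_smul_of_bounded (hamp n) (fun p => hac n _) hd
  have hξlim : ∀ᵐ p ∂(P.prod μ), Tendsto (fun n => ξ n p) atTop (𝓝 ((F p.1)⁻¹ * d p)) := by
    filter_upwards [hpos'] with p hp
    exact ((tendsto_softInv hp).comp hδ0).mul_const _
  have iΔ : ∀ n, Integrable (fun ω => softInv (δ n) (F ω) * Δ ω) P := fun n =>
    hΔi.bdd_mul (c := (δ n)⁻¹) (ham n) (ae_of_all _ fun ω => hac n _)
  have hslm : ∀ n, AEStronglyMeasurable (fun p : Ω × ι => softSlope (δ n) (F p.1)) (P.prod μ) := by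
    intro n
    have hc : Continuous (softSlope (δ n)) := by
      have h1 : Continuous fun x : ℝ => √(x ^ 2 + δ n ^ 2) := by fun_prop
      exact (continuous_const.add (continuous_id.div h1 fun x =>
        ((abs_nonneg x).trans_lt (abs_lt_sqrt_sq_add (hδ n) x)).ne')).div_const 2
    exact (hc.comp_aestronglyMeasurable hFm).comp_fst
  have isl : ∀ n, Integrable (fun p => softSlope (δ n) (F p.1) * ξ n p ^ 2) (P.prod μ) := fun n =>
    (hξ n).integrable_sq.bdd_mul (c := 1) (hslm n) (ae_of_all _ fun p => by
      obtain ⟨h1, h2⟩ := softSlope_mem (hδ n) (F p.1)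
      rwa [Real.norm_of_nonneg h1])
  have ibp : ∀ n, ∫ p, y p * ξ n p ∂(P.prod μ) = ∫ ω, softInv (δ n) (F ω) * Δ ω ∂P
      - ∫ p, softSlope (δ n) (F p.1) * ξ n p ^ 2 ∂(P.prod μ) := by
    intro n
    have h1 := integral_process_mul_comp_mul_derivAt hgauss hmean hχ hmeas hint H (contDiff_softInv (hδ n))
      (C := max (δ n)⁻¹ ((δ n)⁻¹ ^ 2)) (fun x => (hac n x).trans (le_max_left _ _))
      (fun x => (abs_deriv_softInv_le (hδ n) x).trans (le_max_right _ _))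
    rw [h1, sub_eq_add_neg, ← integral_neg]
    congr 2
    ext p
    rw [(hasDerivAt_softInv (hδ n) _).deriv]
    simp only [hξdef, hddef]
    ring
  set A := ∫ ω, max (Δ ω / F ω) 0 ∂P
  set N := ∫ p, y p ^ 2 ∂(P.prod μ)
  have hqle : ∀ n, ∀ᵐ ω ∂P, softInv (δ n) (F ω) * Δ ω ≤ max (Δ ω / F ω) 0 := by
    intro n
    filter_upwards [hpos] with ω hω
    rcases le_total 0 (Δ ω) with h0 | h0
    · refine le_trans ?_ (le_max_left _ _)
      rw [div_eq_inv_mul]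
      gcongr
      exact softInv_le_inv (hδ n) hω
    · exact (mul_nonpos_of_nonneg_of_nonpos (softInv_pos (hδ n) _).le h0).trans (le_max_right _ _)
  have hQ : ∀ n, ∫ ω, softInv (δ n) (F ω) * Δ ω ∂P ≤ A := fun n =>
    integral_mono_ae (iΔ n) hplus (hqle n)
  -- `|y ξ| ≤ y² + ξ² / 4`, where the constant `1 / 4` lets `hhalf` absorb the last term
  have hcs : ∀ n, |∫ p, y p * ξ n p ∂(P.prod μ)| ≤ N + (∫ p, ξ n p ^ 2 ∂(P.prod μ)) / 4 := by
    intro n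
    have h1 : Integrable (fun p => y p ^ 2 + ξ n p ^ 2 / 4) (P.prod μ) :=
      hy.integrable_sq.add ((hξ n).integrable_sq.div_const 4)
    have h2 := norm_integral_le_of_norm_le h1 (f := fun p => y p * ξ n p) (ae_of_all _ fun p => by
      rw [Real.norm_eq_abs, abs_le]
      constructor <;> nlinarith [sq_nonneg (y p + ξ n p / 2), sq_nonneg (y p - ξ n p / 2)])
    rw [integral_add hy.integrable_sq ((hξ n).integrable_sq.div_const 4), integral_div] at h2
    exact h2
  have hhalf : ∀ n, (∫ p, ξ n p ^ 2 ∂(P.prod μ)) / 2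
      ≤ ∫ p, softSlope (δ n) (F p.1) * ξ n p ^ 2 ∂(P.prod μ) := by
    intro n
    rw [← integral_div]
    refine integral_mono_ae ((hξ n).integrable_sq.div_const 2) (isl n) ?_
    filter_upwards [hpos'] with p hp
    have := half_le_softSlope hp (δ n)
    nlinarith [sq_nonneg (ξ n p)]
  have hbound : ∀ n, ∫ p, ξ n p ^ 2 ∂(P.prod μ) ≤ 4 * (A + N) := by
    intro n
    have h1 := ibp n
    have h2 := (abs_le.1 (hcs n)).1
    have h3 := hQ n
    have h4 := hhalf n
    linarith
  have hηm : AEStronglyMeasurable (fun p => (F p.1)⁻¹ * d p) (P.prod μ) :=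
    aestronglyMeasurable_of_tendsto_ae atTop (fun n => (hξ n).1) hξlim
  have hη : MemLp (fun p => (F p.1)⁻¹ * d p) 2 (P.prod μ) := by
    rw [memLp_two_iff_integrable_sq hηm]
    refine integrable_of_tendsto_of_integral_le (fun n => (hξ n).integrable_sq)
      (fun n => ae_of_all _ fun p => sq_nonneg _) hbound ?_
    filter_upwards [hξlim] with p hp
    exact hp.pow 2
  have hqlim : ∀ᵐ ω ∂P, Tendsto (fun n => softInv (δ n) (F ω) * Δ ω) atTop (𝓝 (Δ ω / F ω)) := by
    filter_upwards [hpos] with ω hω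
    rw [div_eq_inv_mul]
    exact ((tendsto_softInv hω).comp hδ0).mul_const _
  have iΔp : ∀ n, Integrable (fun ω => max (softInv (δ n) (F ω) * Δ ω) 0) P := fun n =>
    (iΔ n).pos_part
  have iΔm : ∀ n, Integrable (fun ω => max (-(softInv (δ n) (F ω) * Δ ω)) 0) P := fun n =>
    (iΔ n).neg_part
  have hpm : ∀ x : ℝ, max (-x) 0 = max x 0 - x := fun x => by
    rcases le_total 0 x with h0 | h0
    · rw [max_eq_right (by linarith), max_eq_left h0, sub_self]
    · rw [max_eq_left (by linarith), max_eq_right h0, zero_sub]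
  -- the negative parts have bounded expectations: `ibp` bounds `E[a(F) ΔF]` from below, and the
  -- positive parts are at most `(ΔF / F)⁺`
  have hminus : Integrable (fun ω => max (-(Δ ω / F ω)) 0) P := by
    refine integrable_of_tendsto_of_integral_le (K := A + N + (A + N)) iΔm
      (fun n => ae_of_all _ fun ω => le_max_right _ _) (fun n => ?_) ?_
    · simp only [hpm]
      rw [integral_sub (iΔp n) (iΔ n)]
      have h1 : ∫ ω, max (softInv (δ n) (F ω) * Δ ω) 0 ∂P ≤ A := by
        refine integral_mono_ae (iΔp n) hplus ?_
        filter_upwards [hqle n] with ω hω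
        exact max_le hω (le_max_right _ _)
      have h2 := ibp n
      have h3 := (abs_le.1 (hcs n)).1
      have h4 := hhalf n
      have h5 := hbound n
      have h6 : 0 ≤ ∫ p, ξ n p ^ 2 ∂(P.prod μ) := integral_nonneg fun p => sq_nonneg _
      linarith
    · filter_upwards [hqlim] with ω hω
      exact hω.neg.max tendsto_const_nhds
  have hΔF : Integrable (fun ω => Δ ω / F ω) P := by
    refine (hplus.sub hminus).congr (ae_of_all _ fun ω => ?_)
    simp only [Pi.sub_apply, hpm]
    ring
  refine ⟨hη, hΔF, ?_⟩
  have hξle : ∀ n, ∀ᵐ p ∂(P.prod μ), |ξ n p| ≤ |(F p.1)⁻¹ * d p| := by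
    intro n
    filter_upwards [hpos'] with p hp
    rw [abs_mul, abs_mul, abs_of_pos (softInv_pos (hδ n) _), abs_of_pos (inv_pos.2 hp)]
    gcongr
    exact softInv_le_inv (hδ n) hp
  have t1 : Tendsto (fun n => ∫ p, y p * ξ n p ∂(P.prod μ)) atTop
      (𝓝 (∫ p, y p * ((F p.1)⁻¹ * d p) ∂(P.prod μ))) := by
    refine tendsto_integral_of_dominated_convergence _ (fun n => hy.1.mul (hξ n).1)
      (hy.integrable_mul hη).norm (fun n => ?_) ?_
    · filter_upwards [hξle n] with p hp
      rw [norm_mul (y p) (ξ n p), Pi.mul_apply, norm_mul (y p)]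
      exact mul_le_mul_of_nonneg_left hp (norm_nonneg _)
    · filter_upwards [hξlim] with p hp
      exact hp.const_mul _
  have t2 : Tendsto (fun n => ∫ ω, softInv (δ n) (F ω) * Δ ω ∂P) atTop
      (𝓝 (∫ ω, Δ ω / F ω ∂P)) := by
    refine tendsto_integral_of_dominated_convergence _ (fun n => (iΔ n).1) hΔF.norm (fun n => ?_)
      hqlim
    filter_upwards [hpos] with ω hω
    rw [norm_mul, div_eq_inv_mul, norm_mul, Real.norm_of_nonneg (softInv_pos (hδ n) _).le,
      Real.norm_of_nonneg (inv_pos.2 hω).le]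
    exact mul_le_mul_of_nonneg_right (softInv_le_inv (hδ n) hω) (norm_nonneg _)
  have t3 : Tendsto (fun n => ∫ p, softSlope (δ n) (F p.1) * ξ n p ^ 2 ∂(P.prod μ)) atTop
      (𝓝 (∫ p, 1 * ((F p.1)⁻¹ * d p) ^ 2 ∂(P.prod μ))) := by
    refine tendsto_integral_of_dominated_convergence _ (fun n => (isl n).1)
      hη.integrable_sq (fun n => ?_) ?_
    · filter_upwards [hξle n] with p hp
      obtain ⟨h1, h2⟩ := softSlope_mem (hδ n) (F p.1)
      rw [Real.norm_of_nonneg (by positivity)]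
      calc _ ≤ 1 * ξ n p ^ 2 := by gcongr
        _ ≤ _ := by rw [one_mul]; exact sq_le_sq.2 hp
    · filter_upwards [hξlim, hpos'] with p hp hp'
      exact ((tendsto_softSlope hp').comp hδ0).mul (hp.pow 2)
  simp only [one_mul] at t3
  exact tendsto_nhds_unique t1 ((t2.sub t3).congr fun n => (ibp n).symm)

end LogDerivative

/-! ### The Laplacian of the square root -/

section SqrtLaplacian

variable {Ω ι : Type*} [MeasurableSpace Ω] {P : Measure Ω} [MeasurableSpace ι] {μ : Measure ι}
  {Y : ι → Ω → ℝ} {h : ℕ → GaussHilbert P Y} {χ : ι → GaussHilbert P Y}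

lemma ae_prod_eq_of_forall_ae_eq [SFinite P] [SFinite μ] {f g : Ω × ι → ℝ}
    (hf : AEStronglyMeasurable f (P.prod μ)) (hg : AEStronglyMeasurable g (P.prod μ))
    (hfg : ∀ t, ∀ᵐ ω ∂P, f (ω, t) = g (ω, t)) : f =ᵐ[P.prod μ] g := by
  have hm : AEMeasurable (fun p => ‖f p - g p‖ₑ) (P.prod μ) := (hf.sub hg).enorm
  have h0 : ∫⁻ p, ‖f p - g p‖ₑ ∂(P.prod μ) = 0 := by
    rw [lintegral_prod_symm _ hm]
    refine (lintegral_congr fun t => ?_).trans lintegral_zero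
    refine (lintegral_congr_ae ?_).trans lintegral_zero
    filter_upwards [hfg t] with ω hω
    simp [hω]
  rw [lintegral_eq_zero_iff' hm] at h0
  filter_upwards [h0] with p hp
  simpa [sub_eq_zero] using hp

variable {F : Ω → ℝ} {G : Ω → GaussHilbert P Y} {G2 : ι → Ω → GaussHilbert P Y}

lemma aestronglyMeasurable_sqrt_laplacian_integrand [IsProbabilityMeasure P] [IsFiniteMeasure μ]
    (hχ : ∀ t, gaussVar (χ t) =ᵐ[P] Y t)
    (hmeas : AEStronglyMeasurable (fun p : Ω × ι => Y p.2 p.1) (P.prod μ))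
    (H : IsTwiceMalliavin h μ F G G2) :
    AEStronglyMeasurable (fun p : Ω × ι =>
      -(1 / (4 * (F p.1 * √(F p.1)))) * derivAt G p.2 p.1 * derivAt G p.2 p.1
        + 1 / (2 * √(F p.1)) * derivAt (G2 p.2) p.2 p.1) (P.prod μ) := by
  have hd := aestronglyMeasurable_derivAt (μ := μ) hχ hmeas H.deriv.2.1.1
  have hdd := H.integrable.1
  have hF : AEMeasurable (fun p : Ω × ι => F p.1) (P.prod μ) :=
    (H.deriv.1.1.comp_fst (ν := μ)).aemeasurable
  have h1 : AEMeasurable (fun p : Ω × ι => -(1 / (4 * (F p.1 * √(F p.1))))) (P.prod μ) :=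
    (((hF.mul hF.sqrt).const_mul 4).const_div 1).neg
  have h2 : AEMeasurable (fun p : Ω × ι => 1 / (2 * √(F p.1))) (P.prod μ) :=
    (hF.sqrt.const_mul 2).const_div 1
  exact ((h1.aestronglyMeasurable.mul hd).mul hd).add (h2.aestronglyMeasurable.mul hdd)

lemma integral_sqrt_laplacian_integrand {f g : ι → ℝ} (hf : Integrable (fun t => f t ^ 2) μ)
    (hg : Integrable g μ) (a b : ℝ) :
    Integrable (fun t => a * f t * f t + b * g t) μ ∧
      ∫ t, (a * f t * f t + b * g t) ∂μ = a * ∫ t, f t ^ 2 ∂μ + b * ∫ t, g t ∂μ := by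
  have e : (fun t => a * f t * f t + b * g t) = fun t => a * f t ^ 2 + b * g t := by
    ext t; ring
  rw [e]
  refine ⟨(hf.const_mul a).add (hg.const_mul b), ?_⟩
  rw [integral_add (hf.const_mul a) (hg.const_mul b), integral_const_mul, integral_const_mul]

lemma IsTwiceMalliavin.exists_hasLocalLaplacian_sqrt [IsProbabilityMeasure P] [IsFiniteMeasure μ]
    (hχ : ∀ t, gaussVar (χ t) =ᵐ[P] Y t)
    (hmeas : AEStronglyMeasurable (fun p : Ω × ι => Y p.2 p.1) (P.prod μ))
    (hint : Integrable (fun t => ‖χ t‖ ^ 2) μ) (H : IsTwiceMalliavin h μ F G G2)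
    (hpos : ∀ᵐ ω ∂P, 0 < F ω) :
    ∃ L, HasLocalLaplacian h μ (fun ω => √(F ω)) L := by
  refine ⟨_, fun ω => (1 / (2 * √(F ω))) • G ω, fun t ω =>
    (-(1 / (4 * (F ω * √(F ω)))) * derivAt G t ω) • G ω + (1 / (2 * √(F ω))) • G2 t ω,
    H.deriv.hasLocal_sqrt hpos, fun t => ?_, ?_, ?_, EventuallyEq.rfl⟩
  · rw [funext (derivAt_smul hχ _ G t)]
    exact H.deriv.hasLocal_div_sqrt (H.deriv_deriv t) hpos
  · simp only [derivAt_smul_add_smul hχ]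
    exact aestronglyMeasurable_sqrt_laplacian_integrand hχ hmeas H
  · simp only [derivAt_smul_add_smul hχ]
    filter_upwards [H.integrable.prod_right_ae] with ω hω
    exact (integral_sqrt_laplacian_integrand (integrable_derivAt_sq hχ hmeas hint G ω) hω _ _).1

/-- The formula `Δ√F = ΔF / (2√F) - ‖DF‖² / (4 F √F)`. -/
lemma HasLocalLaplacian.sqrt_ae_eq [IsProbabilityMeasure P] [IsFiniteMeasure μ]
    (hgauss : IsGaussianProcess Y P) (hmean : ∀ t, ∫ ω, Y t ω ∂P = 0)
    (htotal : (Submodule.span ℝ (Set.range h)).topologicalClosure = ⊤)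
    (hχ : ∀ t, gaussVar (χ t) =ᵐ[P] Y t)
    (hmeas : AEStronglyMeasurable (fun p : Ω × ι => Y p.2 p.1) (P.prod μ))
    (hint : Integrable (fun t => ‖χ t‖ ^ 2) μ) {L : Ω → ℝ}
    (HL : HasLocalLaplacian h μ (fun ω => √(F ω)) L) (H : IsTwiceMalliavin h μ F G G2)
    (hpos : ∀ᵐ ω ∂P, 0 < F ω) :
    ∀ᵐ ω ∂P, L ω = -(1 / (4 * (F ω * √(F ω)))) * ∫ t, derivAt G t ω ^ 2 ∂μ
      + 1 / (2 * √(F ω)) * traceDeriv μ G2 ω := by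
  obtain ⟨V, V2, hV, hV2, hm2, -, hL⟩ := HL
  have hVeq := hV.ae_eq hgauss hmean htotal (H.deriv.hasLocal_sqrt hpos) EventuallyEq.rfl
  have hV2eq : ∀ t, ∀ᵐ ω ∂P, derivAt (V2 t) t ω
      = -(1 / (4 * (F ω * √(F ω)))) * derivAt G t ω * derivAt G t ω
        + 1 / (2 * √(F ω)) * derivAt (G2 t) t ω := by
    intro t
    have e1 : derivAt V t =ᵐ[P] fun ω => 1 / (2 * √(F ω)) * derivAt G t ω := by
      filter_upwards [hVeq] with ω hω
      rw [← derivAt_smul hχ (fun ω => 1 / (2 * √(F ω))), derivAt, derivAt, hω]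
    have e2 := (hV2 t).ae_eq hgauss hmean htotal
      (H.deriv.hasLocal_div_sqrt (H.deriv_deriv t) hpos) e1
    filter_upwards [e2] with ω hω
    rw [← derivAt_smul_add_smul hχ (fun ω => -(1 / (4 * (F ω * √(F ω)))) * derivAt G t ω)
      (fun ω => 1 / (2 * √(F ω))), derivAt, derivAt, hω]
  have hall := ae_prod_eq_of_forall_ae_eq hm2
    (aestronglyMeasurable_sqrt_laplacian_integrand hχ hmeas H) hV2eq
  filter_upwards [hL, Measure.ae_ae_of_ae_prod hall, H.integrable.prod_right_ae]
    with ω h1 h2 h3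
  rw [h1, traceDeriv, integral_congr_ae h2,
    (integral_sqrt_laplacian_integrand (integrable_derivAt_sq hχ hmeas hint G ω) h3 _ _).2]
  rfl

end SqrtLaplacian

/-! ### Quadratic risks -/

section Risk

variable {Ω ι : Type*} [MeasurableSpace Ω] {P : Measure Ω} [MeasurableSpace ι] {μ : Measure ι}
  {Y : ι → Ω → ℝ} {h : ℕ → GaussHilbert P Y} {χ : ι → GaussHilbert P Y}

/-- Expansion of the square in the risk of `X + ζ`. -/
lemma quadRisk_add [IsProbabilityMeasure P] [IsFiniteMeasure μ]
    (hχ : ∀ t, gaussVar (χ t) =ᵐ[P] Y t)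
    (hmeas : AEStronglyMeasurable (fun p : Ω × ι => Y p.2 p.1) (P.prod μ))
    (hint : Integrable (fun t => ‖χ t‖ ^ 2) μ) {X u : ι → Ω → ℝ}
    (hY : ∀ t ω, Y t ω = X t ω - u t ω) {ζ : ι → Ω → ℝ}
    (hζ : MemLp (fun p : Ω × ι => ζ p.2 p.1) 2 (P.prod μ)) :
    MemLp (fun p : Ω × ι => X p.2 p.1 + ζ p.2 p.1 - u p.2 p.1) 2 (P.prod μ) ∧
    quadRisk P μ (fun t ω => X t ω + ζ t ω) u = ∫ t, ‖χ t‖ ^ 2 ∂μ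
      + ∫ p : Ω × ι, ζ p.2 p.1 ^ 2 ∂(P.prod μ)
      + 2 * ∫ p : Ω × ι, Y p.2 p.1 * ζ p.2 p.1 ∂(P.prod μ) := by
  obtain ⟨hy, hyn⟩ := memLp_process (μ := μ) hχ hmeas hint
  have e : ∀ t ω, X t ω + ζ t ω - u t ω = Y t ω + ζ t ω := fun t ω => by rw [hY]; ring
  have hsum : MemLp (fun p : Ω × ι => Y p.2 p.1 + ζ p.2 p.1) 2 (P.prod μ) := hy.add hζ
  simp only [quadRisk, e]
  refine ⟨hsum, ?_⟩
  have h1 := integral_prod _ hsum.integrable_sq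
  simp only at h1
  rw [← h1, ← hyn]
  have i1 : Integrable (fun p : Ω × ι => Y p.2 p.1 * ζ p.2 p.1) (P.prod μ) := hy.integrable_mul hζ
  rw [← integral_const_mul, ← integral_add hy.integrable_sq hζ.integrable_sq]
  have i2 : Integrable (fun p : Ω × ι => Y p.2 p.1 ^ 2 + ζ p.2 p.1 ^ 2) (P.prod μ) :=
    hy.integrable_sq.add hζ.integrable_sq
  rw [← integral_add i2 (i1.const_mul 2)]
  congr 1; ext p; ring

lemma integral_nonpos_iff_of_sign {f L S : Ω → ℝ} (hf : Integrable f P)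
    (hS : ∀ᵐ ω ∂P, 0 < S ω) (hfL : ∀ᵐ ω ∂P, f ω = L ω / S ω) (hL : ∀ᵐ ω ∂P, L ω ≤ 0) :
    ∫ ω, f ω ∂P ≤ 0 ∧ (∫ ω, f ω ∂P < 0 ↔ ¬ ∀ᵐ ω ∂P, L ω = 0) := by
  have hf0 : ∀ᵐ ω ∂P, f ω ≤ 0 := by
    filter_upwards [hS, hfL, hL] with ω h1 h2 h3
    rw [h2]; exact div_nonpos_of_nonpos_of_nonneg h3 h1.le
  have hle : ∫ ω, f ω ∂P ≤ 0 := integral_nonpos_of_ae hf0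
  refine ⟨hle, ?_⟩
  rw [lt_iff_le_and_ne, and_iff_right hle, ne_eq, not_iff_not]
  have h1 : ∫ ω, f ω ∂P = 0 ↔ ∫ ω, -f ω ∂P = 0 := by rw [integral_neg, neg_eq_zero]
  have hneg : 0 ≤ᵐ[P] fun ω => -f ω := by
    filter_upwards [hf0] with ω hω
    simpa using hω
  rw [h1, integral_eq_zero_iff_of_nonneg_ae hneg hf.neg]
  constructor
  · intro h2
    filter_upwards [h2, hfL, hS] with ω a b c
    simp only [Pi.zero_apply, neg_eq_zero] at a
    rw [b, div_eq_zero_iff] at a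
    exact a.resolve_right c.ne'
  · intro h2
    filter_upwards [h2, hfL] with ω a b
    simp [b, a]

end Risk


/-! ### The risk of Stein-type estimators -/

theorem theorem3p6 {Ω : Type*} [MeasurableSpace Ω] (P : Measure Ω) [IsProbabilityMeasure P]
    (T : ℝ) (hT : 0 < T)
    (μ : Measure (Set.Icc (0 : ℝ) T)) [IsFiniteMeasure μ]
    (γ : Set.Icc (0 : ℝ) T → Set.Icc (0 : ℝ) T → ℝ)
    -- the observed process `X`, its drift `u`, and the centered Gaussian process `Y = X - u`
    (X u Y : Set.Icc (0 : ℝ) T → Ω → ℝ)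
    (hY : ∀ t ω, Y t ω = X t ω - u t ω)
    (hgauss : IsGaussianProcess Y P)
    (hmean : ∀ t, ∫ ω, Y t ω ∂P = 0)
    (hcov : ∀ s t, ∫ ω, Y s ω * Y t ω ∂P = γ s t)
    (hmeas : AEStronglyMeasurable (fun p : Ω × Set.Icc (0 : ℝ) T => Y p.2 p.1) (P.prod μ))
    (hγ : Integrable (fun t => γ t t) μ)
    (h : ℕ → GaussHilbert P Y)
    (htotal : (Submodule.span ℝ (Set.range h)).topologicalClosure = ⊤) :
    quadRisk P μ X u = ∫ t, γ t t ∂μ ∧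
    -- (i)
    (∀ (ξ : Set.Icc (0 : ℝ) T → Ω → ℝ) (Dξ : Set.Icc (0 : ℝ) T → Ω → GaussHilbert P Y),
      MemLp (fun p : Ω × Set.Icc (0 : ℝ) T => ξ p.2 p.1) 2 (P.prod μ) →
      (∀ t, HasMalliavinDeriv h (ξ t) (Dξ t)) →
      Integrable (fun p : Ω × Set.Icc (0 : ℝ) T => derivAt (Dξ p.2) p.2 p.1) (P.prod μ) →
      MemLp (fun p : Ω × Set.Icc (0 : ℝ) T => X p.2 p.1 + ξ p.2 p.1 - u p.2 p.1) 2 (P.prod μ) ∧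
      quadRisk P μ (fun t ω => X t ω + ξ t ω) u
        = ∫ t, γ t t ∂μ + ∫ ω, ∫ t, (ξ t ω) ^ 2 ∂μ ∂P + 2 * ∫ ω, traceDeriv μ Dξ ω ∂P) ∧
    -- (ii)
    (∀ (F : Ω → ℝ) (DF : Ω → GaussHilbert P Y) (D2F : Set.Icc (0 : ℝ) T → Ω → GaussHilbert P Y),
      (∀ᵐ ω ∂P, 0 < F ω) →
      IsTwiceMalliavin h μ F DF D2F →
      -- `D log F` and `Δ√F` exist locally
      (∃ V, HasLocalMalliavinDeriv h (fun ω => Real.log (F ω)) V) ∧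
      (∀ V, HasLocalMalliavinDeriv h (fun ω => Real.log (F ω)) V →
        ∀ᵐ ω ∂P, V ω = (F ω)⁻¹ • DF ω) ∧
      (∃ L, HasLocalLaplacian h μ (fun ω => √(F ω)) L) ∧
      -- both expressions of the risk
      (Integrable (fun ω => max (traceDeriv μ D2F ω / F ω) 0) P →
        ∀ V, HasLocalMalliavinDeriv h (fun ω => Real.log (F ω)) V →
        ∀ L, HasLocalLaplacian h μ (fun ω => √(F ω)) L →
        MemLp (fun p : Ω × Set.Icc (0 : ℝ) T => derivAt V p.2 p.1) 2 (P.prod μ) ∧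
        Integrable (fun ω => traceDeriv μ D2F ω / F ω) P ∧
        Integrable (fun ω => L ω / √(F ω)) P ∧
        quadRisk P μ (fun t ω => X t ω + derivAt V t ω) u
          = ∫ t, γ t t ∂μ - ∫ ω, ∫ t, (derivAt V t ω) ^ 2 ∂μ ∂P
            + 2 * ∫ ω, traceDeriv μ D2F ω / F ω ∂P ∧
        quadRisk P μ (fun t ω => X t ω + derivAt V t ω) u
          = ∫ t, γ t t ∂μ + 4 * ∫ ω, L ω / √(F ω) ∂P ∧
        ((∀ᵐ ω ∂P, L ω ≤ 0) →
          quadRisk P μ (fun t ω => X t ω + derivAt V t ω) u ≤ ∫ t, γ t t ∂μ ∧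
          (quadRisk P μ (fun t ω => X t ω + derivAt V t ω) u < ∫ t, γ t t ∂μ ↔
            ¬ ∀ᵐ ω ∂P, L ω = 0))) ∧
      -- superefficiency for `√F` superharmonic, without any condition on `ΔF / F`
      (∀ (DG : Ω → GaussHilbert P Y) (D2G : Set.Icc (0 : ℝ) T → Ω → GaussHilbert P Y),
        IsTwiceMalliavin h μ (fun ω => √(F ω)) DG D2G →
        (∀ᵐ ω ∂P, traceDeriv μ D2G ω ≤ 0) →
        ∀ V, HasLocalMalliavinDeriv h (fun ω => Real.log (F ω)) V →
        MemLp (fun p : Ω × Set.Icc (0 : ℝ) T => derivAt V p.2 p.1) 2 (P.prod μ) ∧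
        quadRisk P μ (fun t ω => X t ω + derivAt V t ω) u ≤ ∫ t, γ t t ∂μ ∧
        (quadRisk P μ (fun t ω => X t ω + derivAt V t ω) u < ∫ t, γ t t ∂μ ↔
          ¬ ∀ᵐ ω ∂P, traceDeriv μ D2G ω = 0))) := by
  obtain ⟨χ, hχ⟩ := exists_gaussVar_eq hgauss
  have hχn : ∀ t, ‖χ t‖ ^ 2 = γ t t := norm_sq_eq_of_cov hχ hcov
  have hint : Integrable (fun t => ‖χ t‖ ^ 2) μ := by simpa only [hχn] using hγ
  have hR : ∀ ζ : Set.Icc (0 : ℝ) T → Ω → ℝ,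
      MemLp (fun p : Ω × Set.Icc (0 : ℝ) T => ζ p.2 p.1) 2 (P.prod μ) →
      MemLp (fun p : Ω × Set.Icc (0 : ℝ) T => X p.2 p.1 + ζ p.2 p.1 - u p.2 p.1) 2 (P.prod μ) ∧
      quadRisk P μ (fun t ω => X t ω + ζ t ω) u = ∫ t, γ t t ∂μ
        + ∫ p : Ω × Set.Icc (0 : ℝ) T, ζ p.2 p.1 ^ 2 ∂(P.prod μ)
        + 2 * ∫ p : Ω × Set.Icc (0 : ℝ) T, Y p.2 p.1 * ζ p.2 p.1 ∂(P.prod μ) := by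
    intro ζ hζ
    have := quadRisk_add hχ hmeas hint hY hζ
    simpa only [hχn] using this
  obtain ⟨hy, -⟩ := memLp_process (μ := μ) hχ hmeas hint
  refine ⟨?_, ?_, ?_⟩
  · have := (hR (fun _ _ => 0) MemLp.zero).2
    simpa using this
  · intro ξ Dξ hξ hDξ hi
    refine ⟨(hR ξ hξ).1, ?_⟩
    rw [(hR ξ hξ).2, integral_prod _ hξ.integrable_sq]
    have i1 : Integrable (fun p : Ω × Set.Icc (0 : ℝ) T => Y p.2 p.1 * ξ p.2 p.1) (P.prod μ) :=
      hy.integrable_mul hξ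
    have key : ∀ t, ∫ ω, Y t ω * ξ t ω ∂P = ∫ ω, derivAt (Dξ t) t ω ∂P := by
      intro t
      simp only [derivAt_eq_inner hχ]
      rw [← (hDξ t).integral_mul_gaussVar hgauss hmean (χ t)]
      refine integral_congr_ae ?_
      filter_upwards [hχ t] with ω hω
      rw [hω, mul_comm]
    have h1 : ∫ p : Ω × Set.Icc (0 : ℝ) T, Y p.2 p.1 * ξ p.2 p.1 ∂(P.prod μ)
        = ∫ ω, traceDeriv μ Dξ ω ∂P := by
      rw [integral_prod_symm _ i1]
      simp only [key, traceDeriv]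
      rw [← integral_prod _ hi, integral_prod_symm _ hi]
    rw [h1]
  · intro F DF D2F hpos H
    have hlog := H.deriv.hasLocal_log hpos
    have hVeq : ∀ V, HasLocalMalliavinDeriv h (fun ω => Real.log (F ω)) V →
        ∀ᵐ ω ∂P, V ω = (F ω)⁻¹ • DF ω := fun V hV =>
      hV.ae_eq hgauss hmean htotal hlog EventuallyEq.rfl
    refine ⟨⟨_, hlog⟩, hVeq, H.exists_hasLocalLaplacian_sqrt hχ hmeas hint hpos, ?_, ?_⟩
    · intro hplus V hV L hL
      obtain ⟨hη, hΔ, hibp⟩ := integral_process_mul_log_deriv hgauss hmean hχ hmeas hint H hpos hplus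
      have hVd : ∀ᵐ ω ∂P, ∀ t, derivAt V t ω = (F ω)⁻¹ * derivAt DF t ω := by
        filter_upwards [hVeq V hV] with ω hω t
        rw [← derivAt_smul hχ (fun ω => (F ω)⁻¹), derivAt, derivAt, hω]
      have hVp : (fun p : Ω × Set.Icc (0 : ℝ) T => derivAt V p.2 p.1) =ᵐ[P.prod μ]
          fun p => (F p.1)⁻¹ * derivAt DF p.2 p.1 := by
        filter_upwards [Measure.quasiMeasurePreserving_fst.ae hVd] with p hp
        exact hp p.2
      have hVm : MemLp (fun p : Ω × Set.Icc (0 : ℝ) T => derivAt V p.2 p.1) 2 (P.prod μ) :=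
        (memLp_congr_ae hVp).2 hη
      have hsq := integral_prod _ hVm.integrable_sq
      have hsqη : ∫ p : Ω × Set.Icc (0 : ℝ) T, derivAt V p.2 p.1 ^ 2 ∂(P.prod μ)
          = ∫ p : Ω × Set.Icc (0 : ℝ) T, ((F p.1)⁻¹ * derivAt DF p.2 p.1) ^ 2 ∂(P.prod μ) := by
        refine integral_congr_ae ?_
        filter_upwards [hVp] with p hp
        rw [hp]
      have hYV : ∫ p : Ω × Set.Icc (0 : ℝ) T, Y p.2 p.1 * derivAt V p.2 p.1 ∂(P.prod μ)
          = ∫ ω, traceDeriv μ D2F ω / F ω ∂P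
            - ∫ p : Ω × Set.Icc (0 : ℝ) T, derivAt V p.2 p.1 ^ 2 ∂(P.prod μ) := by
        rw [hsqη, ← hibp]
        refine integral_congr_ae ?_
        filter_upwards [hVp] with p hp
        rw [hp]
      have hLae : ∀ᵐ ω ∂P, L ω / √(F ω) = (1 / 2) * (traceDeriv μ D2F ω / F ω)
          - (1 / 4) * ∫ t, derivAt V t ω ^ 2 ∂μ := by
        filter_upwards [hL.sqrt_ae_eq hgauss hmean htotal hχ hmeas hint H hpos, hVd, hpos]
          with ω h1 h2 h3
        have h4 := Real.sqrt_pos.2 h3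
        have h5 : √(F ω) ^ 2 = F ω := Real.sq_sqrt h3.le
        simp only [h1, h2, mul_pow, integral_const_mul]
        field_simp
        rw [h5]
        ring
      have iV : Integrable (fun ω => ∫ t, derivAt V t ω ^ 2 ∂μ) P :=
        hVm.integrable_sq.integral_prod_left
      have iL : Integrable (fun ω => L ω / √(F ω)) P := by
        refine Integrable.congr ((hΔ.const_mul (1 / 2)).sub (iV.const_mul (1 / 4))) ?_
        filter_upwards [hLae] with ω hω
        rw [hω]; rfl
      have hLint : ∫ ω, L ω / √(F ω) ∂P = (1 / 2) * ∫ ω, traceDeriv μ D2F ω / F ω ∂P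
          - (1 / 4) * ∫ ω, ∫ t, derivAt V t ω ^ 2 ∂μ ∂P := by
        rw [integral_congr_ae hLae, integral_sub (hΔ.const_mul (1 / 2)) (iV.const_mul (1 / 4)),
          integral_const_mul, integral_const_mul]
      have hrisk := (hR (derivAt V) hVm).2
      rw [hYV, hsq] at hrisk
      simp only at hrisk
      have hrisk2 : quadRisk P μ (fun t ω => X t ω + derivAt V t ω) u
          = ∫ t, γ t t ∂μ + 4 * ∫ ω, L ω / √(F ω) ∂P := by
        rw [hrisk, hLint]; ring
      refine ⟨hVm, hΔ, iL, by rw [hrisk]; ring, hrisk2, fun hL0 => ?_⟩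
      obtain ⟨h1, h2⟩ := integral_nonpos_iff_of_sign iL (S := fun ω => √(F ω)) (L := L)
        (by filter_upwards [hpos] with ω hω using Real.sqrt_pos.2 hω) (ae_of_all _ fun _ => rfl) hL0
      rw [hrisk2, ← h2]
      exact ⟨by linarith, ⟨fun h3 => by linarith, fun h3 => by linarith⟩⟩
    · intro DG D2G HS hΔ0 V hV
      have hSpos : ∀ᵐ ω ∂P, 0 < √(F ω) := by
        filter_upwards [hpos] with ω hω using Real.sqrt_pos.2 hω
      -- the integrability condition is automatic for `√F`, and `log F = 2 log √F`
      have hplus : Integrable (fun ω => max (traceDeriv μ D2G ω / √(F ω)) 0) P := by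
        refine (integrable_zero Ω ℝ P).congr ?_
        filter_upwards [hΔ0, hSpos] with ω h1 h2
        exact (max_eq_right (div_nonpos_of_nonpos_of_nonneg h1 h2.le)).symm
      obtain ⟨hη, hΔ, hibp⟩ := integral_process_mul_log_deriv hgauss hmean hχ hmeas hint HS hSpos
        hplus
      have hloc := HS.deriv.hasLocal_comp hSpos (g := fun x => 2 * Real.log x)
        (g' := fun x => 2 * x⁻¹)
        (contDiffOn_const.mul (Real.contDiffOn_log.mono fun _ hx => (Set.mem_Ioi.1 hx).ne'))
        (fun x hx => (Real.hasDerivAt_log hx.ne').const_mul 2)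
      have hVe := hV.ae_eq hgauss hmean htotal hloc (by
        filter_upwards [hpos] with ω hω
        simp only [Real.log_sqrt hω.le]; ring)
      have hVp : (fun p : Ω × Set.Icc (0 : ℝ) T => derivAt V p.2 p.1) =ᵐ[P.prod μ]
          fun p => 2 * ((√(F p.1))⁻¹ * derivAt DG p.2 p.1) := by
        filter_upwards [Measure.quasiMeasurePreserving_fst.ae hVe] with p hp
        rw [← mul_assoc, ← derivAt_smul hχ (fun ω => 2 * (√(F ω))⁻¹), derivAt, derivAt, hp]
      have hVm : MemLp (fun p : Ω × Set.Icc (0 : ℝ) T => derivAt V p.2 p.1) 2 (P.prod μ) :=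
        (memLp_congr_ae hVp).2 (hη.const_mul 2)
      have hsq : ∫ p : Ω × Set.Icc (0 : ℝ) T, derivAt V p.2 p.1 ^ 2 ∂(P.prod μ)
          = 4 * ∫ p : Ω × Set.Icc (0 : ℝ) T, ((√(F p.1))⁻¹ * derivAt DG p.2 p.1) ^ 2
            ∂(P.prod μ) := by
        rw [← integral_const_mul]
        refine integral_congr_ae ?_
        filter_upwards [hVp] with p hp
        rw [hp]; ring
      have hYV : ∫ p : Ω × Set.Icc (0 : ℝ) T, Y p.2 p.1 * derivAt V p.2 p.1 ∂(P.prod μ)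
          = 2 * ∫ p : Ω × Set.Icc (0 : ℝ) T, Y p.2 p.1 * ((√(F p.1))⁻¹ * derivAt DG p.2 p.1)
            ∂(P.prod μ) := by
        rw [← integral_const_mul]
        refine integral_congr_ae ?_
        filter_upwards [hVp] with p hp
        rw [hp]; ring
      have hrisk : quadRisk P μ (fun t ω => X t ω + derivAt V t ω) u
          = ∫ t, γ t t ∂μ + 4 * ∫ ω, traceDeriv μ D2G ω / √(F ω) ∂P := by
        rw [(hR (derivAt V) hVm).2, hsq, hYV, hibp]; ring
      obtain ⟨h1, h2⟩ := integral_nonpos_iff_of_sign hΔ hSpos (ae_of_all _ fun _ => rfl) hΔ0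
      rw [hrisk, ← h2]
      exact ⟨hVm, by linarith, ⟨fun h3 => by linarith, fun h3 => by linarith⟩⟩
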